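/- **Setting.** Let $\mathcal H$ be a complex Hilbert space and $H$ a self-adjoint operator in $\mathcal H$ with domain $\mathcal G^2$ and form domain $\mathcal G^1=D(|H|^{1/2})$, both with graph norms; $\mathcal G^{-1}$ is the topological antidual of $\mathcal G^1$. Let $W_t=e^{itA}$, $t\in\mathbb R$, be a strongly continuous unitary group in $\mathcal H$ that leaves $\mathcal G^2$ invariant. Assume that $H\in C^1(A;\mathcal G^2,\mathcal H)$, i.e. $t\mapsto W_{-t}HW_tf\in\mathcal H$ is differentiable for every $f\in\mathcal G^2$, and let $[iH,A]\in\mathscr B(\mathcal G^2,\mathcal H)$ be the derivative at $t=0$; like every symmetric operator in $\mathscr B(\mathcal G^2,\mathcal H)$ it has a unique extension in $\mathscr B(\mathcal G^1,\mathcal G^{-1})$, denoted by the same letter. Assume that there are constants $c_1>0$ and $c_2>0$ such that $$S:=-c_1H+[iH,A]>0\qquad\text{and}\qquad [iH,A]\ge -c_2 ,$$ where $S>0$ means $\langle f,Sf\rangle>0$ for all $f\in\mathcal G^1\setminus\{0\}$. Let $\mathcal S$ be the completion of $\mathcal G^1$ in the norm $\langle f,Sf\rangle^{1/2}$, and $\mathcal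 S^*$ its antidual. Assume that $\{W_t\}$ extends to a $C_0$-group in $\mathcal S$; by duality it also acts as a $C_0$-group in $\mathcal S^*$, and $D(A,\mathcal S^*)$ denotes the domain of the generator of the latter, with the graph norm. Assume finally that $[iH,A]$ extends to an operator $B\in\mathscr B(\mathcal S,\mathcal S^*)$ of class $C^1(A;\mathcal S,\mathcal S^*)$, i.e. $t\mapsto W_{-t}BW_tx\in\mathcal S^*$ is differentiable for every $x\in\mathcal S$. Let $\mathcal E:=(D(A,\mathcal S^*),\mathcal S^*)_{1/2,1}$ (real interpolation), let $\mathcal E^*$ be its antidual, and let $(\mathcal E^*)^\circ$ be the closure of $\mathcal S$ in $\mathcal E^*$. **Claim.** (i) Every $T\in\mathscr B\big((\mathcal E^*)^\circ,\mathcal H\big)$, regarded as an operator in $\mathcal H$ through $\mathcal G^2\subset\mathcal G^1\subset\mathcal S\subset(\mathcal E^*)^\circ$, is $H$-smooth on $[0,\infty)$: there is $C<\infty$ such that for all $f$ in the range of the spectral projection of $H$ on $[0,\infty)$ and all $\varepsilon>0$ $$\int_{\mathbb R}\Big(\|T(H-\lambda-i\varepsilon)^{-1}f\|^2+\|T(H-\lambda+i\varepsilon)^{-1}f\|^2\Big)\,d\lambda\le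 C\|f\|^2 .$$ (ii) The spectrum of $H$ on $[0,\infty)$ is purely absolutely continuous: the spectral projection of $H$ on any Borel set $N\subset[0,\infty)$ of Lebesgue measure zero vanishes. -/

import Mathlib

open Filter Topology MeasureTheory Set
open scoped ENNReal NNReal

namespace WeakConj

noncomputable section

/-! ### One-parameter groups, graph norms, antiduals, real interpolation -/

/-- A strongly continuous one-parameter group (a `C₀`-group) of bounded operators. -/
structure IsC0Group {X : Type*} [NormedAddCommGroup X] [NormedSpace ℂ X]
    (U : ℝ → X →L[ℂ] X) : Prop where
  map_zero : U 0 = ContinuousLinearMap.id ℂ X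
  map_add : ∀ s t, U (s + t) = (U s).comp (U t)
  continuous : ∀ x, Continuous fun t => U t x

/-- The topological antidual: bounded conjugate-linear functionals, with the operator norm. -/
abbrev AntiDual (V : Type*) [SeminormedAddCommGroup V] [NormedSpace ℂ V] : Type _ := V →L⋆[ℂ] ℂ

/-- The domain of an (unbounded) operator, endowed with the graph norm
`(‖x‖² + ‖K x‖²)^{1/2}`. -/
def GraphSpace {X : Type*} [NormedAddCommGroup X] [NormedSpace ℂ X] (K : X →ₗ.[ℂ] X) : Type _ :=
  K.domain

namespace GraphSpace

variable {X : Type*} [NormedAddCommGroup X] [NormedSpace ℂ X] (K : X →ₗ.[ℂ] X)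

instance : AddCommGroup (GraphSpace K) := inferInstanceAs (AddCommGroup K.domain)
instance : Module ℂ (GraphSpace K) := inferInstanceAs (Module ℂ K.domain)

/-- The inclusion of the domain in the whole space, as a linear map. -/
def inclₗ : GraphSpace K →ₗ[ℂ] X := K.domain.subtype

/-- The action of the operator on its domain. -/
def act : GraphSpace K →ₗ[ℂ] X := K.toFun

/-- The map `x ↦ (x, K x)`. -/
def toPair : GraphSpace K →ₗ[ℂ] WithLp 2 (X × X) :=
  (WithLp.linearEquiv 2 ℂ (X × X)).symm.toLinearMap ∘ₗ (inclₗ K).prod (act K)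

theorem inclₗ_injective : Function.Injective (inclₗ K) := Subtype.val_injective

theorem toPair_injective : Function.Injective (toPair K) := by
  intro x y h
  have h' := congrArg (fun p => (WithLp.ofLp p).1) h
  exact inclₗ_injective K h'

instance : NormedAddCommGroup (GraphSpace K) :=
  NormedAddCommGroup.induced _ _ (toPair K) (toPair_injective K)

instance : NormedSpace ℂ (GraphSpace K) := NormedSpace.induced ℂ _ _ (toPair K)

theorem norm_def (x : GraphSpace K) : ‖x‖ = √(‖inclₗ K x‖ ^ 2 + ‖act K x‖ ^ 2) := by
  change ‖toPair K x‖ = _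
  rw [WithLp.prod_norm_eq_of_L2]
  rfl

theorem norm_incl_le (x : GraphSpace K) : ‖inclₗ K x‖ ≤ ‖x‖ := by
  rw [norm_def]
  exact Real.le_sqrt_of_sq_le (by nlinarith [sq_nonneg ‖act K x‖])

/-- The continuous inclusion of the domain (with the graph norm) in the whole space. -/
def incl : GraphSpace K →L[ℂ] X :=
  (inclₗ K).mkContinuous 1 fun x => by simpa using norm_incl_le K x

end GraphSpace

/-- The generator `A` of a `C₀`-group `U t = e^{itA}`: its domain consists of the
vectors with differentiable orbit, and `A x = -i (d/dt) U t x` at `t = 0`. -/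
def generator {X : Type*} [NormedAddCommGroup X] [NormedSpace ℂ X] (U : ℝ → X →L[ℂ] X) :
    X →ₗ.[ℂ] X where
  domain :=
    { carrier := {x | DifferentiableAt ℝ (fun t => U t x) 0}
      zero_mem' := by simp
      add_mem' := fun {x y} hx hy => by
        simpa only [mem_ofPred_eq, _root_.map_add] using DifferentiableAt.fun_add hx hy
      smul_mem' := fun c x hx => by
        simpa only [mem_ofPred_eq, _root_.map_smul] using
          DifferentiableAt.fun_const_smul (R := ℂ) hx c }
  toFun :=
    { toFun := fun x => -Complex.I • deriv (fun t => U t (x : X)) 0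
      map_add' := fun x y => by
        have h := deriv_fun_add (f := fun t => U t (x : X)) (g := fun t => U t (y : X)) x.2 y.2
        simp only [Submodule.coe_add, _root_.map_add, h, smul_add]
      map_smul' := fun c x => by
        have h := deriv_fun_const_smul (R := ℂ) c (f := fun t => U t (x : X)) x.2
        simp only [Submodule.coe_smul, _root_.map_smul, h, RingHom.id_apply]
        rw [smul_comm] }

/-- The group induced on the antidual: `⟨x, U t φ⟩ = ⟨U (-t) x, φ⟩`. -/
def dualGroup {X : Type*} [SeminormedAddCommGroup X] [NormedSpace ℂ X] (U : ℝ → X →L[ℂ] X)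
    (t : ℝ) : AntiDual X →L[ℂ] AntiDual X :=
  (ContinuousLinearMap.compSL X X ℂ (RingHom.id ℂ) (starRingEnd ℂ)).flip (U (-t))

section Interpolation

variable {Y X : Type*} [NormedAddCommGroup Y] [NormedSpace ℂ Y]
  [NormedAddCommGroup X] [NormedSpace ℂ X] (j : Y →L[ℂ] X)

/-- The `K`-functional of the couple `Y ⊆ X` (the inclusion being `j`):
`K(τ, x) = inf {‖y‖_Y + τ ‖x - y‖_X : y ∈ Y}`. -/
def kFunctional (τ : ℝ) (x : X) : ℝ≥0∞ := ⨅ y : Y, ‖y‖ₑ + ENNReal.ofReal τ * ‖x - j y‖ₑ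

/-- The norm of the real interpolation space `(Y, X)_{1/2,1}`:
`∫₀^∞ τ^{-1/2} K(τ, x) dτ/τ`. -/
def interpENorm (x : X) : ℝ≥0∞ :=
  ∫⁻ τ in Ioi (0 : ℝ), ENNReal.ofReal (τ ^ (-(3 / 2) : ℝ)) * kFunctional j τ x

theorem kFunctional_mono (x : X) : Monotone fun τ => kFunctional j τ x := fun s t h => by
  refine iInf_mono fun y => ?_
  gcongr

theorem kFunctional_zero (τ : ℝ) : kFunctional j τ 0 = 0 := by
  refine le_antisymm ((iInf_le _ 0).trans ?_) zero_le
  simp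

theorem kFunctional_add_le (τ : ℝ) (x x' : X) :
    kFunctional j τ (x + x') ≤ kFunctional j τ x + kFunctional j τ x' := by
  refine ENNReal.le_iInf_add_iInf fun y y' => (iInf_le _ (y + y')).trans ?_
  calc ‖y + y'‖ₑ + ENNReal.ofReal τ * ‖x + x' - j (y + y')‖ₑ
      ≤ (‖y‖ₑ + ‖y'‖ₑ) + ENNReal.ofReal τ * (‖x - j y‖ₑ + ‖x' - j y'‖ₑ) := by
        have h : x + x' - j (y + y') = (x - j y) + (x' - j y') := by
          rw [_root_.map_add]; abel
        rw [h]
        gcongr <;> exact enorm_add_le _ _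
    _ = _ := by ring

theorem kFunctional_smul_le (τ : ℝ) (c : ℂ) (x : X) :
    kFunctional j τ (c • x) ≤ ‖c‖ₑ * kFunctional j τ x := by
  rcases eq_or_ne c 0 with rfl | hc
  · simp [kFunctional_zero]
  rw [kFunctional, kFunctional, ENNReal.mul_iInf_of_ne (by simpa using hc) (by simp)]
  refine le_iInf fun y => (iInf_le _ (c • y)).trans (le_of_eq ?_)
  rw [_root_.map_smul, ← smul_sub, enorm_smul, enorm_smul]
  ring

theorem interpENorm_zero : interpENorm j 0 = 0 := by simp [interpENorm, kFunctional_zero]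

theorem measurable_integrand (x : X) :
    Measurable fun τ : ℝ => ENNReal.ofReal (τ ^ (-(3 / 2) : ℝ)) * kFunctional j τ x :=
  (by fun_prop : Measurable fun τ : ℝ => ENNReal.ofReal (τ ^ (-(3 / 2) : ℝ))).mul
    (kFunctional_mono j x).measurable

theorem interpENorm_add_le (x x' : X) :
    interpENorm j (x + x') ≤ interpENorm j x + interpENorm j x' := by
  rw [interpENorm, interpENorm, interpENorm, ← lintegral_add_left (measurable_integrand j x)]
  refine lintegral_mono fun τ => ?_
  rw [← mul_add]
  exact mul_le_mul_right (kFunctional_add_le j τ x x') _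

theorem interpENorm_smul_le (c : ℂ) (x : X) :
    interpENorm j (c • x) ≤ ‖c‖ₑ * interpENorm j x := by
  rw [interpENorm, interpENorm, ← lintegral_const_mul _ (measurable_integrand j x)]
  refine lintegral_mono fun τ => ?_
  rw [← mul_assoc, mul_comm ‖c‖ₑ, mul_assoc]
  exact mul_le_mul_right (kFunctional_smul_le j τ c x) _

theorem exists_enorm_le : ∃ C : ℝ≥0, ∀ x : X, ‖x‖ₑ ≤ C * interpENorm j x := by
  set M : ℝ≥0 := max 1 ‖j‖₊
  have hM1 : (1 : ℝ≥0∞) ≤ M := by exact_mod_cast le_max_left _ _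
  have hK : ∀ τ : ℝ, 1 ≤ τ → ∀ x : X, ‖x‖ₑ ≤ M * kFunctional j τ x := fun τ hτ x => by
    rw [kFunctional, ENNReal.mul_iInf_of_ne (by exact (zero_lt_one.trans_le hM1).ne') (by simp)]
    refine le_iInf fun y => ?_
    have hτ' : (1 : ℝ≥0∞) ≤ ENNReal.ofReal τ := by simpa using hτ
    calc ‖x‖ₑ = ‖j y + (x - j y)‖ₑ := by congr 1; abel
      _ ≤ ‖j y‖ₑ + ‖x - j y‖ₑ := enorm_add_le _ _
      _ ≤ M * ‖y‖ₑ + M * (ENNReal.ofReal τ * ‖x - j y‖ₑ) := by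
        gcongr
        · refine (j.le_opENorm y).trans ?_
          gcongr
          rw [enorm_eq_nnnorm]
          exact_mod_cast le_max_right _ _
        · rw [← mul_assoc]
          exact le_mul_of_one_le_left zero_le (one_le_mul hM1 hτ')
      _ = _ := by ring
  set a : ℝ≥0 := (2 : ℝ≥0) ^ (-(3 / 2) : ℝ)
  have ha : a ≠ 0 := (NNReal.rpow_pos (by norm_num)).ne'
  refine ⟨a⁻¹ * M, fun x => ?_⟩
  have h1 : (a : ℝ≥0∞) * ‖x‖ₑ ≤ M * interpENorm j x := by
    rw [interpENorm, ← lintegral_const_mul _ (measurable_integrand j x)]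
    calc (a : ℝ≥0∞) * ‖x‖ₑ = ∫⁻ _ in Ioc (1 : ℝ) 2, (a : ℝ≥0∞) * ‖x‖ₑ := by
          simp [Real.volume_Ioc]; norm_num
      _ ≤ ∫⁻ τ in Ioc (1 : ℝ) 2,
            M * (ENNReal.ofReal (τ ^ (-(3 / 2) : ℝ)) * kFunctional j τ x) := by
          refine setLIntegral_mono' measurableSet_Ioc fun τ hτ => ?_
          rw [← mul_assoc, mul_comm (M : ℝ≥0∞), mul_assoc]
          refine mul_le_mul' ?_ (hK τ hτ.1.le x)
          rw [← ENNReal.ofReal_coe_nnreal]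
          refine ENNReal.ofReal_le_ofReal ?_
          rw [NNReal.coe_rpow]
          exact Real.rpow_le_rpow_of_nonpos (by linarith [hτ.1]) hτ.2 (by norm_num)
      _ ≤ _ := lintegral_mono_set fun τ hτ => by
          have := hτ.1
          simp only [mem_Ioi]
          linarith
  calc ‖x‖ₑ = (a⁻¹ : ℝ≥0) * (a * ‖x‖ₑ) := by
        rw [← mul_assoc, ← ENNReal.coe_mul, inv_mul_cancel₀ ha]; simp
    _ ≤ (a⁻¹ : ℝ≥0) * (M * interpENorm j x) := by gcongr
    _ = _ := by push_cast; ring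

/-- The vectors of the real interpolation space `(Y, X)_{1/2,1}`. -/
def interpSubmodule : Submodule ℂ X where
  carrier := {x | interpENorm j x ≠ ∞}
  zero_mem' := by simp [interpENorm_zero]
  add_mem' := fun {x y} hx hy =>
    ((interpENorm_add_le j x y).trans_lt (ENNReal.add_lt_top.2 ⟨hx.lt_top, hy.lt_top⟩)).ne
  smul_mem' := fun c x hx =>
    ((interpENorm_smul_le j c x).trans_lt (ENNReal.mul_lt_top (by simp) hx.lt_top)).ne

/-- The real interpolation space `(Y, X)_{1/2,1}`, normed by `interpENorm`. -/
def InterpSpace : Type _ := interpSubmodule j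

namespace InterpSpace

instance : AddCommGroup (InterpSpace j) := inferInstanceAs (AddCommGroup (interpSubmodule j))
instance : Module ℂ (InterpSpace j) := inferInstanceAs (Module ℂ (interpSubmodule j))

/-- The inclusion of the interpolation space in `X`, as a linear map. -/
def inclₗ : InterpSpace j →ₗ[ℂ] X := (interpSubmodule j).subtype

theorem interpENorm_ne_top (x : InterpSpace j) : interpENorm j (inclₗ j x) ≠ ∞ := x.2

theorem toReal_smul_le (c : ℂ) (x : InterpSpace j) :
    (interpENorm j (inclₗ j (c • x))).toReal ≤ ‖c‖ * (interpENorm j (inclₗ j x)).toReal := by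
  rw [_root_.map_smul, ← toReal_enorm c, ← ENNReal.toReal_mul]
  exact ENNReal.toReal_mono (ENNReal.mul_ne_top (by simp) (interpENorm_ne_top j x))
    (interpENorm_smul_le j c _)

instance : NormedAddCommGroup (InterpSpace j) :=
  AddGroupNorm.toNormedAddCommGroup
    { toFun := fun x => (interpENorm j (inclₗ j x)).toReal
      map_zero' := by simp [interpENorm_zero]
      add_le' := fun x y => by
        rw [← ENNReal.toReal_add (interpENorm_ne_top j x) (interpENorm_ne_top j y),
          _root_.map_add]
        exact ENNReal.toReal_mono
          (ENNReal.add_ne_top.2 ⟨interpENorm_ne_top j x, interpENorm_ne_top j y⟩)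
          (interpENorm_add_le j _ _)
      neg' := fun x => by
        refine le_antisymm ?_ ?_
        · simpa using toReal_smul_le j (-1) x
        · simpa using toReal_smul_le j (-1) (-x)
      eq_zero_of_map_eq_zero' := fun x hx => by
        obtain ⟨C, hC⟩ := exists_enorm_le j
        have h0 : interpENorm j (inclₗ j x) = 0 :=
          ((ENNReal.toReal_eq_zero_iff _).1 hx).resolve_right (interpENorm_ne_top j x)
        have h1 := hC (inclₗ j x)
        rw [h0, mul_zero, nonpos_iff_eq_zero, enorm_eq_zero] at h1
        exact Subtype.val_injective h1 }

theorem norm_def (x : InterpSpace j) : ‖x‖ = (interpENorm j (inclₗ j x)).toReal := rfl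

instance : NormedSpace ℂ (InterpSpace j) where
  norm_smul_le := toReal_smul_le j

theorem exists_norm_incl_le : ∃ C : ℝ, ∀ x : InterpSpace j, ‖inclₗ j x‖ ≤ C * ‖x‖ := by
  obtain ⟨C, hC⟩ := exists_enorm_le j
  refine ⟨C, fun x => ?_⟩
  have h := ENNReal.toReal_mono (ENNReal.mul_ne_top (by simp) (interpENorm_ne_top j x))
    (hC (inclₗ j x))
  rwa [toReal_enorm, ENNReal.toReal_mul, ENNReal.coe_toReal] at h

end InterpSpace

end Interpolation

/-- For a couple `Y ⊆ V*` (antidual of `V`) and `E = (Y, V*)_{1/2,1} ⊆ V*`, the natural bounded map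
`V → E*`, `v ↦ (e ↦ conj ⟨v, e⟩)`. -/
def toInterpDual {Y V : Type*} [NormedAddCommGroup Y] [NormedSpace ℂ Y]
    [NormedAddCommGroup V] [NormedSpace ℂ V] (j : Y →L[ℂ] AntiDual V) :
    V →L[ℂ] AntiDual (InterpSpace j) :=
  LinearMap.mkContinuous₂
    (LinearMap.mk₂'ₛₗ (RingHom.id ℂ) (starRingEnd ℂ)
      (fun (v : V) (e : InterpSpace j) => starRingEnd ℂ (InterpSpace.inclₗ j e v))
      (fun v w e => by simp) (fun c v e => by simp)
      (fun v e e' => by simp) (fun c v e => by simp))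
    (InterpSpace.exists_norm_incl_le j).choose
    (fun v e => by
      have h := (InterpSpace.exists_norm_incl_le j).choose_spec e
      have h' := (InterpSpace.inclₗ j e).le_opNorm v
      simp only [LinearMap.mk₂'ₛₗ_apply, RCLike.norm_conj]
      calc _ ≤ _ := h'
        _ ≤ _ := mul_le_mul_of_nonneg_right h (norm_nonneg v)
        _ = _ := by ring)

/-! ### Energy spaces -/

section Energy

variable {V : Type*} [NormedAddCommGroup V] [NormedSpace ℂ V]

/-- `S > 0` for `S ∈ B(V, V*)`: `⟨f, S f⟩` is real and strictly positive for all `f ≠ 0`. -/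
def IsStrictlyPos (S : V →L[ℂ] AntiDual V) : Prop :=
  ∀ f, f ≠ 0 → (S f f).im = 0 ∧ 0 < (S f f).re

theorem IsStrictlyPos.im_eq_zero {S : V →L[ℂ] AntiDual V} (hS : IsStrictlyPos S) (f : V) :
    (S f f).im = 0 := by
  rcases eq_or_ne f 0 with rfl | hf
  · simp
  · exact (hS f hf).1

theorem IsStrictlyPos.symm {S : V →L[ℂ] AntiDual V} (hS : IsStrictlyPos S) (f g : V) :
    starRingEnd ℂ (S f g) = S g f := by
  have h1 := hS.im_eq_zero (f + g)
  have h2 := hS.im_eq_zero (f + Complex.I • g)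
  have hf := hS.im_eq_zero f
  have hg := hS.im_eq_zero g
  simp [_root_.map_add, ContinuousLinearMap.map_smulₛₗ, hf, hg] at h1 h2
  apply Complex.ext
  · simp; linarith
  · simp; linarith

/-- The space `V` equipped with the scalar product `(f, g) ↦ ⟨f, S g⟩`. -/
def PreEnergy (S : V →L[ℂ] AntiDual V) (_hS : IsStrictlyPos S) : Type _ := V

namespace PreEnergy

variable {S : V →L[ℂ] AntiDual V} (hS : IsStrictlyPos S)

instance : AddCommGroup (PreEnergy S hS) := inferInstanceAs (AddCommGroup V)
instance : Module ℂ (PreEnergy S hS) := inferInstanceAs (Module ℂ V)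

/-- The identification of `V` with `PreEnergy S hS`. -/
def equiv : V ≃ₗ[ℂ] PreEnergy S hS := LinearEquiv.refl ℂ V

/-- The scalar product `⟨f, S g⟩` (conjugate-linear in `f`). -/
abbrev core : InnerProductSpace.Core ℂ (PreEnergy S hS) where
  inner f g := S ((equiv hS).symm g) ((equiv hS).symm f)
  conj_inner_symm f g := hS.symm _ _
  re_inner_nonneg f := by
    rcases eq_or_ne f 0 with rfl | hf
    · simp
    · exact (hS _ (by simpa using hf)).2.le
  add_left f g h := by simp
  smul_left f g c := by simp
  definite f hf := by
    by_contra h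
    have := (hS _ (by simpa using h : (equiv hS).symm f ≠ 0)).2
    rw [hf] at this
    simp at this

instance : NormedAddCommGroup (PreEnergy S hS) := (core hS).toNormedAddCommGroup
instance : InnerProductSpace ℂ (PreEnergy S hS) := InnerProductSpace.ofCore (core hS).toCore

end PreEnergy

/-- The completion of `V` with respect to the norm `⟨f, S f⟩^{1/2}`. -/
abbrev Energy (S : V →L[ℂ] AntiDual V) (hS : IsStrictlyPos S) : Type _ :=
  UniformSpace.Completion (PreEnergy S hS)

/-- The canonical embedding of `V` in its completion. -/
def toEnergy {S : V →L[ℂ] AntiDual V} (hS : IsStrictlyPos S) : V →ₗ[ℂ] Energy S hS :=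
  (UniformSpace.Completion.toComplL (𝕜 := ℂ) (E := PreEnergy S hS)).toLinearMap ∘ₗ
    (PreEnergy.equiv hS).toLinearMap

end Energy

/-! ### Spectral notions for a self-adjoint operator -/

section Spectral

variable {𝓗 : Type*} [NormedAddCommGroup 𝓗] [InnerProductSpace ℂ 𝓗] [CompleteSpace 𝓗]

/-- The resolvent `(H - z)⁻¹`: the bounded operator with range in `D(H)` and
`(H - z) (H - z)⁻¹ f = f`. For `H` self-adjoint and `z` not real it exists and is unique. -/
def resolvent (H : 𝓗 →ₗ.[ℂ] 𝓗) (z : ℂ) : 𝓗 →L[ℂ] 𝓗 :=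
  Classical.epsilon fun R : 𝓗 →L[ℂ] 𝓗 =>
    ∀ f, ∃ h : R f ∈ H.domain, H ⟨R f, h⟩ - z • R f = f

/-- The operator `⟨H⟩^{1/2} = (1 + H²)^{1/4}`, as the inverse of the bounded operator
`((H + i)⁻¹ (H - i)⁻¹)^{1/4}`. Its domain is the form domain `D(|H|^{1/2})` of `H`. -/
def sqrtWeight (H : 𝓗 →ₗ.[ℂ] 𝓗) : 𝓗 →ₗ.[ℂ] 𝓗 :=
  LinearPMap.inverse
    ((((resolvent H (-Complex.I) * resolvent H Complex.I) ^ (1 / 4 : ℝ) :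
      𝓗 →L[ℂ] 𝓗).toLinearMap).toPMap ⊤)

/-- The form domain `𝓖¹` of `H`, with the graph norm of `⟨H⟩^{1/2}`. -/
abbrev FormDomain (H : 𝓗 →ₗ.[ℂ] 𝓗) : Type _ := GraphSpace (sqrtWeight H)

/-- For a symmetric operator `T ∈ B(𝓖², 𝓗)`, where `𝓖² = D(H)` with the graph norm, its unique
extension to an element of `B(𝓖¹, 𝓖⁻¹)`, where `𝓖⁻¹` is the antidual of `𝓖¹`:
`⟨g, T f⟩` is the scalar product of `𝓗` for `f ∈ 𝓖²` and `g ∈ 𝓖¹`. -/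
def formExtension (H : 𝓗 →ₗ.[ℂ] 𝓗) (T : H.domain → 𝓗) :
    FormDomain H →L[ℂ] AntiDual (FormDomain H) :=
  Classical.epsilon fun S : FormDomain H →L[ℂ] AntiDual (FormDomain H) =>
    ∀ (f : FormDomain H) (hf : GraphSpace.incl _ f ∈ H.domain) (g : FormDomain H),
      S f g = inner ℂ (GraphSpace.incl _ g) (T ⟨GraphSpace.incl _ f, hf⟩)

/-- `μ` is the spectral measure of the vector `f` with respect to `H`, characterized by
`⟨f, (H - z)⁻¹ f⟩ = ∫ (x - z)⁻¹ dμ(x)` for `z` not real; that is, `μ B = ‖E(B) f‖²` for the spectral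
projections `E(B)` of `H`. -/
structure IsSpectralMeasure (H : 𝓗 →ₗ.[ℂ] 𝓗) (f : 𝓗) (μ : Measure ℝ) : Prop where
  finite : IsFiniteMeasure μ
  inner_resolvent : ∀ z : ℂ, z.im ≠ 0 →
    inner ℂ f (resolvent H z f) = ∫ x : ℝ, ((x : ℂ) - z)⁻¹ ∂μ

/-- `f` belongs to the range of the spectral projection `E(J)`. -/
def MemSpectralSubspace (H : 𝓗 →ₗ.[ℂ] 𝓗) (J : Set ℝ) (f : 𝓗) : Prop :=
  ∃ μ, IsSpectralMeasure H f μ ∧ μ Jᶜ = 0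

/-- The spectrum of `H` on the Borel set `J` is purely absolutely continuous: `E(N) = 0` for every
Borel set `N ⊆ J` of Lebesgue measure zero. -/
def HasACSpectrumOn (H : 𝓗 →ₗ.[ℂ] 𝓗) (J : Set ℝ) : Prop :=
  ∀ f, ∃ μ, IsSpectralMeasure H f μ ∧ μ.restrict J ≪ volume

open Classical in
/-- The value of an unbounded operator, extended by `0` outside its domain. -/
def evalOrZero (L : 𝓗 →ₗ.[ℂ] 𝓗) (f : 𝓗) : 𝓗 := if h : f ∈ L.domain then L ⟨f, h⟩ else 0

/-- The operator `L` is `H`-smooth on `J` (in the sense of Kato), i.e. `L E(J)` is `H`-smooth: for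
all `f` in the range of `E(J)` and all `ε > 0`, the vectors `(H - λ ∓ iε)⁻¹ f` are in the domain of
`L` for almost all `λ`, and
`∫ (‖L (H - λ - iε)⁻¹ f‖² + ‖L (H - λ + iε)⁻¹ f‖²) dλ ≤ C ‖f‖²` with `C` independent of `f`, `ε`. -/
def IsSmoothOn (H L : 𝓗 →ₗ.[ℂ] 𝓗) (J : Set ℝ) : Prop :=
  ∃ C : ℝ≥0, ∀ f, MemSpectralSubspace H J f → ∀ ε : ℝ, 0 < ε →
    (∀ᵐ l : ℝ, resolvent H (l + ε * Complex.I) f ∈ L.domain ∧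
      resolvent H (l - ε * Complex.I) f ∈ L.domain) ∧
    ∫⁻ l : ℝ, (‖evalOrZero L (resolvent H (l + ε * Complex.I) f)‖ₑ ^ 2 +
      ‖evalOrZero L (resolvent H (l - ε * Complex.I) f)‖ₑ ^ 2) ≤ C * ‖f‖ₑ ^ 2

end Spectral

/-! ### The framework of the weakly conjugate operator -/

section Framework

variable {𝓗 : Type*} [NormedAddCommGroup 𝓗] [InnerProductSpace ℂ 𝓗] [CompleteSpace 𝓗]

/-- The orbit `t ↦ W_{-t} H W_t f` of `f ∈ D(H)`. -/
def conjOrbit (H : 𝓗 →ₗ.[ℂ] 𝓗) (W : ℝ → 𝓗 →L[ℂ] 𝓗)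
    (hWH : ∀ t, ∀ f : H.domain, W t f ∈ H.domain) (f : H.domain) (t : ℝ) : 𝓗 :=
  W (-t) (H ⟨W t f, hWH t f⟩)

/-- The commutator `[iH, A]`: the derivative at `t = 0` of `W_{-t} H W_t`. -/
def commutator (H : 𝓗 →ₗ.[ℂ] 𝓗) (W : ℝ → 𝓗 →L[ℂ] 𝓗)
    (hWH : ∀ t, ∀ f : H.domain, W t f ∈ H.domain) (f : H.domain) : 𝓗 :=
  deriv (conjOrbit H W hWH f) 0

/-- The extension to `B(𝓖¹, 𝓖⁻¹)` of the operator `S = -c₁ H + [iH, A]`. -/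
def weakForm (H : 𝓗 →ₗ.[ℂ] 𝓗) (W : ℝ → 𝓗 →L[ℂ] 𝓗)
    (hWH : ∀ t, ∀ f : H.domain, W t f ∈ H.domain) (c₁ : ℝ) :
    FormDomain H →L[ℂ] AntiDual (FormDomain H) :=
  formExtension H fun f => -((c₁ : ℂ) • H f) + commutator H W hWH f

variable {X : Type*} [NormedAddCommGroup X] [NormedSpace ℂ X]

/-- For a `C₀`-group `U` in `X = 𝓢`, the inclusion of `D(A, 𝓢*)`, the domain (with the graph norm)
of the generator of the group induced in `𝓢*`, in `𝓢*`. -/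
def dualGeneratorIncl (U : ℝ → X →L[ℂ] X) :
    GraphSpace (generator (dualGroup U)) →L[ℂ] AntiDual X :=
  GraphSpace.incl (generator (dualGroup U))

/-- The space `𝓔 = (D(A, 𝓢*), 𝓢*)_{1/2,1}`. -/
abbrev SpaceE (U : ℝ → X →L[ℂ] X) : Type _ := InterpSpace (dualGeneratorIncl U)

/-- The space `(𝓔*)°`, the closure of `𝓢` in `𝓔*`. -/
def dualClosure (U : ℝ → X →L[ℂ] X) : Submodule ℂ (AntiDual (SpaceE U)) :=
  (LinearMap.range (toInterpDual (dualGeneratorIncl U)).toLinearMap).topologicalClosure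

/-- The natural map from `𝓢` to `(𝓔*)°`. -/
def toDualClosure (U : ℝ → X →L[ℂ] X) : X →ₗ[ℂ] dualClosure U :=
  (toInterpDual (dualGeneratorIncl U)).toLinearMap.codRestrict _ fun x =>
    Submodule.le_topologicalClosure _ (LinearMap.mem_range_self _ x)

/-- An element `T` of `B((𝓔*)°, 𝓗)` as an operator in `𝓗` with domain `𝓖¹`, through
`𝓖¹ ⊆ 𝓢 ⊆ (𝓔*)°`. -/
def asOperator {H : 𝓗 →ₗ.[ℂ] 𝓗} {S : FormDomain H →L[ℂ] AntiDual (FormDomain H)}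
    {hS : IsStrictlyPos S} {U : ℝ → Energy S hS →L[ℂ] Energy S hS}
    (T : dualClosure U →L[ℂ] 𝓗) : 𝓗 →ₗ.[ℂ] 𝓗 where
  domain := (sqrtWeight H).domain
  toFun := (T.toLinearMap ∘ₗ toDualClosure U ∘ₗ toEnergy hS : FormDomain H →ₗ[ℂ] 𝓗)

end Framework

end

end WeakConj

/-!
The proof is Mourre's differential inequality in the form used for weakly conjugate operators,
followed by Kato's theory of smooth operators.

**The limiting absorption principle.** The operator `H` is perturbed to `H - iε[iH, A]`, and the
resolvent `G_ε = (H - iε[iH, A] - z)⁻¹` is constructed by the Lax-Milgram lemma on the closure `K`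
of `D(H)` in `𝓢 × 𝓗`. For `Re z ≥ 0` and `Im z > 0` the form is coercive (`coercive`):
`-Im - ε c₁ Re` of it dominates `Im z ‖·‖²_𝓗 + ε ‖·‖²_𝓢`, because `[iH, A] - c₁ H = S` is the square
of the norm of `𝓢`. Hence `‖G_ε f‖²_𝓢` is at most a multiple of `ε⁻¹ |⟨f, G_ε f⟩|`. The derivative
of `⟨f, G_ε f⟩` in `ε` is `i⟨f, G_ε [iH, A] G_ε f⟩`, and the virial identity (`virial`) expresses it
through the generator applied to `f` and through `ε` times the second commutator, which is bounded
on `𝓢` since `[iH, A]` extends to an operator of class `C¹(A; 𝓢, 𝓢*)`.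

The resulting inequality is linear in `√|⟨f, G_ε f⟩|` with an inhomogeneity `‖A f‖ / √ε`. It is
integrated over dyadic intervals (`sqrt_step`), and between consecutive intervals `f` is exchanged
for a better approximation (`sqrt_change`): the elements of `(D(A, 𝓢*), 𝓢*)_{1/2,1}` are
limits of `f_n ∈ D(A, 𝓢*)` for which the accumulated errors at the scales `2^{-n}` are summable
(`exists_dyadic_approximation`, `exists_bound`). The outcome (`exists_bound_resolvent`) is that
`(H - z)⁻¹` maps `𝓗` to `𝓔*` with norm at most `C |Im z|^{-1/2}` for `Re z ≥ 0`.

**Spectral measures.** The statement speaks of `H` through its resolvent, so spectral measures are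
obtained from the Cayley transform by the continuous functional calculus and the Riesz-Markov
theorem (`exists_spectralMeasure`).

**Absolute continuity.** For `e ∈ D(A, 𝓢*)` the functional `g ↦ e((H - i)⁻¹ g)` is represented by a
vector whose spectral measure is at most a multiple of Lebesgue measure on `[0, ∞)`
(`IsSpectralMeasure.measure_le`). Since `D(A, 𝓢*)` separates the points of `𝓢`
(`eq_zero_of_forall_generator`), these vectors span a dense subspace, and the property of having no
mass on a null set passes to limits (`hasACSpectrumOn_of_functionals`).

**Smoothness.** For bounded `T` the functions `T (H - λ ∓ iε)⁻¹ f` of `λ` belong to the two Hardy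
spaces, hence are orthogonal in `L²`, by a shift of the contour (`integral_inner_resolvent_eq_zero`).
The integral in question is therefore that of `‖T(G(λ + iε) - G(λ - iε))f‖²`, with `G` the resolvent
of `H`, and the jump equals `2iε G(λ - iε) G(λ + iε) f`, to which the resolvent bound applies when
`λ ≥ 0`. For `λ < 0` the bound on the spectral subspace follows from the one at `z = iε`
(`exists_resolvent_jump`). The operator `T` of the theorem is only bounded on `D(H)`, and is
replaced by `-in T(H - in)⁻¹` before `n → ∞` (`exists_smoothness_bound`).
-/

namespace WeakConj

/-! ### The resolvent of a self-adjoint operator -/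

section Resolvent

variable {𝓗 : Type*} [NormedAddCommGroup 𝓗] [InnerProductSpace ℂ 𝓗] [CompleteSpace 𝓗]
  {H : 𝓗 →ₗ.[ℂ] 𝓗}

theorem selfAdjoint_inner_left (hH : IsSelfAdjoint H) (x y : H.domain) :
    inner ℂ (H x) (y : 𝓗) = inner ℂ (x : 𝓗) (H y) := by
  have h := LinearPMap.adjoint_isFormalAdjoint hH.dense_domain
  rw [LinearPMap.isSelfAdjoint_def.1 hH] at h
  exact h x y

theorem selfAdjoint_mem_domain (hH : IsSelfAdjoint H) {y w : 𝓗}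
    (h : ∀ x : H.domain, inner ℂ w (x : 𝓗) = inner ℂ y (H x)) :
    ∃ hy : y ∈ H.domain, H ⟨y, hy⟩ = w := by
  have h1 : y ∈ H.adjoint.domain := LinearPMap.mem_adjoint_domain_of_exists y ⟨w, h⟩
  have h2 := LinearPMap.adjoint_apply_eq hH.dense_domain ⟨y, h1⟩ h
  have h3 := LinearPMap.isSelfAdjoint_def.1 hH
  revert h1
  rw [h3]
  exact fun h1 h2 => ⟨h1, h2⟩

theorem selfAdjoint_inner_self_im (hH : IsSelfAdjoint H) (x : H.domain) :
    (inner ℂ (x : 𝓗) (H x)).im = 0 := by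
  have h := selfAdjoint_inner_left hH x x
  rw [← inner_conj_symm] at h
  exact Complex.conj_eq_iff_im.1 h

theorem selfAdjoint_norm_le (hH : IsSelfAdjoint H) (z : ℂ) (x : H.domain) :
    |z.im| * ‖(x : 𝓗)‖ ≤ ‖H x - z • (x : 𝓗)‖ := by
  rcases eq_or_ne (x : 𝓗) 0 with h0 | h0
  · simp [h0]
  have h1 : (inner ℂ (x : 𝓗) (H x - z • (x : 𝓗))).im = -z.im * ‖(x : 𝓗)‖ ^ 2 := by
    rw [inner_sub_right, inner_smul_right, Complex.sub_im, selfAdjoint_inner_self_im hH,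
      inner_self_eq_norm_sq_to_K]
    have : (((‖(x : 𝓗)‖ : ℝ) : ℂ) ^ 2) = ((‖(x : 𝓗)‖ ^ 2 : ℝ) : ℂ) := by push_cast; rfl
    simp [this, -Complex.ofReal_pow]
  have h2 := (Complex.abs_im_le_norm _).trans
    (norm_inner_le_norm (𝕜 := ℂ) (x : 𝓗) (H x - z • (x : 𝓗)))
  rw [h1, abs_mul, abs_neg, abs_of_nonneg (sq_nonneg ‖(x : 𝓗)‖)] at h2
  have h3 : 0 < ‖(x : 𝓗)‖ := norm_pos_iff.2 h0
  nlinarith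

theorem selfAdjoint_sub_surjective (hH : IsSelfAdjoint H) {z : ℂ} (hz : z.im ≠ 0) (y : 𝓗) :
    ∃ x : H.domain, H x - z • (x : 𝓗) = y := by
  let L : H.domain →ₗ[ℂ] 𝓗 := H.toFun - z • H.domain.subtype
  have hL : ∀ x, L x = H x - z • (x : 𝓗) := fun x => rfl
  have hcl : IsClosed (LinearMap.range L : Set 𝓗) := by
    refine isClosed_of_closure_subset fun y hy => ?_
    obtain ⟨u, hu, huy⟩ := mem_closure_iff_seq_limit.1 hy
    choose x hx using hu
    have hc : CauchySeq fun n => (x n : 𝓗) := by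
      have h1 := huy.cauchySeq
      rw [Metric.cauchySeq_iff'] at h1 ⊢
      intro ε hε
      obtain ⟨N, hN⟩ := h1 (|z.im| * ε) (by positivity)
      refine ⟨N, fun n hn => ?_⟩
      have h2 := selfAdjoint_norm_le hH z (x n - x N)
      rw [← hL, _root_.map_sub, hx, hx, ← dist_eq_norm] at h2
      have h3 := h2.trans_lt (hN n hn)
      rw [dist_eq_norm]
      exact lt_of_mul_lt_mul_left h3 (abs_nonneg _)
    obtain ⟨w, hw⟩ := cauchySeq_tendsto_of_complete hc
    have hmem := selfAdjoint_mem_domain hH (y := w) (w := y + z • w) fun v => by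
      have h1 : Tendsto (fun n => inner ℂ (u n + z • (x n : 𝓗)) (v : 𝓗)) atTop
          (𝓝 (inner ℂ (y + z • w) (v : 𝓗))) :=
        (huy.add (hw.const_smul z)).inner tendsto_const_nhds
      have h2 : Tendsto (fun n => inner ℂ (x n : 𝓗) (H v)) atTop (𝓝 (inner ℂ w (H v))) :=
        hw.inner tendsto_const_nhds
      refine tendsto_nhds_unique h1 (h2.congr fun n => ?_)
      rw [← hx n, hL, sub_add_cancel, selfAdjoint_inner_left hH]
    obtain ⟨hw1, hw2⟩ := hmem
    refine ⟨⟨w, hw1⟩, ?_⟩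
    rw [hL, hw2, add_sub_cancel_right]
  have hbot : (LinearMap.range L)ᗮ = ⊥ := by
    rw [Submodule.eq_bot_iff]
    intro g hg
    have hmem := selfAdjoint_mem_domain hH (y := g) (w := (starRingEnd ℂ z) • g) fun v => by
      have h1 := Submodule.inner_left_of_mem_orthogonal (LinearMap.mem_range_self L v) hg
      rw [hL, inner_sub_right, inner_smul_right, sub_eq_zero] at h1
      rw [h1, inner_smul_left, Complex.conj_conj]
    obtain ⟨h1, h2⟩ := hmem
    have h3 := selfAdjoint_norm_le hH (starRingEnd ℂ z) ⟨g, h1⟩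
    rw [h2] at h3
    simp only [sub_self, norm_zero, Complex.conj_im, abs_neg] at h3
    have h4 : 0 < |z.im| := abs_pos.2 hz
    exact norm_le_zero_iff.1 (by nlinarith [norm_nonneg g])
  have : CompleteSpace (LinearMap.range L) := hcl.completeSpace_coe
  have htop : LinearMap.range L = ⊤ := (Submodule.orthogonal_eq_bot_iff).1 hbot
  exact LinearMap.range_eq_top.1 htop y

theorem resolvent_spec (hH : IsSelfAdjoint H) {z : ℂ} (hz : z.im ≠ 0) (f : 𝓗) :
    ∃ h : resolvent H z f ∈ H.domain, H ⟨resolvent H z f, h⟩ - z • resolvent H z f = f := by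
  refine Classical.epsilon_spec (p := fun R : 𝓗 →L[ℂ] 𝓗 =>
    ∀ f, ∃ h : R f ∈ H.domain, H ⟨R f, h⟩ - z • R f = f) ?_ f
  choose r hr using selfAdjoint_sub_surjective hH hz
  have hinj : ∀ x y : H.domain, H x - z • (x : 𝓗) = H y - z • (y : 𝓗) → x = y := by
    intro x y hxy
    have h1 := selfAdjoint_norm_le hH z (x - y)
    have h2 : H (x - y) - z • ((x - y : H.domain) : 𝓗) = 0 := by
      rw [LinearPMap.map_sub, Submodule.coe_sub, smul_sub]
      rw [← sub_eq_zero] at hxy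
      rw [← hxy]; abel
    rw [h2, norm_zero] at h1
    have h4 : 0 < |z.im| := abs_pos.2 hz
    have h5 : ((x - y : H.domain) : 𝓗) = 0 :=
      norm_le_zero_iff.1 (by nlinarith [norm_nonneg ((x - y : H.domain) : 𝓗)])
    exact sub_eq_zero.1 (Subtype.ext h5)
  let R : 𝓗 →ₗ[ℂ] 𝓗 :=
    { toFun := fun f => r f
      map_add' := fun f g => by
        rw [← Submodule.coe_add]
        congr 1
        apply hinj
        rw [hr, LinearPMap.map_add, Submodule.coe_add, smul_add]
        nth_rewrite 1 [← hr f, ← hr g]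
        abel
      map_smul' := fun c f => by
        rw [RingHom.id_apply, ← Submodule.coe_smul]
        congr 1
        apply hinj
        rw [hr, LinearPMap.map_smul, Submodule.coe_smul, smul_comm z c, ← smul_sub, hr] }
  refine ⟨R.mkContinuous |z.im|⁻¹ fun f => ?_, fun f => ⟨(r f).2, hr f⟩⟩
  have h1 := selfAdjoint_norm_le hH z (r f)
  rw [hr] at h1
  rw [inv_mul_eq_div, le_div_iff₀ (abs_pos.2 hz), mul_comm]
  exact h1

theorem resolvent_mem (hH : IsSelfAdjoint H) {z : ℂ} (hz : z.im ≠ 0) (f : 𝓗) :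
    resolvent H z f ∈ H.domain := (resolvent_spec hH hz f).1

theorem apply_resolvent (hH : IsSelfAdjoint H) {z : ℂ} (hz : z.im ≠ 0) (f : 𝓗) :
    H ⟨resolvent H z f, resolvent_mem hH hz f⟩ = f + z • resolvent H z f := by
  obtain ⟨h1, h2⟩ := resolvent_spec hH hz f
  exact sub_eq_iff_eq_add.1 h2

theorem resolvent_apply_sub (hH : IsSelfAdjoint H) {z : ℂ} (hz : z.im ≠ 0) (x : H.domain) :
    resolvent H z (H x - z • (x : 𝓗)) = x := by
  obtain ⟨h1, h2⟩ := resolvent_spec hH hz (H x - z • (x : 𝓗))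
  have h3 := selfAdjoint_norm_le hH z (⟨_, h1⟩ - x)
  have h4 : H (⟨_, h1⟩ - x) - z • ((⟨_, h1⟩ - x : H.domain) : 𝓗) = 0 := by
    rw [LinearPMap.map_sub, Submodule.coe_sub, smul_sub]
    rw [← sub_eq_zero] at h2
    rw [← h2]
    abel
  rw [h4, norm_zero] at h3
  have h5 : 0 < |z.im| := abs_pos.2 hz
  have h6 := norm_nonneg (((⟨_, h1⟩ - x : H.domain)) : 𝓗)
  have h7 : ‖(((⟨_, h1⟩ - x : H.domain)) : 𝓗)‖ = 0 := by nlinarith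
  exact sub_eq_zero.1 (norm_eq_zero.1 h7)

theorem resolvent_norm_le (hH : IsSelfAdjoint H) {z : ℂ} (hz : z.im ≠ 0) (f : 𝓗) :
    |z.im| * ‖resolvent H z f‖ ≤ ‖f‖ := by
  obtain ⟨h1, h2⟩ := resolvent_spec hH hz f
  have := selfAdjoint_norm_le hH z ⟨_, h1⟩
  rwa [h2] at this

/-- The first resolvent identity. -/
theorem resolvent_sub (hH : IsSelfAdjoint H) {z w : ℂ} (hz : z.im ≠ 0) (hw : w.im ≠ 0) (f : 𝓗) :
    resolvent H z f - resolvent H w f = (z - w) • resolvent H z (resolvent H w f) := by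
  have h := resolvent_apply_sub hH hz ⟨_, resolvent_mem hH hw f⟩
  rw [apply_resolvent hH hw, add_sub_assoc, ← sub_smul, _root_.map_add, _root_.map_smul] at h
  simp only at h
  rw [← neg_sub w z, neg_smul, sub_eq_iff_eq_add', ← sub_eq_add_neg, eq_sub_iff_add_eq]
  exact h

theorem resolvent_comm (hH : IsSelfAdjoint H) {z w : ℂ} (hz : z.im ≠ 0) (hw : w.im ≠ 0) (f : 𝓗) :
    resolvent H z (resolvent H w f) = resolvent H w (resolvent H z f) := by
  rcases eq_or_ne z w with rfl | hne
  · rfl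
  have h1 := resolvent_sub hH hz hw f
  have h2 := resolvent_sub hH hw hz f
  rw [← neg_sub, h1, ← neg_sub z w, neg_smul, neg_inj] at h2
  exact smul_right_injective _ (sub_ne_zero.2 hne) h2

theorem resolvent_inner (hH : IsSelfAdjoint H) {z : ℂ} (hz : z.im ≠ 0) (f g : 𝓗) :
    inner ℂ (resolvent H z f) g = inner ℂ f (resolvent H (starRingEnd ℂ z) g) := by
  have hz' : (starRingEnd ℂ z).im ≠ 0 := by simpa using hz
  obtain ⟨h1, h2⟩ := resolvent_spec hH hz f
  obtain ⟨h3, h4⟩ := resolvent_spec hH hz' g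
  have h5 := selfAdjoint_inner_left hH ⟨_, h1⟩ ⟨_, h3⟩
  nth_rewrite 1 [← h4]
  nth_rewrite 2 [← h2]
  rw [inner_sub_right, inner_sub_left, inner_smul_right, inner_smul_left, h5]

theorem resolvent_adjoint (hH : IsSelfAdjoint H) {z : ℂ} (hz : z.im ≠ 0) :
    ContinuousLinearMap.adjoint (resolvent H z) = resolvent H (starRingEnd ℂ z) := by
  symm
  rw [ContinuousLinearMap.eq_adjoint_iff]
  intro f g
  rw [resolvent_inner hH (by simpa using hz), Complex.conj_conj]

theorem resolvent_norm_conj (hH : IsSelfAdjoint H) {z : ℂ} (hz : z.im ≠ 0) (f : 𝓗) :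
    ‖resolvent H (starRingEnd ℂ z) f‖ = ‖resolvent H z f‖ := by
  have hz' : (starRingEnd ℂ z).im ≠ 0 := by simpa using hz
  have h : inner ℂ (resolvent H (starRingEnd ℂ z) f) (resolvent H (starRingEnd ℂ z) f) =
      inner ℂ (resolvent H z f) (resolvent H z f) := by
    rw [resolvent_inner hH hz', resolvent_inner hH hz, Complex.conj_conj,
      resolvent_comm hH hz hz']
  rw [inner_self_eq_norm_sq_to_K, inner_self_eq_norm_sq_to_K] at h
  have h2 : ‖resolvent H (starRingEnd ℂ z) f‖ ^ 2 = ‖resolvent H z f‖ ^ 2 := by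
    exact_mod_cast h
  exact (pow_left_inj₀ (norm_nonneg _) (norm_nonneg _) two_ne_zero).1 h2

theorem resolvent_injective (hH : IsSelfAdjoint H) {z : ℂ} (hz : z.im ≠ 0) :
    Function.Injective (resolvent H z) := by
  rw [injective_iff_map_eq_zero]
  intro f hf
  obtain ⟨h1, h2⟩ := resolvent_spec hH hz f
  have : (⟨_, h1⟩ : H.domain) = 0 := Subtype.ext hf
  rw [this, hf] at h2
  simpa using h2.symm

theorem mem_domain_iff_resolvent (hH : IsSelfAdjoint H) {z : ℂ} (hz : z.im ≠ 0) (x : 𝓗) :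
    x ∈ H.domain ↔ ∃ f, resolvent H z f = x :=
  ⟨fun h => ⟨_, resolvent_apply_sub hH hz ⟨x, h⟩⟩, fun ⟨f, h⟩ => h ▸ resolvent_mem hH hz f⟩

theorem resolvent_denseRange (hH : IsSelfAdjoint H) {z : ℂ} (hz : z.im ≠ 0) :
    DenseRange (resolvent H z) := by
  have : Set.range (resolvent H z) = (H.domain : Set 𝓗) := by
    ext x
    simp [mem_domain_iff_resolvent hH hz]
  rw [DenseRange, this]
  exact hH.dense_domain

end Resolvent

/-! ### The form domain -/

section RangeInclusion

variable {𝓗 : Type*} [NormedAddCommGroup 𝓗] [InnerProductSpace ℂ 𝓗] [CompleteSpace 𝓗]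

/-- A commuting version of Douglas' range inclusion: `A = V B = B V` for a bounded `V`. -/
theorem exists_preimage_of_commute_of_norm_le {A B : 𝓗 →L[ℂ] 𝓗} (hB : DenseRange B)
    (hAB : ∀ x, A (B x) = B (A x)) (hn : ∀ x, ‖A x‖ ≤ ‖B x‖) (x : 𝓗) : ∃ y, A x = B y := by
  have hn' : ∃ C, ∀ x, ‖A.toLinearMap x‖ ≤ C * ‖B.toLinearMap x‖ := ⟨1, by simpa using hn⟩
  let V := LinearMap.extendOfNorm A.toLinearMap B.toLinearMap
  have hV : ∀ x, V (B x) = A x := fun x => LinearMap.extendOfNorm_eq (by simpa using hB) hn' x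
  have hVB : ∀ y, V (B y) = B (V y) := by
    intro y
    refine congrFun (DenseRange.equalizer (f := B) (g := fun y => V (B y))
      (h := fun y => B (V y)) hB (V.continuous.comp B.continuous)
      (B.continuous.comp V.continuous) (funext fun x => ?_)) y
    simp only [Function.comp_apply, hV, hAB]
  exact ⟨V x, by rw [← hVB, hV]⟩

omit [CompleteSpace 𝓗] in
/-- If `P = Q²` with `Q` self-adjoint, and `P N` is self-adjoint, then `‖Q N x‖ ≤ ‖N‖ ‖Q x‖`
(an inequality of Reid). It follows by iterating `‖Q N^m x‖² ≤ ‖Q x‖ ‖Q N^{2m} x‖`. -/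
theorem norm_apply_le_of_symmetric {Q N : 𝓗 →L[ℂ] 𝓗}
    (hQ : ∀ x y, inner ℂ (Q x) y = inner ℂ x (Q y))
    (hN : ∀ x y, inner ℂ (Q (Q (N x))) y = inner ℂ x (Q (Q (N y)))) (x : 𝓗) :
    ‖Q (N x)‖ ≤ ‖N‖ * ‖Q x‖ := by
  have hmove : ∀ m : ℕ, ∀ u v : 𝓗,
      inner ℂ (Q (Q ((N ^ m) u))) v = inner ℂ u (Q (Q ((N ^ m) v))) := by
    intro m
    induction m with
    | zero => intro u v; simp [hQ]
    | succ m ih =>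
      intro u v
      rw [pow_succ', mul_apply_eq_comp, hN, ← hQ, ← hQ, ih,
        ← pow_succ', pow_succ, mul_apply_eq_comp]
  have hsq : ∀ m : ℕ, ‖Q ((N ^ m) x)‖ ^ 2 ≤ ‖Q x‖ * ‖Q ((N ^ (2 * m)) x)‖ := by
    intro m
    have h1 : inner ℂ (Q ((N ^ m) x)) (Q ((N ^ m) x)) = inner ℂ (Q x) (Q ((N ^ (2 * m)) x)) := by
      rw [← hQ, hmove, hQ, two_mul, pow_add, mul_apply_eq_comp]
    have h2 := norm_inner_le_norm (𝕜 := ℂ) (Q x) (Q ((N ^ (2 * m)) x))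
    rw [← h1, inner_self_eq_norm_sq_to_K] at h2
    simpa using h2
  rcases eq_or_ne (Q x) 0 with h0 | h0
  · have := hsq 1
    rw [h0] at this
    simp at this
    simp [h0, this]
  have hr0 : 0 < ‖Q x‖ := norm_pos_iff.2 h0
  set ρ : ℝ := ‖Q (N x)‖ / ‖Q x‖ with hρ
  have hpow : ∀ n : ℕ, ρ ^ (2 ^ n) ≤ ‖Q ((N ^ (2 ^ n)) x)‖ / ‖Q x‖ := by
    intro n
    induction n with
    | zero => simp [hρ]
    | succ n ih =>
      rw [pow_succ, pow_mul]
      calc (ρ ^ 2 ^ n) ^ 2 ≤ (‖Q ((N ^ (2 ^ n)) x)‖ / ‖Q x‖) ^ 2 := by gcongr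
        _ ≤ _ := by
          rw [div_pow, div_le_div_iff₀ (by positivity) hr0]
          have := hsq (2 ^ n)
          rw [mul_comm 2] at this
          nlinarith
  have hbd : ∀ n : ℕ, ρ ^ (2 ^ n) ≤ ‖Q‖ * ‖x‖ / ‖Q x‖ * ‖N‖ ^ (2 ^ n) := by
    intro n
    refine (hpow n).trans ?_
    rw [div_mul_eq_mul_div]
    gcongr
    calc ‖Q ((N ^ (2 ^ n)) x)‖ ≤ ‖Q‖ * (‖N ^ (2 ^ n)‖ * ‖x‖) :=
          (Q.le_opNorm _).trans (by gcongr; exact ContinuousLinearMap.le_opNorm _ _)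
      _ ≤ ‖Q‖ * (‖N‖ ^ (2 ^ n) * ‖x‖) := by
          gcongr
          exact norm_pow_le' _ (by positivity)
      _ = _ := by ring
  have hρN : ρ ≤ ‖N‖ := by
    by_contra! hlt
    rcases (norm_nonneg N).eq_or_lt with hN0 | hN0
    · have := hbd 0
      rw [← hN0] at this hlt
      simp at this
      linarith
    have h1 : 1 < ρ / ‖N‖ := (one_lt_div hN0).2 hlt
    obtain ⟨n, hn⟩ := pow_unbounded_of_one_lt (‖Q‖ * ‖x‖ / ‖Q x‖) h1
    have h2 : (ρ / ‖N‖) ^ n ≤ (ρ / ‖N‖) ^ (2 ^ n) :=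
      pow_le_pow_right₀ h1.le Nat.lt_two_pow_self.le
    have h3 := hbd n
    rw [← div_le_iff₀ (by positivity), ← div_pow] at h3
    linarith
  rwa [hρ, div_le_iff₀ hr0] at hρN

end RangeInclusion

section FormDomain

variable {𝓗 : Type*} [NormedAddCommGroup 𝓗] [InnerProductSpace ℂ 𝓗] [CompleteSpace 𝓗]
  {H : 𝓗 →ₗ.[ℂ] 𝓗}

/-- The bounded operator `⟨H⟩^{-1/2}`, whose range is the form domain of `H`. -/
noncomputable def weightRoot (H : 𝓗 →ₗ.[ℂ] 𝓗) : 𝓗 →L[ℂ] 𝓗 :=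
  (resolvent H (-Complex.I) * resolvent H Complex.I) ^ (1 / 4 : ℝ)

theorem resolvent_mul_eq_star_mul (hH : IsSelfAdjoint H) :
    resolvent H (-Complex.I) * resolvent H Complex.I =
      star (resolvent H Complex.I) * resolvent H Complex.I := by
  rw [ContinuousLinearMap.star_eq_adjoint, resolvent_adjoint hH (by simp), Complex.conj_I]

theorem resolvent_mul_nonneg (hH : IsSelfAdjoint H) :
    0 ≤ resolvent H (-Complex.I) * resolvent H Complex.I := by
  rw [resolvent_mul_eq_star_mul hH]
  exact star_mul_self_nonneg _

theorem weightRoot_inner (H : 𝓗 →ₗ.[ℂ] 𝓗) (x y : 𝓗) :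
    inner ℂ (weightRoot H x) y = inner ℂ x (weightRoot H y) := by
  have h : IsSelfAdjoint (weightRoot H) := IsSelfAdjoint.of_nonneg CFC.rpow_nonneg
  rw [← ContinuousLinearMap.adjoint_inner_left, ← ContinuousLinearMap.star_eq_adjoint, h.star_eq]

theorem weightRoot_pow (hH : IsSelfAdjoint H) (x : 𝓗) :
    weightRoot H (weightRoot H (weightRoot H (weightRoot H x))) =
      resolvent H (-Complex.I) (resolvent H Complex.I x) := by
  have h0 := resolvent_mul_nonneg hH
  have h1 : weightRoot H ^ (4 : ℕ) = resolvent H (-Complex.I) * resolvent H Complex.I := by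
    rw [weightRoot, ← CFC.rpow_natCast _ _ CFC.rpow_nonneg,
      CFC.rpow_rpow_of_exponent_nonneg _ _ _ (by norm_num) (by norm_num)]
    norm_num
    exact CFC.rpow_one _
  have h2 := congrArg (fun A : 𝓗 →L[ℂ] 𝓗 => A x) h1
  simpa [pow_succ] using h2

theorem weightRoot_injective (hH : IsSelfAdjoint H) : Function.Injective (weightRoot H) := by
  rw [injective_iff_map_eq_zero]
  intro x hx
  have h := weightRoot_pow hH x
  rw [hx] at h
  simp only [_root_.map_zero] at h
  exact (injective_iff_map_eq_zero _).1 (resolvent_injective hH (by simp)) _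
    ((injective_iff_map_eq_zero _).1 (resolvent_injective hH (by simp)) _ h.symm)

theorem weightRoot_denseRange (hH : IsSelfAdjoint H) : DenseRange (weightRoot H) := by
  have h1 : DenseRange (resolvent H (-Complex.I) ∘ resolvent H Complex.I) :=
    (resolvent_denseRange hH (by simp)).comp (resolvent_denseRange hH (by simp))
      (ContinuousLinearMap.continuous _)
  refine Dense.mono ?_ h1
  rintro _ ⟨x, rfl⟩
  exact ⟨_, weightRoot_pow hH x⟩

theorem weightRoot_commute (hH : IsSelfAdjoint H) (x : 𝓗) :
    weightRoot H (resolvent H Complex.I x) = resolvent H Complex.I (weightRoot H x) := by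
  set R := resolvent H Complex.I
  have h1 : Commute (resolvent H (-Complex.I) * R) R := by
    refine Commute.mul_left ?_ (Commute.refl _)
    ext x
    exact resolvent_comm hH (by simp) (by simp) x
  have h2 : Commute (weightRoot H) R := by
    refine h1.cfc_nnreal _
  exact congrArg (fun A : 𝓗 →L[ℂ] 𝓗 => A x) h2

theorem norm_weightRoot_sq (hH : IsSelfAdjoint H) (x : 𝓗) :
    ‖weightRoot H (weightRoot H x)‖ = ‖resolvent H Complex.I x‖ := by
  have h : inner ℂ (weightRoot H (weightRoot H x)) (weightRoot H (weightRoot H x)) =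
      inner ℂ (resolvent H Complex.I x) (resolvent H Complex.I x) := by
    rw [weightRoot_inner, weightRoot_inner, weightRoot_pow hH, resolvent_inner hH (by simp),
      Complex.conj_I]
  rw [inner_self_eq_norm_sq_to_K, inner_self_eq_norm_sq_to_K] at h
  have h2 : ‖weightRoot H (weightRoot H x)‖ ^ 2 = ‖resolvent H Complex.I x‖ ^ 2 := by
    exact_mod_cast h
  exact (pow_left_inj₀ (norm_nonneg _) (norm_nonneg _) two_ne_zero).1 h2

/-- The operator `⟨H⟩^{-1}` has range `D(H)`. -/
theorem mem_domain_iff_weightRoot_sq (hH : IsSelfAdjoint H) (x : 𝓗) :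
    x ∈ H.domain ↔ ∃ y, weightRoot H (weightRoot H y) = x := by
  have hc : ∀ x, weightRoot H (weightRoot H (resolvent H Complex.I x)) =
      resolvent H Complex.I (weightRoot H (weightRoot H x)) := fun x => by
    rw [weightRoot_commute hH, weightRoot_commute hH]
  rw [mem_domain_iff_resolvent hH (z := Complex.I) (by simp)]
  constructor
  · rintro ⟨f, rfl⟩
    obtain ⟨y, hy⟩ := exists_preimage_of_commute_of_norm_le (A := resolvent H Complex.I)
      (B := weightRoot H * weightRoot H)
      ((weightRoot_denseRange hH).comp (weightRoot_denseRange hH)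
        (ContinuousLinearMap.continuous _))
      (fun x => (hc x).symm) (fun x => (norm_weightRoot_sq hH x).ge) f
    exact ⟨y, hy.symm⟩
  · rintro ⟨y, rfl⟩
    obtain ⟨w, hw⟩ := exists_preimage_of_commute_of_norm_le (B := resolvent H Complex.I)
      (A := weightRoot H * weightRoot H) (resolvent_denseRange hH (by simp))
      (fun x => hc x) (fun x => (norm_weightRoot_sq hH x).le) y
    exact ⟨w, hw.symm⟩

theorem weightRoot_toPMap_ker (hH : IsSelfAdjoint H) :
    LinearMap.ker ((weightRoot H).toLinearMap.toPMap ⊤).toFun = ⊥ := by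
  rw [LinearMap.ker_eq_bot]
  intro x y hxy
  exact Subtype.ext (weightRoot_injective hH hxy)

theorem mem_sqrtWeight_domain (H : 𝓗 →ₗ.[ℂ] 𝓗) (x : 𝓗) :
    x ∈ (sqrtWeight H).domain ↔ ∃ y, weightRoot H y = x := by
  rw [sqrtWeight, LinearPMap.inverse_domain]
  constructor
  · rintro ⟨y, rfl⟩
    exact ⟨y, rfl⟩
  · rintro ⟨y, rfl⟩
    exact ⟨⟨y, trivial⟩, rfl⟩

/-- The element `⟨H⟩^{-1/2} x` of the form domain. -/
noncomputable def formVec (H : 𝓗 →ₗ.[ℂ] 𝓗) (x : 𝓗) : FormDomain H :=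
  (⟨weightRoot H x, (mem_sqrtWeight_domain H _).2 ⟨x, rfl⟩⟩ : (sqrtWeight H).domain)

theorem incl_formVec (x : 𝓗) : GraphSpace.incl _ (formVec H x) = weightRoot H x := rfl

theorem act_formVec (hH : IsSelfAdjoint H) (x : 𝓗) : GraphSpace.act _ (formVec H x) = x :=
  LinearPMap.inverse_apply_eq (weightRoot_toPMap_ker hH) (x := ⟨x, trivial⟩) rfl

theorem incl_injective (H : 𝓗 →ₗ.[ℂ] 𝓗) : Function.Injective (GraphSpace.incl (sqrtWeight H)) :=
  GraphSpace.inclₗ_injective _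

theorem weightRoot_act (hH : IsSelfAdjoint H) (f : FormDomain H) :
    weightRoot H (GraphSpace.act _ f) = GraphSpace.incl _ f := by
  obtain ⟨y, hy⟩ := (mem_sqrtWeight_domain H (GraphSpace.incl _ f)).1
    (Subtype.property (p := fun x => x ∈ (sqrtWeight H).domain) f)
  have : f = formVec H y := incl_injective H hy.symm
  rw [this, act_formVec hH, incl_formVec]

theorem norm_act_le (f : FormDomain H) : ‖GraphSpace.act _ f‖ ≤ ‖f‖ := by
  rw [GraphSpace.norm_def]
  exact Real.le_sqrt_of_sq_le (by nlinarith [sq_nonneg ‖GraphSpace.inclₗ _ f‖])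

theorem domain_le_formDomain (hH : IsSelfAdjoint H) {x : 𝓗} (hx : x ∈ H.domain) :
    x ∈ (sqrtWeight H).domain := by
  obtain ⟨y, hy⟩ := (mem_domain_iff_weightRoot_sq hH x).1 hx
  exact (mem_sqrtWeight_domain H x).2 ⟨_, hy⟩

/-- The inclusion of `D(H)` in the form domain. -/
noncomputable def domainIncl (hH : IsSelfAdjoint H) : H.domain →ₗ[ℂ] FormDomain H :=
  (Submodule.inclusion fun _ hx => domain_le_formDomain hH hx :
    H.domain →ₗ[ℂ] (sqrtWeight H).domain)

theorem incl_domainIncl (hH : IsSelfAdjoint H) (x : H.domain) :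
    GraphSpace.incl _ (domainIncl hH x) = (x : 𝓗) := rfl

/-- `D(H)` is dense in the form domain. -/
theorem domainIncl_denseRange (hH : IsSelfAdjoint H) : DenseRange (domainIncl hH) := by
  intro f
  rw [Metric.mem_closure_iff]
  intro ε hε
  set x := GraphSpace.act _ f
  set C := ‖weightRoot H‖ + 1
  have hC : 0 < C := by positivity
  obtain ⟨_, ⟨y, rfl⟩, hy⟩ := Metric.mem_closure_iff.1 (weightRoot_denseRange hH x)
    (ε / (C + 1)) (by positivity)
  have hmem : weightRoot H (weightRoot H y) ∈ H.domain :=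
    (mem_domain_iff_weightRoot_sq hH _).2 ⟨y, rfl⟩
  refine ⟨_, ⟨⟨_, hmem⟩, rfl⟩, ?_⟩
  have h1 : (f - domainIncl hH ⟨_, hmem⟩) = formVec H (x - weightRoot H y) := by
    apply incl_injective
    rw [_root_.map_sub, incl_domainIncl, incl_formVec, _root_.map_sub, weightRoot_act hH]
  rw [dist_eq_norm, h1, GraphSpace.norm_def, act_formVec hH]
  rw [dist_eq_norm] at hy
  set d := x - weightRoot H y
  have h2 : ‖GraphSpace.inclₗ _ (formVec H d)‖ ≤ C * ‖d‖ :=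
    ((weightRoot H).le_opNorm d).trans (by gcongr; simp [C])
  calc √(‖GraphSpace.inclₗ _ (formVec H d)‖ ^ 2 + ‖d‖ ^ 2) ≤ √((C * ‖d‖) ^ 2 + ‖d‖ ^ 2) := by
        gcongr
    _ ≤ (C + 1) * ‖d‖ := by
        apply Real.sqrt_le_iff.2 ⟨by positivity, ?_⟩
        nlinarith [mul_nonneg hC.le (sq_nonneg ‖d‖)]
    _ < ε := by rwa [lt_div_iff₀' (by positivity)] at hy

/-- A symmetric operator `T` defined on all of `D(H)` extends to a bounded operator from the form
domain to its antidual. With `Q = weightRoot H`, the operator `N = T Q²`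
is bounded by the closed graph theorem and `Q² N` is symmetric, so that Reid's inequality
`‖Q N x‖ ≤ ‖N‖ ‖Q x‖` makes `Q x ↦ Q N x` a bounded operator. -/
theorem formExtension_apply (hH : IsSelfAdjoint H) (T : H.domain →ₗ[ℂ] 𝓗)
    (hT : ∀ x y : H.domain, inner ℂ (T x) (y : 𝓗) = inner ℂ (x : 𝓗) (T y))
    (f : H.domain) (g : FormDomain H) :
    formExtension H T (domainIncl hH f) g = inner ℂ (GraphSpace.incl _ g) (T f) := by
  let P : 𝓗 →ₗ[ℂ] H.domain := LinearMap.codRestrict H.domain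
    (weightRoot H * weightRoot H).toLinearMap
    fun x => (mem_domain_iff_weightRoot_sq hH _).2 ⟨x, rfl⟩
  have hP : ∀ x, (P x : 𝓗) = weightRoot H (weightRoot H x) := fun x => rfl
  have hsym : ∀ x y : 𝓗, inner ℂ (weightRoot H (weightRoot H (T (P x)))) y =
      inner ℂ x (weightRoot H (weightRoot H (T (P y)))) := by
    intro x y
    rw [weightRoot_inner, weightRoot_inner, ← hP y, hT, hP, weightRoot_inner, weightRoot_inner]
  -- the closed graph theorem
  let N : 𝓗 →L[ℂ] 𝓗 := ⟨T ∘ₗ P, by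
    refine LinearMap.continuous_of_seq_closed_graph _ fun u x y hu hTu => ?_
    have h0 : weightRoot H (weightRoot H y) = weightRoot H (weightRoot H (T (P x))) := by
      refine ext_inner_right ℂ fun w => ?_
      have h1 : Tendsto (fun n => inner ℂ (weightRoot H (weightRoot H (T (P (u n))))) w) atTop
          (𝓝 (inner ℂ (weightRoot H (weightRoot H y)) w)) := by
        refine Tendsto.inner ?_ tendsto_const_nhds
        exact (((weightRoot H).continuous.comp (weightRoot H).continuous).tendsto y).comp hTu
      have h2 : Tendsto (fun n => inner ℂ (u n) (weightRoot H (weightRoot H (T (P w))))) atTop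
          (𝓝 (inner ℂ x (weightRoot H (weightRoot H (T (P w)))))) :=
        hu.inner tendsto_const_nhds
      rw [hsym x w]
      exact tendsto_nhds_unique (h1.congr fun n => hsym _ _) h2
    exact weightRoot_injective hH (weightRoot_injective hH h0)⟩
  have hN : ∀ x, N x = T (P x) := fun x => rfl
  have hreid := norm_apply_le_of_symmetric (Q := weightRoot H) (N := N)
    (weightRoot_inner H) (fun x y => hsym x y)
  have hex : ∃ C, ∀ x, ‖(weightRoot H * N).toLinearMap x‖ ≤
      C * ‖(weightRoot H).toLinearMap x‖ := ⟨‖N‖, hreid⟩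
  let K : 𝓗 →L[ℂ] 𝓗 :=
    LinearMap.extendOfNorm (weightRoot H * N).toLinearMap (weightRoot H).toLinearMap
  have hK : ∀ x, K (weightRoot H x) = weightRoot H (N x) := fun x =>
    LinearMap.extendOfNorm_eq (by simpa using weightRoot_denseRange hH) hex x
  let S : FormDomain H →L[ℂ] AntiDual (FormDomain H) :=
    LinearMap.mkContinuous₂
      (LinearMap.mk₂'ₛₗ (RingHom.id ℂ) (starRingEnd ℂ)
        (fun f g : FormDomain H => inner ℂ (GraphSpace.act _ g) (K (GraphSpace.act _ f)))
        (fun f f' g => by simp)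
        (fun c f g => by simp)
        (fun f g g' => by simp)
        (fun c f g => by simp [mul_comm])) ‖K‖
      (fun f g => by
        refine (norm_inner_le_norm _ _).trans ?_
        calc _ ≤ ‖g‖ * (‖K‖ * ‖f‖) := by
              gcongr
              · exact norm_act_le g
              · exact (K.le_opNorm _).trans (by gcongr; exact norm_act_le f)
          _ = _ := by ring)
  have hS : ∀ f g, S f g = inner ℂ (GraphSpace.act _ g) (K (GraphSpace.act _ f)) := fun f g => rfl
  refine Classical.epsilon_spec (p := fun S : FormDomain H →L[ℂ] AntiDual (FormDomain H) =>
    ∀ (f : FormDomain H) (hf : GraphSpace.incl _ f ∈ H.domain) (g : FormDomain H),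
      S f g = inner ℂ (GraphSpace.incl _ g) (T ⟨GraphSpace.incl _ f, hf⟩)) ⟨S, ?_⟩
    (domainIncl hH f) f.2 g
  intro f hf g
  obtain ⟨w, hw⟩ := (mem_domain_iff_weightRoot_sq hH _).1 hf
  have hfw : GraphSpace.act _ f = weightRoot H w :=
    weightRoot_injective hH (by rw [weightRoot_act hH, hw])
  have hPw : P w = ⟨GraphSpace.incl _ f, hf⟩ := Subtype.ext hw
  rw [hS, hfw, hK, hN, hPw, ← weightRoot_inner, weightRoot_act hH]

end FormDomain

/-! ### Antiduals of Hilbert spaces and the Lax-Milgram lemma -/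

section LaxMilgram

variable {K : Type*} [NormedAddCommGroup K] [InnerProductSpace ℂ K]

/-- The Riesz isomorphism of a Hilbert space with its antidual, `x ↦ (y ↦ ⟨y, x⟩)`. -/
noncomputable def antiRiesz (K : Type*) [NormedAddCommGroup K] [InnerProductSpace ℂ K] :
    K →L[ℂ] AntiDual K := innerSLFlip ℂ

theorem antiRiesz_apply (x y : K) : antiRiesz K x y = inner ℂ y x := rfl

theorem exists_antiRiesz_eq [CompleteSpace K] (φ : AntiDual K) : ∃ x, antiRiesz K x = φ := by
  let ψ : StrongDual ℂ K := (starL ℂ : ℂ ≃L⋆[ℂ] ℂ).toContinuousLinearMap.comp φ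
  refine ⟨(InnerProductSpace.toDual ℂ K).symm ψ, ?_⟩
  ext y
  rw [antiRiesz_apply, ← inner_conj_symm, InnerProductSpace.toDual_symm_apply]
  simp [ψ]

theorem surjective_of_coercive [CompleteSpace K] {T : K →L[ℂ] K} {c : ℝ} (hc : 0 < c)
    (hT : ∀ k, c * ‖k‖ ^ 2 ≤ ‖(inner ℂ k (T k) : ℂ)‖) : Function.Surjective T := by
  have hb : ∀ k, c * ‖k‖ ≤ ‖T k‖ := by
    intro k
    rcases eq_or_ne k 0 with rfl | hk
    · simp
    have h1 := (hT k).trans (norm_inner_le_norm _ _)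
    have h2 : 0 < ‖k‖ := norm_pos_iff.2 hk
    nlinarith
  have hanti : AntilipschitzWith c⁻¹.toNNReal T := by
    refine ContinuousLinearMap.antilipschitz_of_bound T fun k => ?_
    rw [Real.coe_toNNReal _ (by positivity), inv_mul_eq_div, le_div_iff₀' hc]
    exact hb k
  have hcl : IsClosed (LinearMap.range T.toLinearMap : Set K) :=
    hanti.isClosed_range T.uniformContinuous
  have : CompleteSpace (LinearMap.range T.toLinearMap) := hcl.completeSpace_coe
  refine LinearMap.range_eq_top.1 ((Submodule.orthogonal_eq_bot_iff).1 ?_)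
  rw [Submodule.eq_bot_iff]
  intro g hg
  have h1 := Submodule.inner_left_of_mem_orthogonal (LinearMap.mem_range_self T.toLinearMap g) hg
  have h2 := hT g
  rw [ContinuousLinearMap.coe_coe] at h1
  rw [h1, norm_zero] at h2
  have h3 : ‖g‖ ^ 2 ≤ 0 := by nlinarith
  exact norm_eq_zero.1 (by nlinarith [norm_nonneg g])

/-- The Lax-Milgram lemma, for a form `A k l = ⟨l, A k⟩` and for its adjoint. -/
theorem exists_of_coercive [CompleteSpace K] (A : K →L[ℂ] AntiDual K) {c : ℝ} (hc : 0 < c)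
    (hA : ∀ k, c * ‖k‖ ^ 2 ≤ ‖A k k‖) (φ : AntiDual K) :
    (∃ u, ∀ l, A u l = φ l) ∧ ∃ v, ∀ k, A k v = starRingEnd ℂ (φ k) := by
  have hnorm : ∀ x : K, ‖antiRiesz K x‖ = ‖x‖ := fun x => by
    refine le_antisymm (ContinuousLinearMap.opNorm_le_bound _ (norm_nonneg x) fun y => ?_) ?_
    · rw [antiRiesz_apply, mul_comm]
      exact norm_inner_le_norm _ _
    · rcases eq_or_ne x 0 with rfl | hx
      · simp
      have h := (antiRiesz K x).le_opNorm x
      rw [antiRiesz_apply, inner_self_eq_norm_sq_to_K] at h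
      have h' : ‖x‖ ^ 2 ≤ ‖antiRiesz K x‖ * ‖x‖ := by simpa using h
      have := norm_pos_iff.2 hx
      nlinarith
  have hinj : Function.Injective (antiRiesz K) := by
    rw [injective_iff_map_eq_zero]
    intro x hx
    rw [← norm_eq_zero, ← hnorm, hx, norm_zero]
  let J : K ≃ₗ[ℂ] AntiDual K :=
    LinearEquiv.ofBijective (antiRiesz K).toLinearMap ⟨hinj, exists_antiRiesz_eq⟩
  have hJ : ∀ ψ, antiRiesz K (J.symm ψ) = ψ := fun ψ => J.apply_symm_apply ψ
  let T : K →L[ℂ] K := LinearMap.mkContinuous (J.symm.toLinearMap ∘ₗ A.toLinearMap) ‖A‖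
    fun k => by
      rw [← hnorm]
      change ‖antiRiesz K (J.symm (A k))‖ ≤ _
      rw [hJ]
      exact A.le_opNorm k
  have hT : ∀ k l, inner ℂ l (T k) = A k l := fun k l => by
    rw [← antiRiesz_apply]
    change antiRiesz K (J.symm (A k)) l = _
    rw [hJ]
  obtain ⟨x, hx⟩ := exists_antiRiesz_eq φ
  constructor
  · obtain ⟨u, hu⟩ := surjective_of_coercive hc (T := T) (fun k => by rw [hT]; exact hA k) x
    exact ⟨u, fun l => by rw [← hT, hu, ← hx, antiRiesz_apply]⟩
  · obtain ⟨v, hv⟩ := surjective_of_coercive hc (T := ContinuousLinearMap.adjoint T) (fun k => by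
      rw [ContinuousLinearMap.adjoint_inner_right, ← inner_conj_symm, RCLike.norm_conj, hT]
      exact hA k) x
    refine ⟨v, fun k => ?_⟩
    rw [← hT, ← ContinuousLinearMap.adjoint_inner_left, hv, ← hx, antiRiesz_apply,
      inner_conj_symm]

/-- The form `(k, l) ↦ ⟨j l, h (j k)⟩`. -/
noncomputable def pullForm {E : Type*} [NormedAddCommGroup E] [NormedSpace ℂ E]
    (j : K →L[ℂ] E) (h : E →L[ℂ] AntiDual E) : K →L[ℂ] AntiDual K :=
  ((ContinuousLinearMap.compSL K E ℂ (RingHom.id ℂ) (starRingEnd ℂ)).flip j).comp (h.comp j)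

end LaxMilgram

theorem dualGroup_apply {X : Type*} [SeminormedAddCommGroup X] [NormedSpace ℂ X]
    (U : ℝ → X →L[ℂ] X) (t : ℝ) (φ : AntiDual X) (x : X) : dualGroup U t φ x = φ (U (-t) x) := rfl

/-- The weakly conjugate setting in terms of forms. The energy space `E` is only coupled to the
space `G` through the Hilbert space `K`, the completion of `D(H)` for the sum of the norms of `E`
and `G`, with its maps `j` and `i` to `E` and `G`. The forms of `H`, of `[iH, A]` and of the second
commutator are `h`, `b` and `b'`, and the group acts by `U` in `E` and by `V` in `K`. -/
structure ConjugateForms (E G K : Type*) [NormedAddCommGroup E] [InnerProductSpace ℂ E]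
    [NormedAddCommGroup G] [InnerProductSpace ℂ G]
    [NormedAddCommGroup K] [InnerProductSpace ℂ K] where
  j : K →L[ℂ] E
  i : K →L[ℂ] G
  h : E →L[ℂ] AntiDual E
  b : E →L[ℂ] AntiDual E
  b' : E →L[ℂ] AntiDual E
  c₁ : ℝ
  U : ℝ → E →L[ℂ] E
  V : ℝ → K → K
  c₁_pos : 0 < c₁
  norm_le : ∀ k, ‖k‖ ^ 2 ≤ ‖j k‖ ^ 2 + ‖i k‖ ^ 2
  h_im : ∀ k, (h (j k) (j k)).im = 0
  b_im : ∀ k, (b (j k) (j k)).im = 0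
  energy : ∀ k, ‖j k‖ ^ 2 = (b (j k) (j k)).re - c₁ * (h (j k) (j k)).re
  group : IsC0Group U
  j_V : ∀ t k, j (V t k) = U t (j k)
  V_V_neg : ∀ t k, V t (V (-t) k) = k
  inner_V : ∀ t k l, inner ℂ (i (V t k)) (i (V t l)) = inner ℂ (i k) (i l)
  h_deriv : ∀ k, HasDerivAt (fun t => dualGroup U (-t) (h (U t (j k)))) (b (j k)) 0
  b_deriv : ∀ k, HasDerivAt (fun t => dualGroup U (-t) (b (U t (j k)))) (b' (j k)) 0

namespace ConjugateForms

/-! ### The modified resolvent -/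

variable {E G K : Type*} [NormedAddCommGroup E] [InnerProductSpace ℂ E]
  [NormedAddCommGroup G] [InnerProductSpace ℂ G]
  [NormedAddCommGroup K] [InnerProductSpace ℂ K] (D : ConjugateForms E G K)

/-- The form of `H - iε[iH, A] - z`. -/
noncomputable def form (ε : ℝ) (z : ℂ) : K →L[ℂ] AntiDual K :=
  pullForm D.j D.h - z • pullForm D.i (antiRiesz G) - (Complex.I * ε) • pullForm D.j D.b

theorem form_apply (ε : ℝ) (z : ℂ) (k l : K) :
    D.form ε z k l = D.h (D.j k) (D.j l) - z * inner ℂ (D.i l) (D.i k) -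
      Complex.I * ε * D.b (D.j k) (D.j l) := rfl

/-- The coercivity of the modified form: `-Im - ε c₁ Re` is positive definite, since
`b - c₁ h` is the square of the norm of `E`. -/
theorem coercive {ε : ℝ} (hε : 0 ≤ ε) {z : ℂ} (hz : 0 ≤ z.re) (k : K) :
    z.im * ‖D.i k‖ ^ 2 + ε * ‖D.j k‖ ^ 2 ≤ (1 + D.c₁ * ε) * ‖D.form ε z k k‖ := by
  have hc := D.c₁_pos
  have hn : inner ℂ (D.i k) (D.i k) = ((‖D.i k‖ ^ 2 : ℝ) : ℂ) := by
    rw [inner_self_eq_norm_sq_to_K]; push_cast; rfl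
  have hre : (D.form ε z k k).re = (D.h (D.j k) (D.j k)).re - z.re * ‖D.i k‖ ^ 2 := by
    rw [form_apply, hn]
    simp [D.b_im, -Complex.ofReal_pow]
  have him : (D.form ε z k k).im = -(z.im * ‖D.i k‖ ^ 2) - ε * (D.b (D.j k) (D.j k)).re := by
    rw [form_apply, hn]
    simp [D.b_im, D.h_im, -Complex.ofReal_pow]
  have h1 := neg_le_of_abs_le (Complex.abs_im_le_norm (D.form ε z k k))
  have h2 := neg_le_of_abs_le (Complex.abs_re_le_norm (D.form ε z k k))
  have h3 := D.energy k
  have h4 : 0 ≤ D.c₁ * ε := by positivity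
  have h5 : 0 ≤ D.c₁ * ε * (z.re * ‖D.i k‖ ^ 2) := by positivity
  have h6 := mul_le_mul_of_nonneg_left h2 h4
  rw [hre] at h6
  rw [him] at h1
  rw [h3]
  nlinarith

theorem exists_sol [CompleteSpace K] {ε : ℝ} (hε : 0 < ε) {z : ℂ} (hz : 0 ≤ z.re) (hz' : 0 < z.im)
    (φ : AntiDual K) :
    (∃ u, ∀ l, D.form ε z u l = φ l) ∧ ∃ v, ∀ k, D.form ε z k v = starRingEnd ℂ (φ k) := by
  have hc := D.c₁_pos
  have hm : 0 < min z.im ε := lt_min hz' hε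
  refine exists_of_coercive (D.form ε z) (c := min z.im ε / (1 + D.c₁ * ε)) (by positivity)
    (fun k => ?_) φ
  have h1 := D.coercive hε.le hz k
  rw [div_mul_eq_mul_div, div_le_iff₀' (by positivity)]
  refine le_trans ?_ h1
  have h2 := mul_le_mul_of_nonneg_left (D.norm_le k) hm.le
  have h3 := mul_le_mul_of_nonneg_right (min_le_left z.im ε) (sq_nonneg ‖D.i k‖)
  have h4 := mul_le_mul_of_nonneg_right (min_le_right z.im ε) (sq_nonneg ‖D.j k‖)
  linarith

/-- `u` is the image of `f` under the modified resolvent. -/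
def IsSol (ε : ℝ) (z : ℂ) (f : AntiDual E) (u : K) : Prop := ∀ l, D.form ε z u l = f (D.j l)

/-- `v` is the image of `f` under the adjoint of the modified resolvent. -/
def IsDualSol (ε : ℝ) (z : ℂ) (f : AntiDual E) (v : K) : Prop :=
  ∀ k, D.form ε z k v = starRingEnd ℂ (f (D.j k))

theorem exists_isSol [CompleteSpace K] {ε : ℝ} (hε : 0 < ε) {z : ℂ} (hz : 0 ≤ z.re) (hz' : 0 < z.im)
    (f : AntiDual E) : (∃ u, D.IsSol ε z f u) ∧ ∃ v, D.IsDualSol ε z f v :=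
  D.exists_sol hε hz hz' (f.comp D.j)

variable {D} {ε : ℝ} {z : ℂ} {f f' : AntiDual E} {u v u' v' : K}

theorem IsSol.apply_eq (hu : D.IsSol ε z f u) (hv : D.IsDualSol ε z f v) :
    f (D.j v) = starRingEnd ℂ (f (D.j u)) := by rw [← hu v, ← hv u]

theorem IsSol.bound (hu : D.IsSol ε z f u) (hε : 0 ≤ ε) (hε' : ε ≤ 1) (hz : 0 ≤ z.re) :
    z.im * ‖D.i u‖ ^ 2 + ε * ‖D.j u‖ ^ 2 ≤ (1 + D.c₁) * ‖f (D.j u)‖ := by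
  have h := D.coercive hε hz u
  rw [hu u] at h
  refine h.trans ?_
  have hc := D.c₁_pos
  gcongr
  nlinarith

theorem IsDualSol.bound (hv : D.IsDualSol ε z f v) (hε : 0 ≤ ε) (hε' : ε ≤ 1) (hz : 0 ≤ z.re) :
    z.im * ‖D.i v‖ ^ 2 + ε * ‖D.j v‖ ^ 2 ≤ (1 + D.c₁) * ‖f (D.j v)‖ := by
  have h := D.coercive hε hz v
  rw [hv v, RCLike.norm_conj] at h
  refine h.trans ?_
  have hc := D.c₁_pos
  gcongr
  nlinarith

theorem norm_j_le_of_bound {q c : ℝ} (hε : 0 < ε) (hz : 0 ≤ z.im) (hq : 0 ≤ q)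
    (h : z.im * ‖D.i u‖ ^ 2 + ε * ‖D.j u‖ ^ 2 ≤ c * q) : ‖D.j u‖ ≤ √(c / ε) * √q := by
  have h1 : 0 ≤ z.im * ‖D.i u‖ ^ 2 := by positivity
  rw [← Real.sqrt_mul' _ hq]
  refine Real.le_sqrt_of_sq_le ?_
  rw [div_mul_eq_mul_div, le_div_iff₀' hε]
  linarith

end ConjugateForms

theorem tendsto_antiDual_apply {X ι : Type*} [NormedAddCommGroup X] [NormedSpace ℂ X]
    {l : Filter ι} {φ : ι → AntiDual X} {φ₀ : AntiDual X} {x : ι → X} {x₀ : X}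
    (hφ : Tendsto φ l (𝓝 φ₀)) (hx : Tendsto x l (𝓝 x₀)) :
    Tendsto (fun n => φ n (x n)) l (𝓝 (φ₀ x₀)) := by
  have h1 : Tendsto (fun n => ‖φ n - φ₀‖ * ‖x n‖) l (𝓝 0) := by
    have := (tendsto_iff_norm_sub_tendsto_zero.1 hφ).mul hx.norm
    rwa [zero_mul] at this
  have h2 : Tendsto (fun n => (φ n - φ₀) (x n)) l (𝓝 0) :=
    squeeze_zero_norm (fun n => ContinuousLinearMap.le_opNorm _ _) h1
  have h3 := h2.add ((φ₀.continuous.tendsto x₀).comp hx)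
  rw [zero_add] at h3
  exact h3.congr fun n => by simp

namespace ConjugateForms

variable {E G K : Type*} [NormedAddCommGroup E] [InnerProductSpace ℂ E]
  [NormedAddCommGroup G] [InnerProductSpace ℂ G]
  [NormedAddCommGroup K] [InnerProductSpace ℂ K] {D : ConjugateForms E G K}

/-! ### The differential inequality for the modified resolvent -/

theorem form_sub_form (ε η : ℝ) (z : ℂ) (k l : K) :
    D.form η z k l - D.form ε z k l = -(Complex.I * (η - ε) * D.b (D.j k) (D.j l)) := by
  rw [form_apply, form_apply]
  ring

/-- The modified resolvent is Lipschitz in `ε`. -/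
theorem norm_sol_sub_le {ε η : ℝ} (hη : 0 < η) {z : ℂ} (hz : 0 ≤ z.re)
    (hz' : 0 ≤ z.im) {f : AntiDual E} {u v : K} (hu : D.IsSol ε z f u) (hv : D.IsSol η z f v) :
    η * ‖D.j v - D.j u‖ ≤ (1 + D.c₁ * η) * (|η - ε| * ‖D.b (D.j u)‖) := by
  have hc := D.c₁_pos
  have h1 := D.coercive hη.le hz (v - u)
  have h2 : D.form η z (v - u) (v - u) =
      Complex.I * (η - ε) * D.b (D.j u) (D.j (v - u)) := by
    have := form_sub_form (D := D) ε η z u (v - u)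
    rw [hu] at this
    rw [_root_.map_sub (D.form η z), _root_.sub_apply, hv]
    linear_combination -this
  have h3 : ‖D.form η z (v - u) (v - u)‖ ≤ |η - ε| * (‖D.b (D.j u)‖ * ‖D.j (v - u)‖) := by
    rw [h2, norm_mul, norm_mul, Complex.norm_I, one_mul, ← Complex.ofReal_sub, Complex.norm_real,
      Real.norm_eq_abs]
    gcongr
    exact ContinuousLinearMap.le_opNorm _ _
  rw [← _root_.map_sub]
  have h4 : 0 ≤ z.im * ‖D.i (v - u)‖ ^ 2 := by positivity
  have h5 := mul_le_mul_of_nonneg_left h3 (show 0 ≤ 1 + D.c₁ * η by positivity)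
  rcases (norm_nonneg (D.j (v - u))).eq_or_lt with h0 | h0
  · rw [← h0, mul_zero]; positivity
  · refine le_of_mul_le_mul_right ?_ h0
    nlinarith

/-- The derivative of `⟨f, G_ε f⟩` in `ε`, where `G_ε` is the modified resolvent. -/
theorem hasDerivAt_apply_dualSol {z : ℂ} (hz : 0 ≤ z.re) (hz' : 0 ≤ z.im) {f : AntiDual E}
    {u v : ℝ → K} (hu : ∀ ε, 0 < ε → D.IsSol ε z f (u ε))
    (hv : ∀ ε, 0 < ε → D.IsDualSol ε z f (v ε)) {ε : ℝ} (hε : 0 < ε) :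
    HasDerivAt (fun η => f (D.j (v η))) (Complex.I * D.b (D.j (u ε)) (D.j (v ε))) ε := by
  have hpos : ∀ᶠ η in 𝓝 ε, 0 < η := lt_mem_nhds hε
  have hcont : Tendsto (fun η => D.j (u η)) (𝓝 ε) (𝓝 (D.j (u ε))) := by
    rw [tendsto_iff_norm_sub_tendsto_zero]
    have h1 : Tendsto (fun η : ℝ => (1 + D.c₁ * η) * (|η - ε| * ‖D.b (D.j (u ε))‖) / η) (𝓝 ε)
        (𝓝 ((1 + D.c₁ * ε) * (|ε - ε| * ‖D.b (D.j (u ε))‖) / ε)) := by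
      have : ContinuousAt
          (fun η : ℝ => (1 + D.c₁ * η) * (|η - ε| * ‖D.b (D.j (u ε))‖) / η) ε := by
        fun_prop (disch := exact hε.ne')
      exact this
    simp only [sub_self, abs_zero, zero_mul, mul_zero, zero_div] at h1
    refine squeeze_zero' (Eventually.of_forall fun _ => norm_nonneg _) ?_ h1
    filter_upwards [hpos] with η hη
    rw [le_div_iff₀' hη]
    exact norm_sol_sub_le hη hz hz' (hu ε hε) (hu η hη)
  rw [hasDerivAt_iff_tendsto_slope]
  have h2 : Tendsto (fun η => Complex.I * D.b (D.j (u η)) (D.j (v ε))) (𝓝[≠] ε)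
      (𝓝 (Complex.I * D.b (D.j (u ε)) (D.j (v ε)))) := by
    have h3 : Continuous fun x => Complex.I * D.b x (D.j (v ε)) := by fun_prop
    exact ((h3.tendsto _).comp hcont).mono_left nhdsWithin_le_nhds
  refine h2.congr' ?_
  filter_upwards [self_mem_nhdsWithin, nhdsWithin_le_nhds hpos] with η hne hη
  have h4 := form_sub_form (D := D) ε η z (u η) (v ε)
  rw [hu η hη, hv ε hε, (hu η hη).apply_eq (hv η hη) |>.symm] at h4
  have hne' : ((η : ℂ) - ε) ≠ 0 := by
    rw [← Complex.ofReal_sub]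
    exact_mod_cast sub_ne_zero.2 hne
  rw [slope_def_module, Complex.real_smul, Complex.ofReal_inv, Complex.ofReal_sub,
    eq_inv_mul_iff_mul_eq₀ hne']
  linear_combination h4

/-- The derivative at `0` of `t ↦ f ∘ U_t` for `f` in the domain of the generator of the dual
group. -/
theorem _root_.WeakConj.hasDerivAt_dualGroup {X : Type*} [NormedAddCommGroup X] [NormedSpace ℂ X]
    {U : ℝ → X →L[ℂ] X} (g : GraphSpace (generator (dualGroup U))) :
    HasDerivAt (fun t => dualGroup U (-t) (dualGeneratorIncl U g))
      (-(Complex.I • GraphSpace.act _ g)) 0 := by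
  have hd : DifferentiableAt ℝ (fun t => dualGroup U t (dualGeneratorIncl U g)) 0 :=
    Subtype.property (p := fun x => x ∈ (generator (dualGroup U)).domain) g
  have h1 : Complex.I • GraphSpace.act _ g =
      deriv (fun t => dualGroup U t (dualGeneratorIncl U g)) 0 := by
    change Complex.I • (-Complex.I • deriv (fun t => dualGroup U t (dualGeneratorIncl U g)) 0) = _
    rw [smul_smul]
    simp
  rw [h1]
  have h2 := hd.hasDerivAt
  rw [← neg_zero] at h2
  have h3 := h2.scomp (0 : ℝ) (hasDerivAt_neg (0 : ℝ))
  rw [neg_zero, neg_one_smul] at h3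
  exact h3

/-- The virial identity: `⟨f, G_ε [iH, A] G_ε f⟩` is expressed through the derivative `f'` of `f`
along the group, up to a second commutator term multiplied by `ε`. -/
theorem virial {ε : ℝ} {z : ℂ} {f f' : AntiDual E} {u v : K} (hu : D.IsSol ε z f u)
    (hv : D.IsDualSol ε z f v)
    (hf : HasDerivAt (fun t => dualGroup D.U (-t) f) f' 0) :
    D.b (D.j u) (D.j v) = starRingEnd ℂ (f' (D.j u)) + f' (D.j v) +
      Complex.I * ε * D.b' (D.j u) (D.j v) := by
  set Γ : ℝ → AntiDual E := fun t => dualGroup D.U (-t) (D.h (D.U t (D.j u))) -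
    (Complex.I * ε) • dualGroup D.U (-t) (D.b (D.U t (D.j u))) with hΓ
  have hU0 := D.group.map_zero
  have hUneg : ∀ t x, D.U t (D.U (-t) x) = x := fun t x => by
    have := D.group.map_add t (-t)
    rw [add_neg_cancel, hU0] at this
    exact (congrArg (fun A : E →L[ℂ] E => A x) this).symm
  have hΓ' : HasDerivAt Γ (D.b (D.j u) - (Complex.I * ε) • D.b' (D.j u)) 0 :=
    (D.h_deriv u).sub ((D.b_deriv u).fun_const_smul (Complex.I * ε))
  have hΓapp : ∀ t x, Γ t x = D.h (D.U t (D.j u)) (D.U t x) -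
      Complex.I * ε * D.b (D.U t (D.j u)) (D.U t x) := fun t x => by
    simp [hΓ, dualGroup_apply]
  -- the conjugated form on `(u, U (-t) v)`, evaluated by the equations for `u` and `v` tested on
  -- translates; the terms with `z` cancel because the group is unitary in `G`
  have key : ∀ t, (Γ t - Γ 0) (D.U (-t) (D.j v)) =
      starRingEnd ℂ (f (D.U t (D.j u))) - f (D.U (-t) (D.j v)) := by
    intro t
    have h1 := hv (D.V t u)
    have h2 := hu (D.V (-t) v)
    have h3 : inner ℂ (D.i (D.V (-t) v)) (D.i u) = inner ℂ (D.i v) (D.i (D.V t u)) := by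
      rw [← D.inner_V t, D.V_V_neg]
    rw [form_apply, D.j_V] at h1 h2
    rw [_root_.sub_apply, hΓapp, hΓapp, hUneg, hU0, ← h1, ← h2, h3]
    simp
    ring
  have hcontU : Tendsto (fun t => D.U (-t) (D.j v)) (𝓝[≠] 0) (𝓝 (D.j v)) := by
    have h : Continuous fun t => D.U (-t) (D.j v) := (D.group.continuous _).comp continuous_neg
    have := h.tendsto 0
    rw [neg_zero, hU0] at this
    exact this.mono_left nhdsWithin_le_nhds
  have hL : Tendsto (fun t : ℝ => (t⁻¹ • (Γ t - Γ 0)) (D.U (-t) (D.j v))) (𝓝[≠] 0)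
      (𝓝 ((D.b (D.j u) - (Complex.I * ε) • D.b' (D.j u)) (D.j v))) := by
    have h1 : Tendsto (fun t : ℝ => t⁻¹ • (Γ t - Γ 0)) (𝓝[≠] 0)
        (𝓝 (D.b (D.j u) - (Complex.I * ε) • D.b' (D.j u))) := by
      have := hasDerivAt_iff_tendsto_slope.1 hΓ'
      refine this.congr fun t => ?_
      rw [slope_def_module, sub_zero]
    exact tendsto_antiDual_apply h1 hcontU
  have hφ : ∀ x, HasDerivAt (fun t => f (D.U t x)) (f' x) 0 := fun x => by
    have h1 := ((ContinuousLinearMap.apply' ℂ (starRingEnd ℂ) x).restrictScalars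
      ℝ).hasFDerivAt.comp_hasDerivAt (0 : ℝ) hf
    refine h1.congr_of_eventuallyEq (Eventually.of_forall fun t => ?_)
    simp [dualGroup_apply]
  have hR : HasDerivAt (fun t => starRingEnd ℂ (f (D.U t (D.j u))) - f (D.U (-t) (D.j v)))
      (starRingEnd ℂ (f' (D.j u)) - -f' (D.j v)) 0 := by
    refine HasDerivAt.sub ?_ ?_
    · exact (hφ (D.j u)).star
    · have h2 := hφ (D.j v)
      rw [← neg_zero] at h2
      have h3 := h2.scomp (0 : ℝ) (hasDerivAt_neg (0 : ℝ))
      rw [neg_one_smul] at h3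
      exact h3
  have hR' := hasDerivAt_iff_tendsto_slope.1 hR
  have heq := tendsto_nhds_unique (hR'.congr fun t => ?_) hL
  · simp only [_root_.sub_apply, _root_.smul_apply, smul_eq_mul] at heq
    linear_combination -heq
  · rw [slope_def_module, sub_zero, _root_.smul_apply, key, neg_zero, hU0]
    simp [hu.apply_eq hv]

/-- One dyadic step of the differential inequality: the bound at `2η` is carried down to `η`. The
maximum `m` of `√|⟨f, G_ε f⟩|` over `[η, 2η]` satisfies a quadratic inequality, which is solved
for `m`. -/
theorem sqrt_step {M : ℝ} (hM : ‖D.b'‖ ≤ M) {z : ℂ} (hz : 0 ≤ z.re) (hz' : 0 ≤ z.im)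
    (g : GraphSpace (generator (dualGroup D.U))) {u v : ℝ → K}
    (hu : ∀ ε, 0 < ε → D.IsSol ε z (dualGeneratorIncl D.U g) (u ε))
    (hv : ∀ ε, 0 < ε → D.IsDualSol ε z (dualGeneratorIncl D.U g) (v ε)) {η : ℝ} (hη : 0 < η)
    (hη1 : 2 * η ≤ 1) (hηM : (1 + D.c₁) * M * η ≤ 1 / 2) :
    √‖dualGeneratorIncl D.U g (D.j (v η))‖ ≤ (1 + 2 * ((1 + D.c₁) * M * η)) *
      (√‖dualGeneratorIncl D.U g (D.j (v (2 * η)))‖ +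
        2 * √(1 + D.c₁) * √η * ‖GraphSpace.act _ g‖) := by
  set f := dualGeneratorIncl D.U g
  set F : ℝ → ℂ := fun ε => f (D.j (v ε)) with hF
  set c := 1 + D.c₁ with hc
  set a := ‖GraphSpace.act _ g‖
  have hc0 : 0 < c := by have := D.c₁_pos; positivity
  have hM0 : 0 ≤ M := (norm_nonneg D.b').trans hM
  have hder : ∀ ε, 0 < ε → HasDerivAt F (Complex.I * D.b (D.j (u ε)) (D.j (v ε))) ε :=
    fun ε hε => hasDerivAt_apply_dualSol hz hz' hu hv hε
  have hcont : ContinuousOn F (Icc η (2 * η)) := fun ε hε =>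
    (hder ε (hη.trans_le hε.1)).continuousAt.continuousWithinAt
  have hne : (Icc η (2 * η)).Nonempty := ⟨η, by constructor <;> linarith⟩
  obtain ⟨τ, hτ, hmax⟩ := isCompact_Icc.exists_isMaxOn hne hcont.norm
  set m := √‖F τ‖ with hm
  have hm2 : m ^ 2 = ‖F τ‖ := Real.sq_sqrt (norm_nonneg _)
  have hm0 : 0 ≤ m := Real.sqrt_nonneg _
  -- the bound of the derivative
  have hbound : ∀ ε ∈ Icc η (2 * η), ‖Complex.I * D.b (D.j (u ε)) (D.j (v ε))‖ ≤
      2 * a * (√(c / η) * m) + M * c * m ^ 2 := by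
    intro ε hε
    have hε0 : 0 < ε := hη.trans_le hε.1
    have hε1 : ε ≤ 1 := hε.2.trans hη1
    have hle : √‖F ε‖ ≤ m := Real.sqrt_le_sqrt (hmax hε)
    have hFu : ‖f (D.j (u ε))‖ = ‖F ε‖ := by
      rw [hF]
      simp only
      rw [(hu ε hε0).apply_eq (hv ε hε0), RCLike.norm_conj]
    have hju' := norm_j_le_of_bound hε0 hz' (norm_nonneg _) ((hu ε hε0).bound hε0.le hε1 hz)
    have hjv' := norm_j_le_of_bound hε0 hz' (norm_nonneg _) ((hv ε hε0).bound hε0.le hε1 hz)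
    rw [hFu] at hju'
    have hju : ‖D.j (u ε)‖ ≤ √(c / ε) * m := hju'.trans (by gcongr)
    have hjv : ‖D.j (v ε)‖ ≤ √(c / ε) * m := hjv'.trans (by gcongr)
    rw [norm_mul, Complex.norm_I, one_mul,
      virial (hu ε hε0) (hv ε hε0) (hasDerivAt_dualGroup g)]
    have hce : √(c / ε) ≤ √(c / η) := by
      apply Real.sqrt_le_sqrt
      gcongr
      exact hε.1
    have hact : ∀ x, ‖(-(Complex.I • GraphSpace.act (generator (dualGroup D.U)) g)) x‖ ≤
        a * ‖x‖ := fun x => by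
      refine (ContinuousLinearMap.le_opNorm _ x).trans (le_of_eq ?_)
      rw [norm_neg, norm_smul, Complex.norm_I, one_mul]
    have hb' : ‖D.b' (D.j (u ε)) (D.j (v ε))‖ ≤ M * ‖D.j (u ε)‖ * ‖D.j (v ε)‖ :=
      (ContinuousLinearMap.le_opNorm₂ _ _ _).trans (by gcongr)
    calc _ ≤ a * ‖D.j (u ε)‖ + a * ‖D.j (v ε)‖ + ε * (M * ‖D.j (u ε)‖ * ‖D.j (v ε)‖) := by
          refine (norm_add_le _ _).trans (add_le_add ((norm_add_le _ _).trans
            (add_le_add ?_ (hact _))) ?_)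
          · rw [RCLike.norm_conj]
            exact hact _
          · rw [norm_mul, norm_mul, Complex.norm_I, one_mul, Complex.norm_real,
              Real.norm_of_nonneg hε0.le]
            gcongr
      _ ≤ a * (√(c / ε) * m) + a * (√(c / ε) * m) +
          ε * (M * (√(c / ε) * m) * (√(c / ε) * m)) := by gcongr
      _ = 2 * a * (√(c / ε) * m) + M * (ε * √(c / ε) ^ 2) * m ^ 2 := by ring
      _ = 2 * a * (√(c / ε) * m) + M * c * m ^ 2 := by
          rw [Real.sq_sqrt (by positivity)]
          field_simp
      _ ≤ _ := by gcongr
  have hdiff : ‖F τ - F (2 * η)‖ ≤ (2 * a * (√(c / η) * m) + M * c * m ^ 2) * η := by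
    have h := Convex.norm_image_sub_le_of_norm_hasDerivWithin_le
      (f := F) (f' := fun ε => Complex.I * D.b (D.j (u ε)) (D.j (v ε))) (s := Icc η (2 * η))
      (fun ε hε => (hder ε (hη.trans_le hε.1)).hasDerivWithinAt) hbound (convex_Icc _ _)
      (right_mem_Icc.2 (by linarith)) hτ
    refine h.trans ?_
    gcongr
    rw [Real.norm_eq_abs, abs_le]
    constructor <;> linarith [hτ.1, hτ.2]
  set p := √‖F (2 * η)‖ with hp
  have hp2 : p ^ 2 = ‖F (2 * η)‖ := Real.sq_sqrt (norm_nonneg _)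
  have hp0 : 0 ≤ p := Real.sqrt_nonneg _
  have hsq : √(c / η) * η = √c * √η := by
    rw [Real.sqrt_div hc0.le, div_mul_eq_mul_div, div_eq_iff (by positivity), mul_assoc,
      Real.mul_self_sqrt hη.le]
  set α := 2 * √c * √η * a with hα
  have hα0 : 0 ≤ α := by positivity
  have hquad : m ^ 2 ≤ p ^ 2 + α * m + c * M * η * m ^ 2 := by
    have h1 : ‖F τ‖ ≤ ‖F (2 * η)‖ + ‖F τ - F (2 * η)‖ := norm_le_norm_add_norm_sub' _ _
    rw [hm2, hp2]
    have h2 : (2 * a * (√(c / η) * m) + M * c * m ^ 2) * η = α * m + c * M * η * ‖F τ‖ := by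
      rw [hα, ← hm2]
      linear_combination 2 * a * m * hsq
    linarith
  set κ := c * M * η with hκ
  have hκ0 : 0 ≤ κ := by positivity
  have hlin : m * (1 - κ) ≤ p + α := by
    rcases le_or_gt m p with h | h
    · nlinarith
    · have hmpos : 0 < m := hp0.trans_lt h
      refine le_of_mul_le_mul_right ?_ hmpos
      nlinarith
  have hmle : m ≤ (1 + 2 * κ) * (p + α) := by
    have : m * 1 ≤ m * (1 - κ) * (1 + 2 * κ) := by
      rw [mul_assoc]
      gcongr
      nlinarith
    nlinarith
  exact (Real.sqrt_le_sqrt (hmax (left_mem_Icc.2 (by linarith)))).trans hmle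

/-- The effect of changing `f` on the square root of `|⟨f, G_ε f⟩|`. -/
theorem sqrt_change {ε : ℝ} (hε : 0 < ε) (hε1 : ε ≤ 1) {z : ℂ} (hz : 0 ≤ z.re) (hz' : 0 ≤ z.im)
    {f g : AntiDual E} {u v v' : K} (hu : D.IsSol ε z f u) (hv : D.IsDualSol ε z f v)
(hv' : D.IsDualSol ε z g v') :
    √‖f (D.j v)‖ ≤ √‖g (D.j v')‖ + √((1 + D.c₁) / ε) * ‖f - g‖ := by
  have h1 : f (D.j v) - g (D.j v') = starRingEnd ℂ ((f - g) (D.j u)) + (f - g) (D.j v') := by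
    have h2 := hu v'
    rw [hv' u] at h2
    rw [hu.apply_eq hv]
    simp only [_root_.sub_apply, _root_.map_sub]
    rw [← h2]
    ring
  have hju := norm_j_le_of_bound hε hz' (norm_nonneg _) (hu.bound hε.le hε1 hz)
  have hjv := norm_j_le_of_bound hε hz' (norm_nonneg _) (hv'.bound hε.le hε1 hz)
  have hfu : ‖f (D.j u)‖ = ‖f (D.j v)‖ := by rw [hu.apply_eq hv, RCLike.norm_conj]
  rw [hfu] at hju
  set x := √‖f (D.j v)‖ with hx
  set y := √‖g (D.j v')‖ with hy
  set s := √((1 + D.c₁) / ε)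
  have hx0 : 0 ≤ x := Real.sqrt_nonneg _
  have hy0 : 0 ≤ y := Real.sqrt_nonneg _
  have h3 : x ^ 2 ≤ y ^ 2 + s * ‖f - g‖ * (x + y) := by
    rw [hx, hy, Real.sq_sqrt (norm_nonneg _), Real.sq_sqrt (norm_nonneg _)]
    have h4 := norm_le_norm_add_norm_sub' (f (D.j v)) (g (D.j v'))
    have h5 : ‖f (D.j v) - g (D.j v')‖ ≤ ‖f - g‖ * (s * x) + ‖f - g‖ * (s * y) := by
      rw [h1]
      refine (norm_add_le _ _).trans (add_le_add ?_ ?_)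
      · rw [RCLike.norm_conj]
        exact (ContinuousLinearMap.le_opNorm _ _).trans (by gcongr)
      · exact (ContinuousLinearMap.le_opNorm _ _).trans (by gcongr)
    linarith
  have hs : 0 ≤ s * ‖f - g‖ := by positivity
  by_contra! hlt
  have : 0 < x + y := by linarith
  nlinarith

end ConjugateForms

namespace ConjugateForms

/-! ### The limiting absorption principle for the forms -/

/-- A discrete Gronwall lemma. -/
theorem le_of_recursion {p q κ : ℕ → ℝ} (hq : ∀ n, 0 ≤ q n) (hκ : ∀ n, 0 ≤ κ n)
    (hp : 0 ≤ p 0) (h : ∀ n, p (n + 1) ≤ (1 + κ n) * (p n + q n)) (n : ℕ) :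
    p n ≤ Real.exp (∑ m ∈ Finset.range n, κ m) * (p 0 + ∑ m ∈ Finset.range n, q m) := by
  induction n with
  | zero => simp
  | succ n ih =>
    have hs : 0 ≤ ∑ m ∈ Finset.range n, κ m := Finset.sum_nonneg fun m _ => hκ m
    have h1 : 1 ≤ Real.exp (∑ m ∈ Finset.range n, κ m) := Real.one_le_exp hs
    have h2 : 1 + κ n ≤ Real.exp (κ n) := by linarith [Real.add_one_le_exp (κ n)]
    have hQ : 0 ≤ ∑ m ∈ Finset.range n, q m := Finset.sum_nonneg fun m _ => hq m
    rw [Finset.sum_range_succ, Finset.sum_range_succ, add_comm (∑ m ∈ Finset.range n, κ m),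
      Real.exp_add, mul_assoc]
    have h3 : p n + q n ≤ Real.exp (∑ m ∈ Finset.range n, κ m) *
        (p 0 + (∑ m ∈ Finset.range n, q m + q n)) := by
      have := mul_le_mul_of_nonneg_right h1 (hq n)
      nlinarith
    calc p (n + 1) ≤ (1 + κ n) * (p n + q n) := h n
      _ ≤ (1 + κ n) * (Real.exp (∑ m ∈ Finset.range n, κ m) *
        (p 0 + (∑ m ∈ Finset.range n, q m + q n))) := by
          have := hκ n
          gcongr
      _ ≤ _ := by
          have := hq n
          gcongr

variable {E G K : Type*} [NormedAddCommGroup E] [InnerProductSpace ℂ E]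
  [NormedAddCommGroup G] [InnerProductSpace ℂ G]
  [NormedAddCommGroup K] [InnerProductSpace ℂ K]

/-- The solutions of the modified equation with right hand side in `G` converge to a solution of
the limit equation, if the image of the latter under `b` is in `G`. -/
theorem tendsto_j_of_regular {D : ConjugateForms E G K} {z : ℂ} (hz : 0 ≤ z.re) (hz' : 0 < z.im)
    {k₀ : K} {g β : G} (hk : ∀ l, D.form 0 z k₀ l = inner ℂ (D.i l) g)
    (hβ : ∀ l, D.b (D.j k₀) (D.j l) = inner ℂ (D.i l) β) {ε : ℕ → ℝ} (hε : ∀ n, 0 < ε n)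
    (hε1 : ∀ n, ε n ≤ 1) (hlim : Tendsto ε atTop (𝓝 0)) {w : ℕ → K}
    (hw : ∀ n l, D.form (ε n) z (w n) l = inner ℂ (D.i l) g) :
    Tendsto (fun n => D.j (w n)) atTop (𝓝 (D.j k₀)) := by
  set c := 1 + D.c₁ with hcdef
  have hc : 0 < c := by have := D.c₁_pos; positivity
  have hest : ∀ n, ‖D.j (w n) - D.j k₀‖ ^ 2 ≤ c ^ 2 * ‖β‖ ^ 2 / z.im * ε n := by
    intro n
    have h0 := hε n
    have h1 := D.coercive h0.le hz (w n - k₀)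
    have h2 : D.form (ε n) z (w n - k₀) (w n - k₀) =
        Complex.I * ε n * inner ℂ (D.i (w n - k₀)) β := by
      have h3 := form_sub_form (D := D) 0 (ε n) z k₀ (w n - k₀)
      rw [hk, hβ] at h3
      rw [_root_.map_sub (D.form (ε n) z), _root_.sub_apply, hw]
      simp only [Complex.ofReal_zero, sub_zero] at h3
      linear_combination -h3
    have h4 : ‖D.form (ε n) z (w n - k₀) (w n - k₀)‖ ≤ ε n * (‖D.i (w n - k₀)‖ * ‖β‖) := by
      rw [h2, norm_mul, norm_mul, Complex.norm_I, one_mul, Complex.norm_real,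
        Real.norm_of_nonneg h0.le]
      gcongr
      exact norm_inner_le_norm _ _
    rw [← _root_.map_sub]
    set x := ‖D.i (w n - k₀)‖
    set y := ‖D.j (w n - k₀)‖
    have h5 : z.im * x ^ 2 + ε n * y ^ 2 ≤ c * (ε n * (x * ‖β‖)) := by
      refine h1.trans (mul_le_mul ?_ h4 (norm_nonneg _) hc.le)
      have := D.c₁_pos
      have := hε1 n
      rw [hcdef]
      nlinarith
    have hx0 : 0 ≤ x := norm_nonneg _
    have h6 : z.im * x ≤ c * (ε n * ‖β‖) := by
      rcases hx0.eq_or_lt with hx | hx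
      · rw [← hx, mul_zero]; positivity
      · refine le_of_mul_le_mul_right ?_ hx
        nlinarith [mul_nonneg h0.le (sq_nonneg y)]
    have h7 : y ^ 2 ≤ c * (x * ‖β‖) := by
      refine le_of_mul_le_mul_left ?_ h0
      nlinarith [mul_nonneg hz'.le (sq_nonneg x)]
    rw [div_mul_eq_mul_div, le_div_iff₀ hz']
    calc y ^ 2 * z.im ≤ c * (x * ‖β‖) * z.im := by gcongr
      _ = c * ‖β‖ * (z.im * x) := by ring
      _ ≤ c * ‖β‖ * (c * (ε n * ‖β‖)) := by gcongr
      _ = _ := by ring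
  rw [tendsto_iff_norm_sub_tendsto_zero]
  have h8 : Tendsto (fun n => √(c ^ 2 * ‖β‖ ^ 2 / z.im * ε n)) atTop (𝓝 0) := by
    have := (hlim.const_mul (c ^ 2 * ‖β‖ ^ 2 / z.im)).sqrt
    simpa using this
  exact squeeze_zero (fun _ => norm_nonneg _) (fun n => Real.le_sqrt_of_sq_le (hest n)) h8

variable [CompleteSpace K]

set_option maxHeartbeats 1000000 in
/-- The limiting absorption principle: `e ∈ E*` is approximated by elements `f n` of the domain of
the generator of the dual group at the scales `ε₀ 2^{-n}`. -/
theorem exists_bound (D : ConjugateForms E G K) : ∃ C ε₀ : ℝ, 0 < C ∧ 0 < ε₀ ∧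
    ∀ (z : ℂ), 0 ≤ z.re → 0 < z.im →
    ∀ (f : ℕ → GraphSpace (generator (dualGroup D.U))) (e : AntiDual E) (A : ℝ),
      Tendsto (fun n => dualGeneratorIncl D.U (f n)) atTop (𝓝 e) →
      (∀ n, ‖dualGeneratorIncl D.U (f 0)‖ + ∑ m ∈ Finset.range n,
        (√(ε₀ / 2 ^ m) * ‖GraphSpace.act _ (f m)‖ +
          ‖dualGeneratorIncl D.U (f (m + 1)) - dualGeneratorIncl D.U (f m)‖ / √(ε₀ / 2 ^ m)) ≤ A) →
      ∀ (k₀ : K) (g β : G), (∀ l, D.form 0 z k₀ l = inner ℂ (D.i l) g) →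
        (∀ l, D.b (D.j k₀) (D.j l) = inner ℂ (D.i l) β) →
        √z.im * ‖e (D.j k₀)‖ ≤ C * A * ‖g‖ := by
  set c := 1 + D.c₁ with hcdef
  have hc : 0 < c := by have := D.c₁_pos; positivity
  set M := ‖D.b'‖ with hM
  have hM0 : 0 ≤ M := norm_nonneg D.b'
  -- with this `ε₀` the step from the scale `ε₀ 2^{-n}` to the next costs a factor at most
  -- `1 + 2^{-n}`, and the product of these factors is at most `exp 2`
  set ε₀ : ℝ := 1 / (1 + c * M) with hε₀
  have hcM : 0 ≤ c * M := by positivity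
  have hε₀pos : 0 < ε₀ := by positivity
  have hε₀1 : ε₀ ≤ 1 := by
    rw [hε₀, div_le_one (by positivity)]
    linarith
  have hε₀M : c * M * ε₀ ≤ 1 := by
    rw [hε₀, mul_one_div, div_le_one (by positivity)]
    linarith
  set B : ℝ := √(c / ε₀) + 2 * √c with hB
  have hB0 : 0 < B := by positivity
  refine ⟨√c * (Real.exp 2 * B), ε₀, by positivity, hε₀pos, ?_⟩
  intro z hz hz' f e A hfe hA k₀ g β hk hβ
  set ε : ℕ → ℝ := fun n => ε₀ / 2 ^ n with hε
  have hεpos : ∀ n, 0 < ε n := fun n => by positivity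
  have hε1 : ∀ n, ε n ≤ 1 := fun n =>
    (div_le_self hε₀pos.le (one_le_pow₀ (by norm_num))).trans hε₀1
  have hεs : ∀ n, ε n = 2 * ε (n + 1) := fun n => by
    simp only [hε]
    rw [pow_succ]
    field_simp
  have hεlim : Tendsto ε atTop (𝓝 0) := by
    have := (tendsto_pow_atTop_nhds_zero_of_lt_one (r := (1 / 2 : ℝ)) (by norm_num)
      (by norm_num)).const_mul ε₀
    rw [mul_zero] at this
    refine this.congr fun n => ?_
    simp only [hε]
    rw [one_div, inv_pow, div_eq_mul_inv]
  set F : ℕ → AntiDual E := fun n => dualGeneratorIncl D.U (f n) with hF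
  have hsol : ∀ n (s : ℝ), ∃ u v : K, 0 < s → D.IsSol s z (F n) u ∧ D.IsDualSol s z (F n) v := by
    intro n s
    by_cases hs : 0 < s
    · obtain ⟨⟨u, hu⟩, v, hv⟩ := D.exists_isSol hs hz hz' (F n)
      exact ⟨u, v, fun _ => ⟨hu, hv⟩⟩
    · exact ⟨0, 0, fun h => (hs h).elim⟩
  choose u v huv using hsol
  set p : ℕ → ℝ := fun n => √‖F n (D.j (v n (ε n)))‖ with hp
  set a : ℕ → ℝ := fun n => √(ε n) * ‖GraphSpace.act _ (f n)‖ with ha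
  set d : ℕ → ℝ := fun n => ‖F (n + 1) - F n‖ / √(ε n) with hd
  have hp0 : p 0 ≤ √(c / ε₀) * ‖F 0‖ := by
    have hε0 : ε 0 = ε₀ := by simp [hε]
    have h1 := norm_j_le_of_bound (hεpos 0) hz'.le (norm_nonneg _)
      ((huv 0 (ε 0) (hεpos 0)).2.bound (hεpos 0).le (hε1 0) hz)
    have h2 := (F 0).le_opNorm (D.j (v 0 (ε 0)))
    rw [hε0] at h1 h2
    simp only [hp, hε0]
    set q := ‖F 0 (D.j (v 0 ε₀))‖
    have h3 : √q * √q ≤ ‖F 0‖ * (√(c / ε₀) * √q) := by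
      rw [Real.mul_self_sqrt (norm_nonneg _)]
      exact h2.trans (by gcongr)
    rcases (Real.sqrt_nonneg q).eq_or_lt with h4 | h4
    · rw [← h4]; positivity
    · refine le_of_mul_le_mul_right ?_ h4
      linarith
  have hrec : ∀ n, p (n + 1) ≤ (1 + 1 / 2 ^ n) * (p n + 2 * √c * (a n + d n)) := by
    intro n
    have hη := hεpos (n + 1)
    have h2η : 2 * ε (n + 1) ≤ 1 := by rw [← hεs]; exact hε1 n
    have hκ : c * M * ε (n + 1) ≤ 1 / 2 ^ (n + 1) := by
      calc c * M * ε (n + 1) = c * M * ε₀ / 2 ^ (n + 1) := by simp only [hε]; ring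
        _ ≤ _ := by gcongr
    have hκ2 : c * M * ε (n + 1) ≤ 1 / 2 := by
      refine hκ.trans ?_
      rw [pow_succ]
      gcongr
      exact le_mul_of_one_le_left (by norm_num) (one_le_pow₀ (by norm_num))
    have h1 := sqrt_step (D := D) le_rfl hz hz'.le (f n) (fun s hs => (huv n s hs).1)
      (fun s hs => (huv n s hs).2) hη h2η hκ2
    rw [← hεs] at h1
    have h2 := sqrt_change hη (hε1 _) hz hz'.le (huv (n + 1) _ hη).1 (huv (n + 1) _ hη).2
      (huv n _ hη).2
    have hsq : √(ε (n + 1)) ≤ √(ε n) := Real.sqrt_le_sqrt (by rw [hεs n]; linarith)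
    have hsd : √(c / ε (n + 1)) ≤ 2 * √c / √(ε n) := by
      rw [Real.sqrt_div hc.le, div_le_div_iff₀ (by positivity) (Real.sqrt_pos.2 (hεpos n))]
      have : √(ε n) ≤ 2 * √(ε (n + 1)) := by
        apply Real.sqrt_le_iff.2 ⟨by positivity, ?_⟩
        rw [mul_pow, Real.sq_sqrt hη.le, hεs n]
        linarith
      calc √c * √(ε n) ≤ √c * (2 * √(ε (n + 1))) := by gcongr
        _ = _ := by ring
    have hκ3 : 1 + 2 * (c * M * ε (n + 1)) ≤ 1 + 1 / 2 ^ n := by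
      have : (2 : ℝ) * (1 / 2 ^ (n + 1)) = 1 / 2 ^ n := by rw [pow_succ]; field_simp
      linarith
    calc p (n + 1) ≤ √‖F n (D.j (v n (ε (n + 1))))‖ + √(c / ε (n + 1)) * ‖F (n + 1) - F n‖ := h2
      _ ≤ (1 + 2 * (c * M * ε (n + 1))) * (p n + 2 * √c * √(ε (n + 1)) *
            ‖GraphSpace.act _ (f n)‖) + 2 * √c / √(ε n) * ‖F (n + 1) - F n‖ := by
          gcongr
      _ ≤ (1 + 1 / 2 ^ n) * (p n + 2 * √c * √(ε n) *
            ‖GraphSpace.act _ (f n)‖) + 2 * √c / √(ε n) * ‖F (n + 1) - F n‖ := by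
          gcongr
      _ = (1 + 1 / 2 ^ n) * (p n + 2 * √c * a n) + 1 * (2 * √c * d n) := by
          simp only [ha, hd]; ring
      _ ≤ (1 + 1 / 2 ^ n) * (p n + 2 * √c * a n) + (1 + 1 / 2 ^ n) * (2 * √c * d n) := by
          gcongr
          linarith [show (0 : ℝ) ≤ 1 / 2 ^ n by positivity]
      _ = _ := by ring
  have hpn : ∀ n, p n ≤ Real.exp 2 * B * A := by
    intro n
    have h1 := le_of_recursion (p := p) (q := fun n => 2 * √c * (a n + d n))
      (κ := fun n => 1 / 2 ^ n) (fun n => by positivity) (fun n => by positivity)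
      (Real.sqrt_nonneg _) hrec n
    have h2 : ∑ m ∈ Finset.range n, (1 : ℝ) / 2 ^ m ≤ 2 := by
      have := sum_geometric_two_le n
      simpa [one_div_pow] using this
    have h3 := hA n
    have h4 : ∑ m ∈ Finset.range n, 2 * √c * (a m + d m) =
        2 * √c * ∑ m ∈ Finset.range n, (a m + d m) := by rw [Finset.mul_sum]
    have h5 : 0 ≤ ∑ m ∈ Finset.range n, (a m + d m) :=
      Finset.sum_nonneg fun m _ => by positivity
    rw [h4] at h1
    refine h1.trans ?_
    change ‖F 0‖ + ∑ m ∈ Finset.range n, (a m + d m) ≤ A at h3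
    generalize ∑ m ∈ Finset.range n, (a m + d m) = S at h3 h5 ⊢
    have hle : p 0 + 2 * √c * S ≤ B * A := by
      calc _ ≤ √(c / ε₀) * ‖F 0‖ + 2 * √c * S := by gcongr
        _ ≤ B * ‖F 0‖ + B * S := by
          have h6 : 0 ≤ √(c / ε₀) := Real.sqrt_nonneg _
          have h7 : 0 ≤ 2 * √c := by positivity
          gcongr <;> rw [hB] <;> linarith
        _ = B * (‖F 0‖ + S) := by ring
        _ ≤ B * A := mul_le_mul_of_nonneg_left h3 hB0.le
    have hnn : 0 ≤ p 0 + 2 * √c * S :=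
      add_nonneg (Real.sqrt_nonneg _) (mul_nonneg (by positivity) h5)
    rw [mul_assoc (Real.exp 2)]
    exact mul_le_mul (Real.exp_le_exp.2 h2) hle hnn (Real.exp_pos _).le
  -- the limit `n → ∞`
  have hw : ∀ n, ∃ w : K, ∀ l, D.form (ε n) z w l = inner ℂ (D.i l) g := fun n => by
    obtain ⟨⟨w, hw⟩, -⟩ := D.exists_sol (hεpos n) hz hz' ((antiRiesz G g).comp D.i)
    exact ⟨w, hw⟩
  choose w hw using hw
  have hlimw := tendsto_j_of_regular hz hz' hk hβ hεpos hε1 hεlim hw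
  have hlim : Tendsto (fun n => √z.im * ‖F n (D.j (w n))‖) atTop
      (𝓝 (√z.im * ‖e (D.j k₀)‖)) := (tendsto_antiDual_apply hfe hlimw).norm.const_mul _
  refine le_of_tendsto hlim (Eventually.of_forall fun n => ?_)
  have h1 : ‖F n (D.j (w n))‖ ≤ ‖D.i (v n (ε n))‖ * ‖g‖ := by
    rw [← RCLike.norm_conj, ← (huv n _ (hεpos n)).2 (w n), hw]
    exact norm_inner_le_norm _ _
  have h2 : √z.im * ‖D.i (v n (ε n))‖ ≤ √c * p n := by
    have h3 := (huv n _ (hεpos n)).2.bound (hεpos n).le (hε1 n) hz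
    have h4 : 0 ≤ ε n * ‖D.j (v n (ε n))‖ ^ 2 := by have := hεpos n; positivity
    rw [hp, ← Real.sqrt_mul hc.le]
    refine Real.le_sqrt_of_sq_le ?_
    rw [mul_pow, Real.sq_sqrt hz'.le]
    linarith
  calc √z.im * ‖F n (D.j (w n))‖ ≤ √z.im * (‖D.i (v n (ε n))‖ * ‖g‖) := by gcongr
    _ = (√z.im * ‖D.i (v n (ε n))‖) * ‖g‖ := by ring
    _ ≤ (√c * (Real.exp 2 * B * A)) * ‖g‖ := by
      exact mul_le_mul_of_nonneg_right
        (h2.trans (mul_le_mul_of_nonneg_left (hpn n) (Real.sqrt_nonneg _))) (norm_nonneg _)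
    _ = _ := by ring

end ConjugateForms

/-! ### Dyadic approximation in the real interpolation space -/

section Interpolation

variable {Y X : Type*} [NormedAddCommGroup Y] [NormedSpace ℂ Y]
  [NormedAddCommGroup X] [NormedSpace ℂ X] (j : Y →L[ℂ] X)

theorem kFunctional_ne_top (τ : ℝ) (x : X) : kFunctional j τ x ≠ ∞ := by
  refine ((iInf_le _ 0).trans_lt ?_).ne
  simp only [enorm_zero, _root_.map_zero, sub_zero, zero_add]
  exact ENNReal.mul_lt_top ENNReal.ofReal_lt_top (by simp)

theorem le_setLIntegral_kFunctional {τ : ℝ} (hτ : 0 < τ) (x : X) :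
    ENNReal.ofReal (1 / (4 * √τ)) * kFunctional j τ x ≤
      ∫⁻ s in Ioc τ (2 * τ), ENNReal.ofReal (s ^ (-(3 / 2) : ℝ)) * kFunctional j s x := by
  have h1 : 1 / (4 * √τ) ≤ (2 * τ) ^ (-(3 / 2) : ℝ) * (2 * τ - τ) := by
    have h2 : (2 * τ) ^ (-(3 / 2) : ℝ) = 1 / (2 * τ * √(2 * τ)) := by
      rw [Real.rpow_neg (by positivity), Real.sqrt_eq_rpow, one_div]
      congr 1
      nth_rewrite 2 [← Real.rpow_one (2 * τ)]
      rw [← Real.rpow_add (by positivity)]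
      norm_num
    have h3 : √(2 * τ) ≤ 2 * √τ := by
      apply Real.sqrt_le_iff.2 ⟨by positivity, ?_⟩
      rw [mul_pow, Real.sq_sqrt hτ.le]
      linarith
    have h4 : 0 < √(2 * τ) := by positivity
    rw [h2]
    have : 1 / (2 * τ * √(2 * τ)) * (2 * τ - τ) = 1 / (2 * √(2 * τ)) := by
      field_simp
      ring
    rw [this]
    apply one_div_le_one_div_of_le (by positivity)
    linarith
  calc _ ≤ ENNReal.ofReal ((2 * τ) ^ (-(3 / 2) : ℝ) * (2 * τ - τ)) * kFunctional j τ x := by gcongr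
    _ = ∫⁻ _ in Ioc τ (2 * τ), ENNReal.ofReal ((2 * τ) ^ (-(3 / 2) : ℝ)) * kFunctional j τ x := by
      rw [setLIntegral_const, Real.volume_Ioc, ENNReal.ofReal_mul (by positivity)]
      ring
    _ ≤ _ := by
      refine setLIntegral_mono' measurableSet_Ioc fun s hs => ?_
      exact mul_le_mul' (ENNReal.ofReal_le_ofReal
        (Real.rpow_le_rpow_of_nonpos (hτ.trans hs.1) hs.2 (by norm_num)))
        (kFunctional_mono j x hs.1.le)

theorem sum_kFunctional_le {τ₀ : ℝ} (hτ₀ : 0 < τ₀) (x : X) (n : ℕ) :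
    ∑ m ∈ Finset.range n, ENNReal.ofReal (1 / (4 * √(2 ^ m * τ₀))) *
      kFunctional j (2 ^ m * τ₀) x ≤ interpENorm j x := by
  have h : ∑ m ∈ Finset.range n, ENNReal.ofReal (1 / (4 * √(2 ^ m * τ₀))) *
      kFunctional j (2 ^ m * τ₀) x ≤ ∫⁻ s in Ioc τ₀ (2 ^ n * τ₀),
        ENNReal.ofReal (s ^ (-(3 / 2) : ℝ)) * kFunctional j s x := by
    induction n with
    | zero => simp
    | succ n ih =>
      have h1 : τ₀ ≤ 2 ^ n * τ₀ := le_mul_of_one_le_left hτ₀.le (one_le_pow₀ (by norm_num))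
      have h2 : (2 : ℝ) ^ (n + 1) * τ₀ = 2 * (2 ^ n * τ₀) := by ring
      have h3 : 0 < 2 ^ n * τ₀ := by positivity
      rw [Finset.sum_range_succ, ← Ioc_union_Ioc_eq_Ioc h1
        (show 2 ^ n * τ₀ ≤ 2 ^ (n + 1) * τ₀ by rw [h2]; linarith),
        lintegral_union measurableSet_Ioc
          (Set.disjoint_left.2 fun s hs hs' => absurd hs.2 (not_le.2 hs'.1))]
      refine add_le_add ih ?_
      rw [h2]
      exact le_setLIntegral_kFunctional j h3 x
  exact h.trans (lintegral_mono_set fun s hs => hτ₀.trans hs.1)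

/-- An element of `(Y, X)_{1/2,1}` is approximated at the dyadic scales by elements of `Y`. -/
theorem exists_dyadic_approximation (hj : ∀ y, ‖j y‖ ≤ ‖y‖) {ε₀ : ℝ} (hε₀ : 0 < ε₀)
    (e : InterpSpace j) : ∃ y : ℕ → Y,
      Tendsto (fun n => j (y n)) atTop (𝓝 (InterpSpace.inclₗ j e)) ∧
      ∀ n, ‖j (y 0)‖ + ∑ m ∈ Finset.range n, (√(ε₀ / 2 ^ m) * ‖y m‖ +
          ‖j (y (m + 1)) - j (y m)‖ / √(ε₀ / 2 ^ m)) ≤ (18 + 6 / √ε₀) * ‖e‖ := by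
  set x := InterpSpace.inclₗ j e with hx
  rcases eq_or_ne e 0 with he | he
  · refine ⟨0, ?_, ?_⟩
    · simp [hx, he]
    · simp [he]
  have hN : 0 < ‖e‖ := norm_pos_iff.2 he
  set N := ‖e‖ with hNdef
  set ε : ℕ → ℝ := fun n => ε₀ / 2 ^ n with hε
  have hεpos : ∀ n, 0 < ε n := fun n => by positivity
  set τ : ℕ → ℝ := fun n => 2 ^ n * ε₀⁻¹ with hτ
  have hτε : ∀ n, τ n = (ε n)⁻¹ := fun n => by simp only [hτ, hε]; rw [inv_div]; rfl
  have hτpos : ∀ n, 0 < τ n := fun n => by positivity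
  set k : ℕ → ℝ := fun n => (kFunctional j (τ n) x).toReal with hk
  have hchoice : ∀ n, ∃ y : Y, ‖y‖ + τ n * ‖x - j y‖ ≤ k n + N / 2 ^ n * (√(ε n))⁻¹ := by
    intro n
    have hδ : 0 < N / 2 ^ n * (√(ε n))⁻¹ := by
      have := Real.sqrt_pos.2 (hεpos n)
      positivity
    have h1 : kFunctional j (τ n) x <
        kFunctional j (τ n) x + ENNReal.ofReal (N / 2 ^ n * (√(ε n))⁻¹) :=
      ENNReal.lt_add_right (kFunctional_ne_top j _ _) (by simpa using hδ)
    obtain ⟨y, hy⟩ := iInf_lt_iff.1 h1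
    refine ⟨y, ?_⟩
    have h2 := ENNReal.toReal_mono
      (ENNReal.add_ne_top.2 ⟨kFunctional_ne_top j (τ n) x, ENNReal.ofReal_ne_top⟩) hy.le
    rwa [ENNReal.toReal_add (by simp)
      (ENNReal.mul_ne_top ENNReal.ofReal_ne_top (by simp)), ENNReal.toReal_mul, toReal_enorm,
      toReal_enorm, ENNReal.toReal_ofReal (hτpos n).le,
      ENNReal.toReal_add (kFunctional_ne_top j (τ n) x) ENNReal.ofReal_ne_top,
      ENNReal.toReal_ofReal hδ.le] at h2
  choose y hy using hchoice
  set r : ℕ → ℝ := fun n => √(ε n) * (‖y n‖ + τ n * ‖x - j (y n)‖) with hr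
  have hr0 : ∀ n, 0 ≤ r n := fun n => by have := hτpos n; positivity
  have hrle : ∀ n, r n ≤ √(ε n) * k n + N * (1 / 2) ^ n := by
    intro n
    have h1 := Real.sqrt_pos.2 (hεpos n)
    calc r n ≤ √(ε n) * (k n + N / 2 ^ n * (√(ε n))⁻¹) :=
          mul_le_mul_of_nonneg_left (hy n) h1.le
      _ = _ := by
          rw [mul_add, one_div_pow]
          field_simp
  have hksum : ∀ n, ∑ m ∈ Finset.range n, √(ε m) * k m ≤ 4 * N := by
    intro n
    have h1 := sum_kFunctional_le j (inv_pos.2 hε₀) x n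
    have h2 := ENNReal.toReal_mono (InterpSpace.interpENorm_ne_top j e) h1
    rw [ENNReal.toReal_sum fun m _ =>
      ENNReal.mul_ne_top ENNReal.ofReal_ne_top (kFunctional_ne_top j _ _)] at h2
    have h3 : ∀ m, (ENNReal.ofReal (1 / (4 * √(2 ^ m * ε₀⁻¹))) *
        kFunctional j (2 ^ m * ε₀⁻¹) x).toReal = √(ε m) * k m / 4 := by
      intro m
      rw [ENNReal.toReal_mul, ENNReal.toReal_ofReal (by positivity)]
      change 1 / (4 * √(τ m)) * k m = _
      rw [hτε, Real.sqrt_inv]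
      field_simp
    rw [Finset.sum_congr rfl fun m _ => h3 m, ← Finset.sum_div] at h2
    change _ ≤ N at h2
    linarith
  have hrsum : ∀ n, ∑ m ∈ Finset.range n, r m ≤ 6 * N := by
    intro n
    calc ∑ m ∈ Finset.range n, r m
        ≤ ∑ m ∈ Finset.range n, (√(ε m) * k m + N * (1 / 2) ^ m) :=
          Finset.sum_le_sum fun m _ => hrle m
      _ = ∑ m ∈ Finset.range n, √(ε m) * k m + N * ∑ m ∈ Finset.range n, (1 / 2) ^ m := by
          rw [Finset.sum_add_distrib, Finset.mul_sum]
      _ ≤ 4 * N + N * 2 :=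
          add_le_add (hksum n) (mul_le_mul_of_nonneg_left (sum_geometric_two_le n) hN.le)
      _ = 6 * N := by ring
  have hr1 : ∀ n, r n ≤ 6 * N := fun n =>
    (Finset.single_le_sum (f := r) (fun m _ => hr0 m) (Finset.self_mem_range_succ n)).trans
      (hrsum (n + 1))
  have hry : ∀ n, √(ε n) * ‖y n‖ ≤ r n := fun n => by
    have := hτpos n
    simp only [hr]
    gcongr
    exact le_add_of_nonneg_right (by positivity)
  have hrx : ∀ n, ‖x - j (y n)‖ / √(ε n) ≤ r n := fun n => by
    have h1 := Real.sqrt_pos.2 (hεpos n)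
    have h2 : ‖x - j (y n)‖ / √(ε n) = √(ε n) * (τ n * ‖x - j (y n)‖) := by
      rw [hτε, div_eq_iff h1.ne']
      have h3 := Real.mul_self_sqrt (hεpos n).le
      field_simp
      rw [sq, h3]
      field_simp [(hεpos n).ne']
    rw [h2]
    simp only [hr]
    gcongr
    exact le_add_of_nonneg_left (norm_nonneg _)
  refine ⟨y, ?_, fun n => ?_⟩
  · rw [tendsto_iff_norm_sub_tendsto_zero]
    have h1 : Tendsto (fun n => 6 * N * √(ε n)) atTop (𝓝 0) := by
      have h2 := ((tendsto_pow_atTop_nhds_zero_of_lt_one (r := (1 / 2 : ℝ)) (by norm_num)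
        (by norm_num)).const_mul ε₀).sqrt.const_mul (6 * N)
      simp only [mul_zero, Real.sqrt_zero] at h2
      refine h2.congr fun n => ?_
      simp only [hε]
      rw [one_div_pow, mul_one_div]
    refine squeeze_zero (fun _ => norm_nonneg _) (fun n => ?_) h1
    rw [norm_sub_rev, ← div_le_iff₀ (Real.sqrt_pos.2 (hεpos n))]
    exact (hrx n).trans (hr1 n)
  · have hterm : ∀ m, √(ε m) * ‖y m‖ + ‖j (y (m + 1)) - j (y m)‖ / √(ε m) ≤
        2 * r m + r (m + 1) := by
      intro m
      have h1 := Real.sqrt_pos.2 (hεpos m)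
      have h2 := Real.sqrt_pos.2 (hεpos (m + 1))
      have h3 : √(ε (m + 1)) ≤ √(ε m) := by
        apply Real.sqrt_le_sqrt
        simp only [hε]
        gcongr
        · norm_num
        · omega
      have h4 : ‖j (y (m + 1)) - j (y m)‖ / √(ε m) ≤ r (m + 1) + r m := by
        have h5 : ‖j (y (m + 1)) - j (y m)‖ ≤ ‖x - j (y (m + 1))‖ + ‖x - j (y m)‖ := by
          have := norm_sub_le (x - j (y m)) (x - j (y (m + 1)))
          rw [sub_sub_sub_cancel_left] at this
          linarith
        calc _ ≤ (‖x - j (y (m + 1))‖ + ‖x - j (y m)‖) / √(ε m) := by gcongr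
          _ = ‖x - j (y (m + 1))‖ / √(ε m) + ‖x - j (y m)‖ / √(ε m) := add_div _ _ _
          _ ≤ ‖x - j (y (m + 1))‖ / √(ε (m + 1)) + ‖x - j (y m)‖ / √(ε m) := by gcongr
          _ ≤ _ := add_le_add (hrx _) (hrx _)
      linarith [hry m]
    have hfirst : ‖j (y 0)‖ ≤ 6 / √ε₀ * N := by
      have h1 := (hry 0).trans (hr1 0)
      have h2 : ε 0 = ε₀ := by simp [hε]
      rw [h2] at h1
      rw [div_mul_eq_mul_div, le_div_iff₀' (Real.sqrt_pos.2 hε₀)]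
      exact (mul_le_mul_of_nonneg_left (hj _) (Real.sqrt_nonneg _)).trans h1
    have hshift : ∑ m ∈ Finset.range n, r (m + 1) ≤ 6 * N := by
      have h1 := hrsum (n + 1)
      rw [Finset.sum_range_succ'] at h1
      linarith [hr0 0]
    calc _ ≤ 6 / √ε₀ * N + ∑ m ∈ Finset.range n, (2 * r m + r (m + 1)) :=
          add_le_add hfirst (Finset.sum_le_sum fun m _ => hterm m)
      _ = 6 / √ε₀ * N + (2 * ∑ m ∈ Finset.range n, r m +
            ∑ m ∈ Finset.range n, r (m + 1)) := by
          rw [Finset.sum_add_distrib, Finset.mul_sum]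
      _ ≤ 6 / √ε₀ * N + (2 * (6 * N) + 6 * N) := by
          have := hrsum n
          linarith
      _ = _ := by ring

end Interpolation

namespace ConjugateForms

variable {E G K : Type*} [NormedAddCommGroup E] [InnerProductSpace ℂ E]
  [NormedAddCommGroup G] [InnerProductSpace ℂ G]
  [NormedAddCommGroup K] [InnerProductSpace ℂ K] [CompleteSpace K]

theorem norm_act_le_graphSpace {X : Type*} [NormedAddCommGroup X] [NormedSpace ℂ X]
    (T : X →ₗ.[ℂ] X) (y : GraphSpace T) : ‖GraphSpace.act T y‖ ≤ ‖y‖ := by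
  rw [GraphSpace.norm_def]
  exact Real.le_sqrt_of_sq_le (by nlinarith [sq_nonneg ‖GraphSpace.inclₗ T y‖])

/-- The limiting absorption principle in the interpolation space. -/
theorem exists_bound_interp (D : ConjugateForms E G K) : ∃ C : ℝ, 0 < C ∧
    ∀ (z : ℂ), 0 ≤ z.re → 0 < z.im → ∀ (k₀ : K) (g β : G),
      (∀ l, D.form 0 z k₀ l = inner ℂ (D.i l) g) →
      (∀ l, D.b (D.j k₀) (D.j l) = inner ℂ (D.i l) β) →
      √z.im * ‖toInterpDual (dualGeneratorIncl D.U) (D.j k₀)‖ ≤ C * ‖g‖ := by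
  obtain ⟨C, ε₀, hC, hε₀, h⟩ := D.exists_bound
  refine ⟨C * (18 + 6 / √ε₀), by positivity, fun z hz hz' k₀ g β hk hβ => ?_⟩
  have hs := Real.sqrt_pos.2 hz'
  rw [← le_div_iff₀' hs]
  refine ContinuousLinearMap.opNorm_le_bound _ (by positivity) fun e => ?_
  obtain ⟨y, hy1, hy2⟩ := exists_dyadic_approximation (dualGeneratorIncl D.U)
    (fun y => GraphSpace.norm_incl_le _ y) hε₀ e
  have h1 := h z hz hz' y _ ((18 + 6 / √ε₀) * ‖e‖) hy1 (fun n => by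
    refine le_trans ?_ (hy2 n)
    gcongr with m
    exact norm_act_le_graphSpace _ _) k₀ g β hk hβ
  have h2 : ‖toInterpDual (dualGeneratorIncl D.U) (D.j k₀) e‖ =
      ‖InterpSpace.inclₗ (dualGeneratorIncl D.U) e (D.j k₀)‖ := RCLike.norm_conj _
  rw [h2, div_mul_eq_mul_div, le_div_iff₀' hs]
  refine h1.trans (le_of_eq ?_)
  ring

/-- The limiting absorption principle for a functional in the domain of the generator. -/
theorem exists_bound_generator (D : ConjugateForms E G K)
    (f : GraphSpace (generator (dualGroup D.U))) : ∃ C : ℝ, 0 ≤ C ∧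
    ∀ (z : ℂ), 0 ≤ z.re → 0 < z.im → ∀ (k₀ : K) (g β : G),
      (∀ l, D.form 0 z k₀ l = inner ℂ (D.i l) g) →
      (∀ l, D.b (D.j k₀) (D.j l) = inner ℂ (D.i l) β) →
      √z.im * ‖dualGeneratorIncl D.U f (D.j k₀)‖ ≤ C * ‖g‖ := by
  obtain ⟨C, ε₀, hC, hε₀, h⟩ := D.exists_bound
  set q : ℝ := √(1 / 2) with hq
  have hq0 : 0 ≤ q := Real.sqrt_nonneg _
  have hq1 : q < 1 := by
    rw [hq, Real.sqrt_lt' one_pos]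
    norm_num
  have hq2 : 0 < 1 - q := by linarith
  set A := ‖dualGeneratorIncl D.U f‖ + √ε₀ * ‖GraphSpace.act _ f‖ * (1 - q)⁻¹ with hA
  have hA0 : 0 ≤ A := by positivity
  refine ⟨C * A, by positivity, fun z hz hz' k₀ g β hk hβ => ?_⟩
  refine h z hz hz' (fun _ => f) _ A tendsto_const_nhds (fun n => ?_) k₀ g β hk hβ
  rw [hA]
  gcongr
  simp only [sub_self, norm_zero, zero_div, add_zero]
  have hterm : ∀ m : ℕ, √(ε₀ / 2 ^ m) = √ε₀ * q ^ m := fun m => by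
    rw [hq, Real.sqrt_div hε₀.le, one_div, Real.sqrt_inv, inv_pow, ← div_eq_mul_inv]
    congr 1
    rw [Real.sqrt_eq_iff_mul_self_eq (by positivity) (by positivity), ← mul_pow,
      Real.mul_self_sqrt (by norm_num)]
  simp_rw [hterm]
  rw [← Finset.sum_mul, ← Finset.mul_sum]
  have hg : ∑ m ∈ Finset.range n, q ^ m ≤ (1 - q)⁻¹ := by
    rw [geom_sum_eq hq1.ne, ← neg_sub 1 q, div_neg, ← neg_div, neg_sub, inv_eq_one_div]
    gcongr
    linarith [pow_nonneg hq0 n]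
  calc _ ≤ √ε₀ * (1 - q)⁻¹ * ‖GraphSpace.act _ f‖ := by gcongr
    _ = _ := by ring

end ConjugateForms

/-! ### One-parameter groups and conjugated forms -/

section Groups

variable {E : Type*} [NormedAddCommGroup E] [NormedSpace ℂ E] {U : ℝ → E →L[ℂ] E}

theorem IsC0Group.apply_neg_apply (hU : IsC0Group U) (t : ℝ) (x : E) : U t (U (-t) x) = x := by
  have := hU.map_add t (-t)
  rw [add_neg_cancel, hU.map_zero] at this
  exact (congrArg (fun A : E →L[ℂ] E => A x) this).symm

theorem IsC0Group.apply_add (hU : IsC0Group U) (s t : ℝ) (x : E) : U (s + t) x = U s (U t x) := by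
  rw [hU.map_add]; rfl

theorem IsC0Group.exists_norm_le [CompleteSpace E] (hU : IsC0Group U) (T : ℝ) :
    ∃ C, 0 ≤ C ∧ ∀ s ∈ Icc (-T) T, ‖U s‖ ≤ C := by
  obtain ⟨C, hC⟩ := banach_steinhaus (g := fun s : Icc (-T) T => U s) fun x => by
    obtain ⟨C, hC⟩ := isCompact_Icc.exists_bound_of_continuousOn
      (s := Icc (-T) T) (hU.continuous x).continuousOn
    exact ⟨C, fun s => hC s s.2⟩
  exact ⟨max C 0, le_max_right _ _, fun s hs => (hC ⟨s, hs⟩).trans (le_max_left _ _)⟩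

/-- The form conjugated by the group, `(x, y) ↦ b (U t x, U t y)`. -/
noncomputable def conjForm (U : ℝ → E →L[ℂ] E) (b : E →L[ℂ] AntiDual E) (t : ℝ) :
    E →L[ℂ] AntiDual E := (dualGroup U (-t)).comp (b.comp (U t))

theorem conjForm_apply (b : E →L[ℂ] AntiDual E) (t : ℝ) (x : E) :
    conjForm U b t x = dualGroup U (-t) (b (U t x)) := rfl

theorem conjForm_apply_apply (b : E →L[ℂ] AntiDual E) (t : ℝ) (x y : E) :
    conjForm U b t x y = b (U t x) (U t y) := by
  rw [conjForm_apply, dualGroup_apply, neg_neg]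

theorem conjForm_zero (hU : IsC0Group U) (b : E →L[ℂ] AntiDual E) (x : E) :
    conjForm U b 0 x = b x := by
  ext y
  rw [conjForm_apply_apply, hU.map_zero]
  rfl

variable [CompleteSpace E]

/-- If the form `b` is of class `C¹`, the derivative of the conjugated form is a bounded form. -/
theorem exists_deriv_conjForm {b : E →L[ℂ] AntiDual E}
    (hb : ∀ x, Differentiable ℝ fun t => conjForm U b t x) :
    ∃ b' : E →L[ℂ] AntiDual E, ∀ x, HasDerivAt (fun t => conjForm U b t x) (b' x) 0 := by
  set Δ : ℕ → E →L[ℂ] AntiDual E := fun n =>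
    ((n : ℂ) + 1) • (conjForm U b (1 / ((n : ℝ) + 1)) - conjForm U b 0)
  have hlim : ∀ x, Tendsto (fun n => Δ n x) atTop (𝓝 (deriv (fun t => conjForm U b t x) 0)) := by
    intro x
    have h1 := hasDerivAt_iff_tendsto_slope.1 ((hb x) 0).hasDerivAt
    have h2 : Tendsto (fun n : ℕ => 1 / ((n : ℝ) + 1)) atTop (𝓝[≠] 0) := by
      refine tendsto_nhdsWithin_iff.2 ⟨tendsto_one_div_add_atTop_nhds_zero_nat, ?_⟩
      exact Eventually.of_forall fun n => by simp; positivity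
    refine (h1.comp h2).congr fun n => ?_
    simp only [Function.comp_apply, slope_def_module, sub_zero, Δ]
    rw [one_div, inv_inv, _root_.smul_apply, _root_.sub_apply]
    rw [← Complex.coe_smul]
    push_cast
    rfl
  let b' := continuousLinearMapOfTendsto (σ₁₂ := RingHom.id ℂ) Δ (tendsto_pi_nhds.2 hlim)
  exact ⟨b', fun x => ((hb x) 0).hasDerivAt⟩

/-- If the derivative of the conjugated form of `h` is the conjugated form of `b` on a dense
subspace, in the weak sense, then this holds everywhere in norm. -/
theorem hasDerivAt_conjForm (hU : IsC0Group U) {h b : E →L[ℂ] AntiDual E}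
    (hb : ∀ x, Continuous fun t => conjForm U b t x) {ι : Type*} {κ : ι → E}
    (hκ : DenseRange κ)
    (hd : ∀ p q t, HasDerivAt (fun t => conjForm U h t (κ p) (κ q))
      (conjForm U b t (κ p) (κ q)) t) (x : E) :
    HasDerivAt (fun t => conjForm U h t x) (b x) 0 := by
  have hint : ∀ (x : E) (t : ℝ), IntervalIntegrable (fun s => conjForm U b s x) volume 0 t :=
    fun x t => (hb x).intervalIntegrable 0 t
  -- the integrated form is bounded
  have hI : ∀ t : ℝ, Continuous fun x => ∫ s in (0 : ℝ)..t, conjForm U b s x := by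
    intro t
    obtain ⟨C, hC0, hC⟩ := hU.exists_norm_le |t|
    let I : E →ₗ[ℂ] AntiDual E :=
      { toFun := fun x => ∫ s in (0 : ℝ)..t, conjForm U b s x
        map_add' := fun x y => by
          simp only [_root_.map_add]
          exact intervalIntegral.integral_add (hint x t) (hint y t)
        map_smul' := fun c x => by
          simp only [_root_.map_smul, RingHom.id_apply]
          exact intervalIntegral.integral_smul _ _ }
    have hbd : ∀ x, ‖I x‖ ≤ (C * ‖b‖ * C * |t|) * ‖x‖ := by
      intro x
      have h1 : ∀ s ∈ uIoc 0 t, ‖conjForm U b s x‖ ≤ C * ‖b‖ * C * ‖x‖ := by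
        intro s hs
        have hs' : s ∈ Icc (-|t|) |t| := by
          rw [mem_Icc, ← abs_le]
          have := abs_sub_left_of_mem_uIcc (uIoc_subset_uIcc hs)
          simpa using this
        refine ContinuousLinearMap.opNorm_le_bound _ (by positivity) fun y => ?_
        rw [conjForm_apply_apply]
        calc ‖b (U s x) (U s y)‖ ≤ ‖b‖ * ‖U s x‖ * ‖U s y‖ := b.le_opNorm₂ _ _
          _ ≤ ‖b‖ * (C * ‖x‖) * (C * ‖y‖) := by
            gcongr
            · exact (U s).le_of_opNorm_le (hC s hs') x
            · exact (U s).le_of_opNorm_le (hC s hs') y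
          _ = _ := by ring
      have h2 := intervalIntegral.norm_integral_le_of_norm_le_const h1
      rw [sub_zero] at h2
      refine h2.trans (le_of_eq ?_)
      ring
    exact (I.mkContinuous _ hbd).continuous
  have hev : ∀ (x y : E) (t : ℝ), (∫ s in (0 : ℝ)..t, conjForm U b s x) y =
      ∫ s in (0 : ℝ)..t, conjForm U b s x y := fun x y t =>
    (((ContinuousLinearMap.apply' ℂ (starRingEnd ℂ) y).restrictScalars
      ℝ).intervalIntegral_comp_comm (hint x t)).symm
  have hftc : ∀ t x, conjForm U h t x = h x + ∫ s in (0 : ℝ)..t, conjForm U b s x := by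
    intro t
    have h1 : ∀ p q, conjForm U h t (κ p) (κ q) =
        (h (κ p) + ∫ s in (0 : ℝ)..t, conjForm U b s (κ p)) (κ q) := by
      intro p q
      have hcont : Continuous fun s => conjForm U b s (κ p) (κ q) := by
        have := ((ContinuousLinearMap.apply' ℂ (starRingEnd ℂ) (κ q)).restrictScalars
          ℝ).continuous.comp (hb (κ p))
        exact this
      have h2 := intervalIntegral.integral_eq_sub_of_hasDerivAt
        (fun s _ => hd p q s) (hcont.intervalIntegrable 0 t)
      rw [conjForm_zero hU] at h2
      rw [_root_.add_apply, hev, h2]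
      ring
    have h2 : ∀ p, conjForm U h t (κ p) =
        h (κ p) + ∫ s in (0 : ℝ)..t, conjForm U b s (κ p) := fun p =>
      DFunLike.coe_injective (hκ.equalizer (ContinuousLinearMap.continuous _)
        (ContinuousLinearMap.continuous _) (funext fun q => h1 p q))
    exact congrFun (hκ.equalizer (ContinuousLinearMap.continuous _)
      (h.continuous.add (hI t)) (funext h2))
  have h3 := (intervalIntegral.integral_hasDerivAt_right (hint x 0)
    (hb x).aestronglyMeasurable.stronglyMeasurableAtFilter (hb x).continuousAt).const_add (h x)
  rw [conjForm_zero hU] at h3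
  exact h3.congr_of_eventuallyEq (Eventually.of_forall fun t => hftc t x)

/-- The averages of a `C₀`-group over intervals are bounded operators. -/
theorem IsC0Group.exists_integral (hU : IsC0Group U) : ∃ A : ℝ → ℝ → E →L[ℂ] E,
    (∀ a b x, A a b x = ∫ s in a..b, U s x) ∧
    ∀ T, ∃ C, 0 ≤ C ∧ ∀ a b, a ∈ Icc (-T) T → b ∈ Icc (-T) T → ‖A a b‖ ≤ C * |b - a| := by
  have hint : ∀ (x : E) (a b : ℝ), IntervalIntegrable (fun s => U s x) volume a b :=
    fun x a b => (hU.continuous x).intervalIntegrable a b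
  have hbd : ∀ T, ∃ C, 0 ≤ C ∧ ∀ a b, a ∈ Icc (-T) T → b ∈ Icc (-T) T →
      ∀ x, ‖∫ s in a..b, U s x‖ ≤ C * |b - a| * ‖x‖ := by
    intro T
    obtain ⟨C, hC0, hC⟩ := hU.exists_norm_le T
    refine ⟨C, hC0, fun a b ha hb x => ?_⟩
    have h1 : ∀ s ∈ uIoc a b, ‖U s x‖ ≤ C * ‖x‖ := fun s hs =>
      (U s).le_of_opNorm_le (hC s (uIcc_subset_Icc ha hb (uIoc_subset_uIcc hs))) x
    refine (intervalIntegral.norm_integral_le_of_norm_le_const h1).trans (le_of_eq ?_)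
    ring
  let L : ℝ → ℝ → E →ₗ[ℂ] E := fun a b =>
    { toFun := fun x => ∫ s in a..b, U s x
      map_add' := fun x y => by
        simp only [_root_.map_add]
        exact intervalIntegral.integral_add (hint x a b) (hint y a b)
      map_smul' := fun c x => by
        simp only [_root_.map_smul, RingHom.id_apply]
        exact intervalIntegral.integral_smul _ _ }
  have hL : ∀ a b, ∃ C, ∀ x, ‖L a b x‖ ≤ C * ‖x‖ := by
    intro a b
    obtain ⟨C, -, hC⟩ := hbd (max |a| |b|)
    exact ⟨_, hC a b (abs_le.1 (le_max_left _ _)) (abs_le.1 (le_max_right _ _))⟩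
  refine ⟨fun a b => (L a b).mkContinuousOfExistsBound (hL a b), fun a b x => rfl, fun T => ?_⟩
  obtain ⟨C, hC0, hC⟩ := hbd T
  refine ⟨C, hC0, fun a b ha hb => ?_⟩
  exact ContinuousLinearMap.opNorm_le_bound _ (by positivity) (hC a b ha hb)

theorem eq_zero_of_integral_eq_zero {F : Type*} [NormedAddCommGroup F] [NormedSpace ℝ F]
    [CompleteSpace F] {G : ℝ → F} (hG : Continuous G) (h : ∀ k, ∫ s in (0 : ℝ)..k, G s = 0) :
    G 0 = 0 := by
  have h1 := intervalIntegral.integral_hasDerivAt_right (hG.intervalIntegrable 0 0)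
    hG.aestronglyMeasurable.stronglyMeasurableAtFilter hG.continuousAt
  simp only [h] at h1
  exact h1.unique (hasDerivAt_const _ _)

/-- The domain of the generator of the dual group separates points. Its elements used here are
the functionals averaged twice along the group: the first average has a norm continuous orbit, and
the second one a differentiable orbit. -/
theorem eq_zero_of_forall_generator (hU : IsC0Group U) {v : E}
    (hv : ∀ g : GraphSpace (generator (dualGroup U)), dualGeneratorIncl U g v = 0) : v = 0 := by
  obtain ⟨A, hA, hAC⟩ := hU.exists_integral
  have hmem : ∀ (e : AntiDual E) (h k : ℝ), ∃ g : GraphSpace (generator (dualGroup U)),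
      dualGeneratorIncl U g v = ∫ r in (0 : ℝ)..k, e (A r (r + h) v) := by
    intro e h k
    set φ : ℝ → AntiDual E := fun r => e.comp (A r (r + h)) with hφ
    have hφc : Continuous φ := by
      rw [continuous_iff_continuousAt]
      intro r₀
      obtain ⟨C, hC0, hC⟩ := hAC (|r₀| + |h| + 1)
      rw [ContinuousAt, tendsto_iff_norm_sub_tendsto_zero]
      have h1 : Tendsto (fun r : ℝ => ‖e‖ * (C * |r - r₀| + C * |r - r₀|)) (𝓝 r₀) (𝓝 0) := by
        have : Continuous fun r : ℝ => ‖e‖ * (C * |r - r₀| + C * |r - r₀|) := by fun_prop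
        simpa using this.tendsto r₀
      refine squeeze_zero' (Eventually.of_forall fun _ => norm_nonneg _) ?_ h1
      filter_upwards [Metric.ball_mem_nhds r₀ one_pos] with r hr
      have hr' : |r - r₀| < 1 := by simpa [Real.dist_eq] using hr
      obtain ⟨hr1, hr2⟩ := abs_lt.1 hr'
      have e1 := neg_abs_le r₀
      have e2 := le_abs_self r₀
      have e3 := neg_abs_le h
      have e4 := le_abs_self h
      have hdiff : φ r - φ r₀ = e.comp (A (r₀ + h) (r + h) - A r₀ r) := by
        ext x
        have hi : ∀ a b, IntervalIntegrable (fun s => U s x) volume a b :=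
          fun a b => (hU.continuous x).intervalIntegrable a b
        have h2 : A r (r + h) x - A r₀ (r₀ + h) x = A (r₀ + h) (r + h) x - A r₀ r x := by
          simp only [hA]
          rw [intervalIntegral.integral_interval_sub_interval_comm (hi _ _) (hi _ _) (hi _ _),
            intervalIntegral.integral_symm r₀ r, intervalIntegral.integral_symm (r₀ + h) (r + h)]
          abel
        simp only [hφ, _root_.sub_apply, ContinuousLinearMap.comp_apply, ← _root_.map_sub, h2]
      rw [hdiff]
      have hn : ‖e.comp (A (r₀ + h) (r + h) - A r₀ r)‖ ≤ ‖e‖ * ‖A (r₀ + h) (r + h) - A r₀ r‖ :=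
        ContinuousLinearMap.opNorm_comp_le _ _
      refine hn.trans ?_
      gcongr
      refine (norm_sub_le _ _).trans (add_le_add ?_ ?_)
      · refine (hC (r₀ + h) (r + h) ?_ ?_).trans (le_of_eq ?_)
        · constructor <;> linarith
        · constructor <;> linarith
        · congr 2; ring
      · refine hC r₀ r ?_ ?_
        · constructor <;> linarith [abs_nonneg h]
        · constructor <;> linarith [abs_nonneg h]
    set f : AntiDual E := ∫ r in (0 : ℝ)..k, φ r with hf
    have hev : ∀ (a b : ℝ) (x : E), (∫ r in a..b, φ r) x = ∫ r in a..b, φ r x := fun a b x =>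
      (((ContinuousLinearMap.apply' ℂ (starRingEnd ℂ) x).restrictScalars
        ℝ).intervalIntegral_comp_comm (hφc.intervalIntegrable a b)).symm
    have horb : ∀ t, dualGroup U t f = ∫ r in (-t)..(k - t), φ r := by
      intro t
      ext x
      rw [dualGroup_apply, hf, hev, hev]
      have h1 := intervalIntegral.integral_comp_sub_right (a := 0) (b := k) (fun r => φ r x) t
      rw [zero_sub] at h1
      rw [← h1]
      refine intervalIntegral.integral_congr fun r _ => ?_
      simp only [hφ, ContinuousLinearMap.comp_apply, hA]
      congr 1
      have h2 := intervalIntegral.integral_comp_sub_right (a := r) (b := r + h)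
        (fun s => U s x) t
      rw [show r + h - t = r - t + h by ring] at h2
      rw [← h2]
      refine intervalIntegral.integral_congr fun s _ => ?_
      rw [sub_eq_add_neg, hU.apply_add]
    have hdiff : DifferentiableAt ℝ (fun t => dualGroup U t f) 0 := by
      simp only [horb]
      have hprim : ∀ c, HasDerivAt (fun y => ∫ r in (0 : ℝ)..y, φ r) (φ c) c := fun c =>
        intervalIntegral.integral_hasDerivAt_right (hφc.intervalIntegrable _ _)
          hφc.aestronglyMeasurable.stronglyMeasurableAtFilter hφc.continuousAt
      have h1 : (fun t : ℝ => ∫ r in (-t)..(k - t), φ r) =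
          fun t => (∫ r in (0 : ℝ)..(k - t), φ r) - ∫ r in (0 : ℝ)..(-t), φ r := by
        funext t
        rw [intervalIntegral.integral_interval_sub_left (hφc.intervalIntegrable _ _)
          (hφc.intervalIntegrable _ _)]
      rw [h1]
      refine DifferentiableAt.sub ?_ ?_
      · exact (hprim _).differentiableAt.comp (0 : ℝ) (differentiableAt_id.const_sub k)
      · exact (hprim _).differentiableAt.comp (0 : ℝ) differentiableAt_id.neg
    refine ⟨(⟨f, hdiff⟩ : (generator (dualGroup U)).domain), ?_⟩
    change f v = _
    rw [hf, hev]
    rfl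
  by_contra hne
  obtain ⟨ℓ, -, hℓ⟩ := exists_dual_vector ℂ v (norm_ne_zero_iff.2 hne)
  let e : AntiDual E := (starL ℂ : ℂ ≃L⋆[ℂ] ℂ).toContinuousLinearMap.comp ℓ
  have hcU : Continuous fun s => e (U s v) := e.continuous.comp (hU.continuous v)
  have heA : ∀ a b, e (A a b v) = ∫ s in a..b, e (U s v) := fun a b => by
    rw [hA]
    exact (((Complex.conjCLE.toContinuousLinearMap.comp
      (ℓ.restrictScalars ℝ)).intervalIntegral_comp_comm
        ((hU.continuous v).intervalIntegrable a b))).symm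
  have hzero : ∀ h, ∫ s in (0 : ℝ)..h, e (U s v) = 0 := by
    intro h
    have hc : Continuous fun r => e (A r (r + h) v) := by
      have h1 : Continuous fun b => ∫ s in (0 : ℝ)..b, e (U s v) :=
        intervalIntegral.continuous_primitive (fun a b => hcU.intervalIntegrable a b) 0
      have h2 : (fun r => e (A r (r + h) v)) =
          fun r => (∫ s in (0 : ℝ)..(r + h), e (U s v)) - ∫ s in (0 : ℝ)..r, e (U s v) := by
        funext r
        rw [heA, intervalIntegral.integral_interval_sub_left (hcU.intervalIntegrable _ _)
          (hcU.intervalIntegrable _ _)]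
      rw [h2]
      exact (h1.comp (continuous_add_const h)).sub h1
    have := eq_zero_of_integral_eq_zero hc fun k => by
      obtain ⟨g, hg⟩ := hmem e h k
      rw [← hg, hv]
    rwa [heA, zero_add] at this
  have h0 := eq_zero_of_integral_eq_zero hcU hzero
  rw [hU.map_zero] at h0
  have h1 : starRingEnd ℂ (ℓ v) = 0 := h0
  rw [hℓ] at h1
  simp at h1
  exact hne h1

end Groups

/-! ### The commutator and the energy space -/

section Commutator

variable {𝓗 : Type*} [NormedAddCommGroup 𝓗] [InnerProductSpace ℂ 𝓗] [CompleteSpace 𝓗]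
  {H : 𝓗 →ₗ.[ℂ] 𝓗} {W : ℝ → 𝓗 →L[ℂ] 𝓗} {hWH : ∀ t, ∀ f : H.domain, W t f ∈ H.domain}

theorem unitary_inner (hWu : ∀ t, W t ∈ unitary (𝓗 →L[ℂ] 𝓗)) (t : ℝ) (x y : 𝓗) :
    inner ℂ (W t x) (W t y) = inner ℂ x y := by
  rw [← ContinuousLinearMap.adjoint_inner_right, ← ContinuousLinearMap.star_eq_adjoint]
  have h := (hWu t).1
  exact congrArg (fun A : 𝓗 →L[ℂ] 𝓗 => inner ℂ x (A y)) h

theorem unitary_inner_neg (hW : IsC0Group W) (hWu : ∀ t, W t ∈ unitary (𝓗 →L[ℂ] 𝓗)) (t : ℝ)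
    (x y : 𝓗) : inner ℂ x (W (-t) y) = inner ℂ (W t x) y := by
  rw [← unitary_inner hWu t, hW.apply_neg_apply]

theorem conjOrbit_symm (hH : IsSelfAdjoint H) (hW : IsC0Group W)
    (hWu : ∀ t, W t ∈ unitary (𝓗 →L[ℂ] 𝓗)) (x y : H.domain) (t : ℝ) :
    inner ℂ (conjOrbit H W hWH x t) (y : 𝓗) = inner ℂ (x : 𝓗) (conjOrbit H W hWH y t) := by
  rw [conjOrbit, conjOrbit, unitary_inner_neg hW hWu, ← inner_conj_symm,
    unitary_inner_neg hW hWu, inner_conj_symm]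
  exact selfAdjoint_inner_left hH ⟨W t x, hWH t x⟩ ⟨W t y, hWH t y⟩

omit [CompleteSpace 𝓗] in
theorem conjOrbit_add (x y : H.domain) (t : ℝ) :
    conjOrbit H W hWH (x + y) t = conjOrbit H W hWH x t + conjOrbit H W hWH y t := by
  have h : (⟨W t ((x + y : H.domain) : 𝓗), hWH t (x + y)⟩ : H.domain) =
      ⟨W t x, hWH t x⟩ + ⟨W t y, hWH t y⟩ := Subtype.ext (by simp)
  rw [conjOrbit, h, LinearPMap.map_add, _root_.map_add]
  rfl

omit [CompleteSpace 𝓗] in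
theorem conjOrbit_smul (c : ℂ) (x : H.domain) (t : ℝ) :
    conjOrbit H W hWH (c • x) t = c • conjOrbit H W hWH x t := by
  have h : (⟨W t ((c • x : H.domain) : 𝓗), hWH t (c • x)⟩ : H.domain) =
      c • ⟨W t x, hWH t x⟩ := Subtype.ext (by simp)
  rw [conjOrbit, h, LinearPMap.map_smul, _root_.map_smul]
  rfl

/-- The commutator `[iH, A]` as a linear map. -/
noncomputable def commutatorₗ (hHC1 : ∀ f : H.domain, Differentiable ℝ (conjOrbit H W hWH f)) :
    H.domain →ₗ[ℂ] 𝓗 where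
  toFun := commutator H W hWH
  map_add' x y := by
    have h : conjOrbit H W hWH (x + y) =
        fun t => conjOrbit H W hWH x t + conjOrbit H W hWH y t := funext (conjOrbit_add x y)
    rw [commutator, h, deriv_fun_add (hHC1 x 0) (hHC1 y 0)]
    rfl
  map_smul' c x := by
    have h : conjOrbit H W hWH (c • x) = fun t => c • conjOrbit H W hWH x t :=
      funext (conjOrbit_smul c x)
    rw [commutator, h, deriv_fun_const_smul (R := ℂ) c (hHC1 x 0)]
    rfl

theorem commutator_symm (hH : IsSelfAdjoint H) (hW : IsC0Group W)
    (hWu : ∀ t, W t ∈ unitary (𝓗 →L[ℂ] 𝓗))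
    (hHC1 : ∀ f : H.domain, Differentiable ℝ (conjOrbit H W hWH f)) (x y : H.domain) :
    inner ℂ (commutator H W hWH x) (y : 𝓗) = inner ℂ (x : 𝓗) (commutator H W hWH y) := by
  have h1 := (hHC1 x 0).hasDerivAt.inner ℂ (hasDerivAt_const (0 : ℝ) (y : 𝓗))
  have h2 := (hasDerivAt_const (0 : ℝ) (x : 𝓗)).inner ℂ (hHC1 y 0).hasDerivAt
  simp only [inner_zero_right, inner_zero_left, zero_add, add_zero] at h1 h2
  refine h1.unique (h2.congr_of_eventuallyEq (Eventually.of_forall fun t => ?_))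
  exact conjOrbit_symm hH hW hWu x y t

omit [CompleteSpace 𝓗] in
theorem hasDerivAt_conjOrbit (hW : IsC0Group W)
    (hHC1 : ∀ f : H.domain, Differentiable ℝ (conjOrbit H W hWH f)) (x : H.domain) (t : ℝ) :
    HasDerivAt (conjOrbit H W hWH x) (W (-t) (commutator H W hWH ⟨W t x, hWH t x⟩)) t := by
  have h1 : HasDerivAt (fun s => W (-t) (conjOrbit H W hWH ⟨W t x, hWH t x⟩ s))
      (W (-t) (commutator H W hWH ⟨W t x, hWH t x⟩)) (t - t) := by
    rw [sub_self]
    exact ((W (-t)).restrictScalars ℝ).hasFDerivAt.comp_hasDerivAt (0 : ℝ)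
      (hHC1 ⟨W t x, hWH t x⟩ 0).hasDerivAt
  refine (h1.comp_sub_const t t).congr_of_eventuallyEq (Eventually.of_forall fun s => ?_)
  simp only [conjOrbit]
  rw [← hW.apply_add]
  have h2 : -t + -(s - t) = -s := by ring
  have h3 : (⟨W s x, hWH s x⟩ : H.domain) =
      ⟨W (s - t) (W t x), hWH (s - t) ⟨W t x, hWH t x⟩⟩ :=
    Subtype.ext (by simp [← hW.apply_add])
  rw [h2, h3]

end Commutator

section Energy

variable {V : Type*} [NormedAddCommGroup V] [NormedSpace ℂ V] {S : V →L[ℂ] AntiDual V}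

theorem inner_toEnergy (hS : IsStrictlyPos S) (f g : V) :
    inner ℂ (toEnergy hS g) (toEnergy hS f) = S f g :=
  UniformSpace.Completion.inner_coe (𝕜 := ℂ) (PreEnergy.equiv hS g) (PreEnergy.equiv hS f)

theorem toEnergy_denseRange (hS : IsStrictlyPos S) : DenseRange (toEnergy hS) :=
  UniformSpace.Completion.denseRange_coe.comp (PreEnergy.equiv hS).surjective.denseRange
    (UniformSpace.Completion.continuous_coe _)

theorem toEnergy_continuous (hS : IsStrictlyPos S) : Continuous (toEnergy hS) := by
  refine ((toEnergy hS).mkContinuous √‖S‖ fun f => ?_).continuous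
  refine abs_le_of_sq_le_sq' ?_ (by positivity) |>.2
  have h1 : ‖toEnergy hS f‖ ^ 2 = ‖S f f‖ := by
    rw [← inner_toEnergy hS, inner_self_eq_norm_sq_to_K]
    simp
  rw [h1, mul_pow, Real.sq_sqrt (norm_nonneg S), sq, ← mul_assoc]
  exact S.le_opNorm₂ f f

end Energy

section Setting

variable {𝓗 : Type*} [NormedAddCommGroup 𝓗] [InnerProductSpace ℂ 𝓗] [CompleteSpace 𝓗]
  {H : 𝓗 →ₗ.[ℂ] 𝓗} {W : ℝ → 𝓗 →L[ℂ] 𝓗} {hWH : ∀ t, ∀ f : H.domain, W t f ∈ H.domain}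

theorem formExtension_commutator (hH : IsSelfAdjoint H) (hW : IsC0Group W)
    (hWu : ∀ t, W t ∈ unitary (𝓗 →L[ℂ] 𝓗))
    (hHC1 : ∀ f : H.domain, Differentiable ℝ (conjOrbit H W hWH f)) (f : H.domain)
    (g : FormDomain H) : formExtension H (commutator H W hWH) (domainIncl hH f) g =
      inner ℂ (GraphSpace.incl _ g) (commutator H W hWH f) :=
  formExtension_apply hH (commutatorₗ hHC1) (commutator_symm hH hW hWu hHC1) f g

theorem weakForm_apply (hH : IsSelfAdjoint H) (hW : IsC0Group W)
    (hWu : ∀ t, W t ∈ unitary (𝓗 →L[ℂ] 𝓗))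
    (hHC1 : ∀ f : H.domain, Differentiable ℝ (conjOrbit H W hWH f)) (c₁ : ℝ) (f : H.domain)
    (g : FormDomain H) : weakForm H W hWH c₁ (domainIncl hH f) g =
      inner ℂ (GraphSpace.incl _ g) (-((c₁ : ℂ) • H f) + commutator H W hWH f) := by
  refine formExtension_apply hH (-((c₁ : ℂ) • H.toFun) + commutatorₗ hHC1) (fun x y => ?_) f g
  have h1 := selfAdjoint_inner_left hH x y
  have h2 := commutator_symm hH hW hWu hHC1 x y
  change inner ℂ (-((c₁ : ℂ) • H x) + commutator H W hWH x) (y : 𝓗) =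
    inner ℂ (x : 𝓗) (-((c₁ : ℂ) • H y) + commutator H W hWH y)
  rw [inner_add_left, inner_add_right, inner_neg_left, inner_neg_right, inner_smul_left,
    inner_smul_right, Complex.conj_ofReal, h1, h2]

/-- The hypotheses of the method of the weakly conjugate operator provide the forms `h`, `b`, `b'`
on the energy space. The Hilbert space `K` is the closure of `D(H)`, embedded diagonally in the
sum of the energy space and `𝓗`. -/
theorem exists_conjugateForms (hH : IsSelfAdjoint H) (hW : IsC0Group W)
    (hWu : ∀ t, W t ∈ unitary (𝓗 →L[ℂ] 𝓗))
    (hHC1 : ∀ f : H.domain, Differentiable ℝ (conjOrbit H W hWH f))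
    {c₁ : ℝ} (hc₁ : 0 < c₁) (hS : IsStrictlyPos (weakForm H W hWH c₁))
    {U : ℝ → Energy _ hS →L[ℂ] Energy _ hS} (hU : IsC0Group U)
    (hUW : ∀ (t : ℝ) (f f' : FormDomain H), GraphSpace.incl _ f' = W t (GraphSpace.incl _ f) →
      U t (toEnergy hS f) = toEnergy hS f')
    {B : Energy _ hS →L[ℂ] AntiDual (Energy _ hS)}
    (hB : ∀ f g : FormDomain H, B (toEnergy hS f) (toEnergy hS g) =
      formExtension H (commutator H W hWH) f g)
    (hBC1 : ∀ x, Differentiable ℝ fun t => dualGroup U (-t) (B (U t x))) :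
    ∃ (K : Submodule ℂ (WithLp 2 (Energy _ hS × 𝓗))) (_ : CompleteSpace K)
      (D : ConjugateForms (Energy _ hS) 𝓗 K), D.U = U ∧ ∀ f : H.domain, ∃ k₀ : K,
        D.j k₀ = toEnergy hS (domainIncl hH f) ∧ D.i k₀ = f ∧
        (∀ l, D.h (D.j k₀) (D.j l) = inner ℂ (D.i l) (H f)) ∧
        ∀ l, D.b (D.j k₀) (D.j l) = inner ℂ (D.i l) (commutator H W hWH f) := by
  set e : H.domain → Energy _ hS := fun f => toEnergy hS (domainIncl hH f) with he
  have hedense : DenseRange e := (toEnergy_denseRange hS).comp (domainIncl_denseRange hH)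
    (toEnergy_continuous hS)
  have hUe : ∀ t (f : H.domain), U t (e f) = e ⟨W t f, hWH t f⟩ := fun t f =>
    hUW t _ _ rfl
  have hBe : ∀ f g : H.domain, B (e f) (e g) = inner ℂ (g : 𝓗) (commutator H W hWH f) :=
    fun f g => (hB _ _).trans (formExtension_commutator hH hW hWu hHC1 f _)
  -- the form of `H`, solved from `S = -c₁ H + [iH, A]`
  set h : Energy _ hS →L[ℂ] AntiDual (Energy _ hS) :=
    ((c₁ : ℂ)⁻¹) • (B - antiRiesz (Energy _ hS)) with hh
  have hc₁' : (c₁ : ℂ) ≠ 0 := by exact_mod_cast hc₁.ne'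
  have hhe : ∀ f g : H.domain, h (e f) (e g) = inner ℂ (g : 𝓗) (H f) := by
    intro f g
    have h1 : antiRiesz (Energy _ hS) (e f) (e g) =
        inner ℂ (g : 𝓗) (-((c₁ : ℂ) • H f) + commutator H W hWH f) := by
      rw [antiRiesz_apply]
      exact (inner_toEnergy hS _ _).trans (weakForm_apply hH hW hWu hHC1 c₁ f _)
    have h2 : h (e f) (e g) =
        (c₁ : ℂ)⁻¹ * (B (e f) (e g) - antiRiesz (Energy _ hS) (e f) (e g)) := rfl
    rw [h2, h1, hBe, inner_add_right, inner_neg_right, inner_smul_right]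
    field_simp
    ring
  -- the space `K`
  let P := WithLp 2 (Energy _ hS × 𝓗)
  let ι : H.domain →ₗ[ℂ] P := (WithLp.linearEquiv 2 ℂ (Energy _ hS × 𝓗)).symm.toLinearMap ∘ₗ
    ((toEnergy hS ∘ₗ domainIncl hH).prod H.domain.subtype)
  let K : Submodule ℂ P := (LinearMap.range ι).topologicalClosure
  let jP : P →L[ℂ] Energy _ hS := WithLp.fstL 2 ℂ _ _
  let iP : P →L[ℂ] 𝓗 := WithLp.sndL 2 ℂ _ _
  have hιmem : ∀ f, ι f ∈ K := fun f =>
    Submodule.le_topologicalClosure _ (LinearMap.mem_range_self ι f)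
  have hind : ∀ p : P → Prop, IsClosed {x | p x} → (∀ f, p (ι f)) → ∀ k ∈ K, p k := by
    intro p hp hι k hk
    have : (LinearMap.range ι : Set P) ⊆ {x | p x} := by rintro _ ⟨f, rfl⟩; exact hι f
    exact closure_minimal this hp hk
  let Φ : ℝ → P →L[ℂ] P := fun t =>
    (WithLp.prodContinuousLinearEquiv 2 ℂ (Energy _ hS) 𝓗).symm.toContinuousLinearMap.comp
      (((U t).prodMap (W t)).comp
        (WithLp.prodContinuousLinearEquiv 2 ℂ (Energy _ hS) 𝓗).toContinuousLinearMap)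
  have hΦι : ∀ t f, Φ t (ι f) = ι ⟨W t f, hWH t f⟩ := fun t f => by
    change WithLp.toLp 2 (U t (e f), W t f) = WithLp.toLp 2 (e ⟨W t f, hWH t f⟩, W t f)
    rw [hUe]
  have hΦK : ∀ t, ∀ k ∈ K, Φ t k ∈ K := fun t => by
    refine hind (fun k => Φ t k ∈ K) ?_ fun f => by
      rw [hΦι]; exact hιmem _
    exact (Submodule.isClosed_topologicalClosure _).preimage (Φ t).continuous
  have hcomplete : CompleteSpace K :=
    (Submodule.isClosed_topologicalClosure (LinearMap.range ι)).completeSpace_coe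
  obtain ⟨b', hb'⟩ := exists_deriv_conjForm (U := U) (b := B) hBC1
  have hder : ∀ x, HasDerivAt (fun t => conjForm U h t x) (B x) 0 := by
    refine hasDerivAt_conjForm hU (fun x => (hBC1 x).continuous) hedense fun f g t => ?_
    rw [conjForm_apply_apply, hUe, hUe, hBe]
    have h1 := (hasDerivAt_const t (g : 𝓗)).inner ℂ (hasDerivAt_conjOrbit hW hHC1 f t)
    simp only [inner_zero_left, add_zero] at h1
    rw [unitary_inner_neg hW hWu] at h1
    refine h1.congr_of_eventuallyEq (Eventually.of_forall fun s => ?_)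
    simp only
    rw [conjForm_apply_apply, hUe, hUe, hhe, conjOrbit, unitary_inner_neg hW hWu]
  have hcont : ∀ b : Energy _ hS →L[ℂ] AntiDual (Energy _ hS),
      Continuous fun x : P => b (jP x) (jP x) := by
    intro b
    rw [continuous_iff_continuousAt]
    exact fun x => tendsto_antiDual_apply ((b.continuous.comp jP.continuous).tendsto x)
      (jP.continuous.tendsto x)
  have him : ∀ b : Energy _ hS →L[ℂ] AntiDual (Energy _ hS),
      (∀ f, (b (e f) (e f)).im = 0) → ∀ k ∈ K, (b (jP k) (jP k)).im = 0 := fun b hb =>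
    hind (fun k => (b (jP k) (jP k)).im = 0)
      (isClosed_eq (Complex.continuous_im.comp (hcont b)) continuous_const) hb
  have hBim := him B fun f => by
    rw [hBe]
    have h1 := commutator_symm hH hW hWu hHC1 f f
    rw [← inner_conj_symm] at h1
    exact Complex.conj_eq_iff_im.1 h1
  have hhim := him h fun f => by
    rw [hhe]
    exact selfAdjoint_inner_self_im hH f
  have hform : ∀ (b : Energy _ hS →L[ℂ] AntiDual (Energy _ hS)) (f : H.domain) (w : 𝓗),
      (∀ g : H.domain, b (e f) (e g) = inner ℂ (g : 𝓗) w) →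
      ∀ l ∈ K, b (e f) (jP l) = inner ℂ (iP l) w := fun b f w hb =>
    hind (fun l => b (e f) (jP l) = inner ℂ (iP l) w)
      (isClosed_eq ((b (e f)).continuous.comp jP.continuous)
        (iP.continuous.inner continuous_const)) hb
  let D : ConjugateForms (Energy _ hS) 𝓗 K :=
    { j := jP.comp K.subtypeL
      i := iP.comp K.subtypeL
      h := h
      b := B
      b' := b'
      c₁ := c₁
      U := U
      V := fun t k => ⟨Φ t k, hΦK t k k.2⟩
      c₁_pos := hc₁
      norm_le := fun k => (WithLp.prod_norm_sq_eq_of_L2 (k : P)).le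
      h_im := fun k => hhim k k.2
      b_im := fun k => hBim k k.2
      energy := fun k => by
        set x := jP k
        have h1 : antiRiesz (Energy _ hS) x x = ((‖x‖ ^ 2 : ℝ) : ℂ) := by
          rw [antiRiesz_apply, inner_self_eq_norm_sq_to_K]
          push_cast
          rfl
        have h2 : (c₁ : ℂ) * h x x = B x x - antiRiesz (Energy _ hS) x x :=
          mul_inv_cancel_left₀ hc₁' _
        rw [h1] at h2
        have h3 := congrArg Complex.re h2
        rw [Complex.re_ofReal_mul, Complex.sub_re, Complex.ofReal_re] at h3
        change ‖x‖ ^ 2 = (B x x).re - c₁ * (h x x).re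
        linarith
      group := hU
      j_V := fun t k => rfl
      V_V_neg := fun t k => by
        refine Subtype.ext ?_
        change WithLp.toLp 2 (U t (U (-t) (jP k)), W t (W (-t) (iP k))) = (k : P)
        rw [hU.apply_neg_apply, hW.apply_neg_apply]
        rfl
      inner_V := fun t k l => unitary_inner hWu t (iP k) (iP l)
      h_deriv := fun k => hder _
      b_deriv := fun k => hb' _ }
  refine ⟨K, hcomplete, D, rfl, fun f => ⟨⟨ι f, hιmem f⟩, rfl, rfl, fun l => ?_, fun l => ?_⟩⟩
  · exact hform h f (H f) (hhe f) l l.2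
  · exact hform B f (commutator H W hWH f) (hBe f) l l.2

theorem selfAdjoint_norm_sub_conj (hH : IsSelfAdjoint H) (z : ℂ) (x : H.domain) :
    ‖H x - starRingEnd ℂ z • (x : 𝓗)‖ = ‖H x - z • (x : 𝓗)‖ := by
  have h1 := selfAdjoint_inner_left hH x x
  have h2 : inner ℂ (H x - starRingEnd ℂ z • (x : 𝓗)) (H x - starRingEnd ℂ z • (x : 𝓗)) =
      inner ℂ (H x - z • (x : 𝓗)) (H x - z • (x : 𝓗)) := by
    simp only [inner_sub_left, inner_sub_right, inner_smul_left, inner_smul_right, h1,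
      Complex.conj_conj]
    ring
  rw [inner_self_eq_norm_sq_to_K, inner_self_eq_norm_sq_to_K] at h2
  have h3 : ‖H x - starRingEnd ℂ z • (x : 𝓗)‖ ^ 2 = ‖H x - z • (x : 𝓗)‖ ^ 2 := by
    exact_mod_cast h2
  exact (pow_left_inj₀ (norm_nonneg _) (norm_nonneg _) two_ne_zero).1 h3

/-- A bound for `T (H - z)⁻¹` in the open upper half-plane carries over to the lower half-plane,
since `(H - conj z)⁻¹ g = (H - z)⁻¹ g'` with `‖g'‖ = ‖g‖`. -/
theorem bound_conj_of_bound (hH : IsSelfAdjoint H) {F : Type*} [NormedAddCommGroup F]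
    [NormedSpace ℂ F] (T : H.domain →ₗ[ℂ] F) {C : ℝ}
    (h : ∀ (z : ℂ) (hz : 0 < z.im), 0 ≤ z.re → ∀ g,
      √z.im * ‖T ⟨resolvent H z g, resolvent_mem hH hz.ne' g⟩‖ ≤ C * ‖g‖)
    (z : ℂ) (hz : z.im ≠ 0) (hz' : 0 ≤ z.re) (g : 𝓗) :
    √|z.im| * ‖T ⟨resolvent H z g, resolvent_mem hH hz g⟩‖ ≤ C * ‖g‖ := by
  rcases hz.lt_or_gt with h1 | h1
  swap
  · rw [abs_of_pos h1]
    exact h z h1 hz' g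
  set w := starRingEnd ℂ z with hw
  have hwim : 0 < w.im := by simpa [hw] using h1
  set g' := g + (z - w) • resolvent H z g with hg'
  have h2 : resolvent H z g = resolvent H w g' := by
    rw [hg', _root_.map_add, _root_.map_smul, resolvent_comm hH hwim.ne' hz,
      ← resolvent_sub hH hz hwim.ne']
    abel
  have h3 : g' = H ⟨_, resolvent_mem hH hz g⟩ - w • resolvent H z g := by
    rw [apply_resolvent hH hz, hg', sub_smul]
    abel
  have h4 : ‖g'‖ = ‖g‖ := by
    rw [h3, hw, selfAdjoint_norm_sub_conj hH z ⟨_, resolvent_mem hH hz g⟩, apply_resolvent hH hz,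
      add_sub_cancel_right]
  have h12 : (⟨resolvent H z g, resolvent_mem hH hz g⟩ : H.domain) =
      ⟨resolvent H w g', resolvent_mem hH hwim.ne' g'⟩ := Subtype.ext h2
  have h13 : |z.im| = w.im := by rw [abs_of_neg h1, hw, Complex.conj_im]
  rw [h12, ← h4, h13]
  exact h w hwim (by simpa [hw] using hz') g'

/-- The limiting absorption principle for the resolvent of an operator whose forms are given: the
vector `(H - z)⁻¹ g` solves the form equation with `ε = 0`, and the lower half-plane is reached
by complex conjugation. -/
theorem ConjugateForms.exists_bound_resolvent {E K : Type*} [NormedAddCommGroup E]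
    [InnerProductSpace ℂ E] [CompleteSpace E] [NormedAddCommGroup K] [InnerProductSpace ℂ K]
    [CompleteSpace K] (D : ConjugateForms E 𝓗 K) (hH : IsSelfAdjoint H) (J : H.domain →ₗ[ℂ] E)
    (hD : ∀ f : H.domain, ∃ (k₀ : K) (β : 𝓗), D.j k₀ = J f ∧ D.i k₀ = f ∧
      (∀ l, D.h (D.j k₀) (D.j l) = inner ℂ (D.i l) (H f)) ∧
      ∀ l, D.b (D.j k₀) (D.j l) = inner ℂ (D.i l) β) :
    (∃ C : ℝ, 0 ≤ C ∧ ∀ (z : ℂ) (hz : z.im ≠ 0), 0 ≤ z.re → ∀ g,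
      √|z.im| * ‖toInterpDual (dualGeneratorIncl D.U)
        (J ⟨resolvent H z g, resolvent_mem hH hz g⟩)‖ ≤ C * ‖g‖) ∧
    ∀ e : GraphSpace (generator (dualGroup D.U)), ∃ C : ℝ, 0 ≤ C ∧
      ∀ (z : ℂ) (hz : z.im ≠ 0), 0 ≤ z.re → ∀ g,
      √|z.im| * ‖dualGeneratorIncl D.U e (J ⟨resolvent H z g, resolvent_mem hH hz g⟩)‖ ≤
        C * ‖g‖ := by
  have hform : ∀ (z : ℂ) (hz : z.im ≠ 0) (g : 𝓗), ∃ (k₀ : K) (β : 𝓗),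
      D.j k₀ = J ⟨resolvent H z g, resolvent_mem hH hz g⟩ ∧
      (∀ l, D.form 0 z k₀ l = inner ℂ (D.i l) g) ∧
      ∀ l, D.b (D.j k₀) (D.j l) = inner ℂ (D.i l) β := by
    intro z hz g
    obtain ⟨k₀, β, h1, h2, h3, h4⟩ := hD ⟨resolvent H z g, resolvent_mem hH hz g⟩
    refine ⟨k₀, β, h1, fun l => ?_, h4⟩
    rw [ConjugateForms.form_apply, h3, h2, apply_resolvent hH hz, inner_add_right,
      inner_smul_right]
    simp
  constructor
  · obtain ⟨C, hC, h⟩ := D.exists_bound_interp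
    refine ⟨C, hC.le, bound_conj_of_bound hH
      ((toInterpDual (dualGeneratorIncl D.U)).toLinearMap ∘ₗ J) fun z hz hz' g => ?_⟩
    obtain ⟨k₀, β, h1, h2, h3⟩ := hform z hz.ne' g
    have h4 := h z hz' hz k₀ g β h2 h3
    rwa [h1] at h4
  · intro e
    obtain ⟨C, hC, h⟩ := D.exists_bound_generator e
    refine ⟨C, hC, fun z hz hz' g => ?_⟩
    -- the functional is antilinear; its conjugate is linear
    let ℓ : E →ₗ[ℂ] ℂ :=
      { toFun := fun x => starRingEnd ℂ (dualGeneratorIncl D.U e x)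
        map_add' := fun x y => by simp
        map_smul' := fun c x => by simp }
    have h5 := bound_conj_of_bound hH (ℓ ∘ₗ J) (C := C) (fun z hz hz' g => ?_) z hz hz' g
    · simpa [ℓ] using h5
    obtain ⟨k₀, β, h1, h2, h3⟩ := hform z hz.ne' g
    have h4 := h z hz' hz k₀ g β h2 h3
    rw [h1] at h4
    simpa [ℓ] using h4

/-- The limiting absorption principle: `(H - z)⁻¹` is bounded from `𝓗` to `𝓔*` by a multiple of
`|Im z|^{-1/2}`, for `Re z ≥ 0`; and composed with an element of `D(A, 𝓢*)` it satisfies a bound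
of the same kind. -/
theorem exists_bound_resolvent (hH : IsSelfAdjoint H) (hW : IsC0Group W)
    (hWu : ∀ t, W t ∈ unitary (𝓗 →L[ℂ] 𝓗))
    (hHC1 : ∀ f : H.domain, Differentiable ℝ (conjOrbit H W hWH f))
    {c₁ : ℝ} (hc₁ : 0 < c₁) (hS : IsStrictlyPos (weakForm H W hWH c₁))
    {U : ℝ → Energy _ hS →L[ℂ] Energy _ hS} (hU : IsC0Group U)
    (hUW : ∀ (t : ℝ) (f f' : FormDomain H), GraphSpace.incl _ f' = W t (GraphSpace.incl _ f) →
      U t (toEnergy hS f) = toEnergy hS f')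
    (hBC1 : ∃ B : Energy _ hS →L[ℂ] AntiDual (Energy _ hS),
      (∀ f g : FormDomain H, B (toEnergy hS f) (toEnergy hS g) =
        formExtension H (commutator H W hWH) f g) ∧
      ∀ x, Differentiable ℝ fun t => dualGroup U (-t) (B (U t x))) :
    (∃ C : ℝ, 0 ≤ C ∧ ∀ (z : ℂ) (hz : z.im ≠ 0), 0 ≤ z.re → ∀ g,
      √|z.im| * ‖toInterpDual (dualGeneratorIncl U)
        (toEnergy hS (domainIncl hH ⟨resolvent H z g, resolvent_mem hH hz g⟩))‖ ≤ C * ‖g‖) ∧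
    ∀ e : GraphSpace (generator (dualGroup U)), ∃ C : ℝ, 0 ≤ C ∧
      ∀ (z : ℂ) (hz : z.im ≠ 0), 0 ≤ z.re → ∀ g,
      √|z.im| * ‖dualGeneratorIncl U e
        (toEnergy hS (domainIncl hH ⟨resolvent H z g, resolvent_mem hH hz g⟩))‖ ≤ C * ‖g‖ := by
  obtain ⟨B, hB, hB'⟩ := hBC1
  obtain ⟨K, hK, D, rfl, hD⟩ := exists_conjugateForms hH hW hWu hHC1 hc₁ hS hU hUW hB hB'
  exact D.exists_bound_resolvent hH (toEnergy hS ∘ₗ domainIncl hH) fun f =>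
    (hD f).imp fun k₀ h => ⟨_, h⟩

end Setting

/-! ### Spectral measures -/

section SpectralMeasure

variable {𝓗 : Type*} [NormedAddCommGroup 𝓗] [InnerProductSpace ℂ 𝓗] [CompleteSpace 𝓗]

open scoped CompactlySupported in
/-- A continuous functional calculus on a compact space is given by scalar measures, which depend
quadratically on the vector. -/
theorem exists_measure_of_starAlgHom {X : Type*} [TopologicalSpace X] [CompactSpace X]
    [T2Space X] [TopologicalSpace.MetrizableSpace X] [MeasurableSpace X] [BorelSpace X]
    (Ψ : C(X, ℂ) →⋆ₐ[ℂ] (𝓗 →L[ℂ] 𝓗)) :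
    ∃ ν : 𝓗 → Measure X, (∀ f, IsFiniteMeasure (ν f)) ∧
      (∀ (f : 𝓗) (g : C(X, ℂ)), inner ℂ f (Ψ g f) = ∫ x, g x ∂ν f) ∧
      ∀ f g, ν (f + g) + ν (f - g) = (2 : ℝ≥0∞) • ν f + (2 : ℝ≥0∞) • ν g := by
  -- real functions as complex functions
  let c : C_c(X, ℝ) → C(X, ℂ) := fun φ =>
    ⟨fun x => (φ x : ℂ), Complex.continuous_ofReal.comp φ.continuous⟩
  have hadj : ∀ (g : C(X, ℂ)) (x y : 𝓗), inner ℂ (Ψ g x) y = inner ℂ x (Ψ (star g) y) := by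
    intro g x y
    rw [map_star, ContinuousLinearMap.star_eq_adjoint, ContinuousLinearMap.adjoint_inner_right]
  have hcim : ∀ φ f, (inner ℂ f (Ψ (c φ) f)).im = 0 := by
    intro φ f
    have h1 : star (c φ) = c φ := by
      ext x
      exact Complex.conj_ofReal _
    have h2 := hadj (c φ) f f
    rw [h1, ← inner_conj_symm] at h2
    exact Complex.conj_eq_iff_im.1 h2
  let Λ : 𝓗 → C_c(X, ℝ) →ₚ[ℝ] ℝ := fun f => PositiveLinearMap.mk₀
    { toFun := fun φ => (inner ℂ f (Ψ (c φ) f)).re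
      map_add' := fun φ ψ => by
        have h : c (φ + ψ) = c φ + c ψ := by
          ext x
          exact Complex.ofReal_add _ _
        rw [h, _root_.map_add, _root_.add_apply, inner_add_right, Complex.add_re]
      map_smul' := fun r φ => by
        have h : c (r • φ) = (r : ℂ) • c φ := by
          ext x
          exact Complex.ofReal_mul _ _
        rw [h, _root_.map_smul, _root_.smul_apply, inner_smul_right, Complex.re_ofReal_mul]
        rfl }
    (fun φ hφ => by
      let s : C(X, ℂ) := ⟨fun x => (√(φ x) : ℂ),
        Complex.continuous_ofReal.comp (Real.continuous_sqrt.comp φ.continuous)⟩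
      have h1 : c φ = star s * s := by
        ext x
        change ((φ x : ℝ) : ℂ) = starRingEnd ℂ (√(φ x) : ℂ) * (√(φ x) : ℂ)
        rw [Complex.conj_ofReal, ← Complex.ofReal_mul, Real.mul_self_sqrt (hφ x)]
      change 0 ≤ (inner ℂ f (Ψ (c φ) f)).re
      rw [h1, map_mul, mul_apply_eq_comp, ← hadj]
      exact inner_self_nonneg (𝕜 := ℂ))
  have hΛ : ∀ f φ, Λ f φ = (inner ℂ f (Ψ (c φ) f)).re := fun f φ => rfl
  have hfin : ∀ f, IsFiniteMeasure (RealRMK.rieszMeasure (Λ f)) := fun f => inferInstance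
  refine ⟨fun f => RealRMK.rieszMeasure (Λ f), hfin, fun f g => ?_, fun f g => ?_⟩
  · have hreal : ∀ φ : C_c(X, ℝ),
        inner ℂ f (Ψ (c φ) f) = ∫ x, ((φ x : ℝ) : ℂ) ∂(RealRMK.rieszMeasure (Λ f)) := fun φ => by
      rw [integral_complex_ofReal, RealRMK.integral_rieszMeasure, hΛ]
      exact Complex.ext rfl (hcim φ f)
    let g₁ : C_c(X, ℝ) := ⟨⟨fun x => (g x).re, by fun_prop⟩, HasCompactSupport.of_compactSpace _⟩
    let g₂ : C_c(X, ℝ) := ⟨⟨fun x => (g x).im, by fun_prop⟩, HasCompactSupport.of_compactSpace _⟩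
    have hg : g = c g₁ + Complex.I • c g₂ := by
      ext x
      change g x = ((g x).re : ℂ) + Complex.I * ((g x).im : ℂ)
      rw [mul_comm, Complex.re_add_im]
    have hi : ∀ φ : C_c(X, ℝ), Integrable (fun x => ((φ x : ℝ) : ℂ))
        (RealRMK.rieszMeasure (Λ f)) := fun φ => φ.integrable.ofReal
    rw [hg, _root_.map_add, _root_.map_smul, _root_.add_apply, _root_.smul_apply,
      inner_add_right, inner_smul_right, hreal, hreal, ← integral_const_mul, ← integral_add (hi _)
        ((hi _).const_mul _)]
    rfl
  · have h2 : ∀ f, IsFiniteMeasure ((2 : ℝ≥0∞) • RealRMK.rieszMeasure (Λ f)) := fun f =>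
      Measure.smul_finite _ (by simp)
    refine Measure.ext_of_integral_eq_on_compactlySupported fun φ => ?_
    have hi : ∀ f, Integrable φ (RealRMK.rieszMeasure (Λ f)) := fun f => φ.integrable
    rw [integral_add_measure (hi _) (hi _), integral_add_measure ((hi _).smul_measure (by simp))
      ((hi _).smul_measure (by simp)), integral_smul_measure, integral_smul_measure]
    simp only [RealRMK.integral_rieszMeasure, hΛ, _root_.map_add, _root_.map_sub, inner_add_left,
      inner_add_right, inner_sub_left, inner_sub_right, Complex.add_re, Complex.sub_re]
    simp
    ring

variable {H : 𝓗 →ₗ.[ℂ] 𝓗}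

/-- The Cayley transform `(H - i) (H + i)⁻¹ = 1 - 2i (H + i)⁻¹`. -/
noncomputable def cayley (H : 𝓗 →ₗ.[ℂ] 𝓗) : 𝓗 →L[ℂ] 𝓗 :=
  1 - (2 * Complex.I) • resolvent H (-Complex.I)

theorem cayley_mem_unitary (hH : IsSelfAdjoint H) : cayley H ∈ unitary (𝓗 →L[ℂ] 𝓗) := by
  have h1 : (Complex.I).im ≠ 0 := by simp
  have h2 : (-Complex.I).im ≠ 0 := by simp
  have h3 : star (cayley H) = 1 + (2 * Complex.I) • resolvent H Complex.I := by
    rw [cayley, star_sub, star_one, star_smul, ContinuousLinearMap.star_eq_adjoint,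
      resolvent_adjoint hH h2]
    simp [sub_eq_add_neg]
  have h4 := resolvent_sub hH h1 h2
  rw [Unitary.mem_iff, h3, cayley]
  constructor
  · ext f
    simp only [mul_apply_eq_comp, _root_.add_apply, _root_.sub_apply, _root_.smul_apply,
      _root_.map_sub, _root_.map_smul, one_apply_eq_self]
    have h5 := h4 f
    rw [sub_eq_iff_eq_add] at h5
    rw [h5]
    module
  · ext f
    simp only [mul_apply_eq_comp, _root_.add_apply, _root_.sub_apply, _root_.smul_apply,
      _root_.map_add, _root_.map_smul, one_apply_eq_self]
    have h5 := h4 f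
    rw [sub_eq_iff_eq_add] at h5
    rw [resolvent_comm hH h2 h1, h5]
    module

/-- In the variable `u = (x - i) / (x + i)` on the unit circle, `(x - z)⁻¹` is the quotient of
`1 - u` by the function considered here. -/
theorem cayley_denom_ne_zero {z u : ℂ} (hz : z.im ≠ 0) (hu : ‖u‖ = 1) :
    Complex.I * (1 + u) - z * (1 - u) ≠ 0 := by
  intro h
  have h1 : u * (z + Complex.I) = z - Complex.I := by linear_combination h
  have h2 := congrArg (fun w => ‖w‖ ^ 2) h1
  simp only [norm_mul, hu, one_mul] at h2
  rw [← Complex.normSq_eq_norm_sq, ← Complex.normSq_eq_norm_sq, Complex.normSq_apply,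
    Complex.normSq_apply] at h2
  simp at h2
  apply hz
  linarith

/-- Spectral measures exist. They are images of the Riesz-Markov measures of the Cayley transform
on the unit circle without the point `1`. The last bound is the parallelogram law. -/
theorem exists_spectralMeasure (hH : IsSelfAdjoint H) : ∃ μ : 𝓗 → Measure ℝ,
    (∀ f, IsSpectralMeasure H f (μ f)) ∧ (∀ f, μ f univ ≤ ENNReal.ofReal (‖f‖ ^ 2)) ∧
    ∀ f g, μ (f + g) ≤ (2 : ℝ≥0∞) • μ f + (2 : ℝ≥0∞) • μ g := by
  have hu := cayley_mem_unitary hH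
  have hN : IsStarNormal (cayley H) := ⟨(hu.1.trans hu.2.symm)⟩
  have hcirc : ∀ u : spectrum ℂ (cayley H), ‖(u : ℂ)‖ = 1 := fun u => by
    simpa using spectrum.subset_circle_of_unitary hu u.2
  obtain ⟨ν, hfin, hν, hpar⟩ := exists_measure_of_starAlgHom
    (cfcHom (R := ℂ) (A := 𝓗 →L[ℂ] 𝓗) hN)
  -- the inverse Cayley transform
  let κ : spectrum ℂ (cayley H) → ℝ := fun u => (Complex.I * (1 + u) / (1 - u)).re
  have hκ : Measurable κ := by fun_prop
  let O : Set (spectrum ℂ (cayley H)) := {u | (u : ℂ) ≠ 1}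
  have hO : MeasurableSet O :=
    (measurableSet_singleton (1 : ℂ)).compl.preimage measurable_subtype_coe
  have hκO : ∀ u ∈ O, (κ u : ℂ) = Complex.I * (1 + u) / (1 - u) := by
    intro u hu'
    have h1 : (1 : ℂ) - u ≠ 0 := sub_ne_zero.2 (Ne.symm hu')
    have h0 : (u : ℂ) ≠ 0 := fun h => by simpa [h] using hcirc u
    have h2 : starRingEnd ℂ (u : ℂ) = (u : ℂ)⁻¹ := by
      rw [Complex.inv_def, Complex.normSq_eq_norm_sq, hcirc]
      simp
    refine Complex.conj_eq_iff_re.1 ?_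
    rw [map_div₀, map_mul, _root_.map_add, _root_.map_sub, h2, map_one, Complex.conj_I]
    have h3 : (1 : ℂ) - (u : ℂ)⁻¹ ≠ 0 := by
      intro h
      apply h1
      field_simp at h
      linear_combination -h
    rw [div_eq_div_iff h3 h1]
    field_simp
    ring
  refine ⟨fun f => ((ν f).restrict O).map κ, fun f => ⟨inferInstance, fun z hz => ?_⟩,
    fun f => ?_, fun f g => ?_⟩
  · have hden := fun u : spectrum ℂ (cayley H) => cayley_denom_ne_zero hz (hcirc u)
    let r : C(spectrum ℂ (cayley H), ℂ) :=
      ⟨fun u => (1 - (u : ℂ)) / (Complex.I * (1 + u) - z * (1 - u)),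
        Continuous.div (by fun_prop) (by fun_prop) hden⟩
    let m : C(spectrum ℂ (cayley H), ℂ) :=
      Complex.I • (1 + ContinuousMap.restrict _ (ContinuousMap.id ℂ)) -
        z • (1 - ContinuousMap.restrict _ (ContinuousMap.id ℂ))
    have hrm : r * m = 1 - ContinuousMap.restrict _ (ContinuousMap.id ℂ) := by
      ext u
      exact div_mul_cancel₀ _ (hden u)
    have hI : (-Complex.I).im ≠ 0 := by simp
    have hr : cfcHom (R := ℂ) (A := 𝓗 →L[ℂ] 𝓗) hN r = resolvent H z := by
      have h1 := congrArg (cfcHom (R := ℂ) (A := 𝓗 →L[ℂ] 𝓗) hN) hrm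
      simp only [m, map_mul, _root_.map_sub, _root_.map_add, _root_.map_smul, map_one,
        cfcHom_id] at h1
      ext f
      set F := f + (z + Complex.I) • resolvent H z f with hF
      have h2 : resolvent H (-Complex.I) F = resolvent H z f := by
        rw [hF, _root_.map_add, _root_.map_smul, ← resolvent_comm hH hz hI,
          ← sub_neg_eq_add z Complex.I, ← resolvent_sub hH hz hI]
        abel
      have h3 : (Complex.I • (1 + cayley H) - z • (1 - cayley H)) F = (2 * Complex.I) • f := by
        simp only [cayley, _root_.add_apply, _root_.sub_apply, _root_.smul_apply,
          one_apply_eq_self, h2]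
        rw [hF]
        match_scalars
        · ring
        · ring
      have h4 := congrArg (fun A : 𝓗 →L[ℂ] 𝓗 => A F) h1
      simp only [mul_apply_eq_comp, h3, _root_.map_smul] at h4
      simp only [cayley, sub_sub_cancel, _root_.smul_apply, h2] at h4
      exact smul_right_injective _ (by simp) h4
    rw [← hr, hν, integral_map hκ.aemeasurable (by fun_prop),
      ← integral_indicator hO]
    refine integral_congr_ae (Eventually.of_forall fun u => ?_)
    by_cases huO : u ∈ O
    · simp only [Set.indicator_of_mem huO]
      rw [hκO u huO]
      have h1 : (1 : ℂ) - u ≠ 0 := sub_ne_zero.2 (Ne.symm huO)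
      change (1 - (u : ℂ)) / (Complex.I * (1 + u) - z * (1 - u)) = _
      rw [div_sub' h1, inv_div, mul_comm (1 - (u : ℂ)) z]
    · simp only [Set.indicator_of_notMem huO]
      have h1 : (u : ℂ) = 1 := not_not.1 huO
      change (1 - (u : ℂ)) / (Complex.I * (1 + u) - z * (1 - u)) = 0
      rw [h1, sub_self, zero_div]
  · rw [Measure.map_apply hκ MeasurableSet.univ, preimage_univ]
    refine (Measure.restrict_apply_le _ _).trans ?_
    have h1 := hν f 1
    rw [map_one, one_apply_eq_self, inner_self_eq_norm_sq_to_K] at h1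
    simp only [ContinuousMap.one_apply, integral_const, Measure.real] at h1
    have h2 : ‖f‖ ^ 2 = (ν f univ).toReal := by
      have h3 := congrArg Complex.re h1
      rw [Complex.real_smul, mul_one, Complex.ofReal_re] at h3
      rw [← h3]
      norm_cast
    rw [h2]
    exact ENNReal.le_ofReal_iff_toReal_le (measure_ne_top _ _) ENNReal.toReal_nonneg |>.2 le_rfl
  · have h1 : ν (f + g) ≤ (2 : ℝ≥0∞) • ν f + (2 : ℝ≥0∞) • ν g := by
      rw [← hpar]
      exact Measure.le_add_right le_rfl
    calc ((ν (f + g)).restrict O).map κ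
        ≤ (((2 : ℝ≥0∞) • ν f + (2 : ℝ≥0∞) • ν g).restrict O).map κ :=
          Measure.map_mono (Measure.restrict_mono_measure h1 O) hκ
      _ = _ := by
        rw [Measure.restrict_add, Measure.restrict_smul, Measure.restrict_smul,
          Measure.map_add _ _ hκ, Measure.map_smul, Measure.map_smul]

end SpectralMeasure

section SpectralMeasure

variable {𝓗 : Type*} [NormedAddCommGroup 𝓗] [InnerProductSpace ℂ 𝓗] [CompleteSpace 𝓗]
  {H : 𝓗 →ₗ.[ℂ] 𝓗}

theorem resolvent_opNorm_le (hH : IsSelfAdjoint H) {z : ℂ} (hz : z.im ≠ 0) :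
    ‖resolvent H z‖ ≤ |z.im|⁻¹ := by
  refine ContinuousLinearMap.opNorm_le_bound _ (by positivity) fun f => ?_
  rw [inv_mul_eq_div, le_div_iff₀ (abs_pos.2 hz), mul_comm]
  exact resolvent_norm_le hH hz f

theorem continuousAt_resolvent (hH : IsSelfAdjoint H) {z : ℂ} (hz : z.im ≠ 0) :
    ContinuousAt (resolvent H) z := by
  have h1 : ContinuousAt (fun w : ℂ => ‖w - z‖ * (|w.im|⁻¹ * |z.im|⁻¹)) z :=
    ContinuousAt.mul (by fun_prop) (ContinuousAt.mul (ContinuousAt.inv₀ (by fun_prop)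
      (abs_ne_zero.2 hz)) continuousAt_const)
  have h2 : Tendsto (fun w : ℂ => ‖w - z‖ * (|w.im|⁻¹ * |z.im|⁻¹)) (𝓝 z) (𝓝 0) := by
    have h3 := h1.tendsto
    simpa using h3
  rw [ContinuousAt, tendsto_iff_norm_sub_tendsto_zero]
  refine squeeze_zero' (Eventually.of_forall fun w => norm_nonneg _) ?_ h2
  filter_upwards [Complex.continuous_im.continuousAt.eventually_ne hz] with w hw
  have h3 : resolvent H w - resolvent H z = (w - z) • (resolvent H w * resolvent H z) := by
    ext f
    exact resolvent_sub hH hw hz f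
  rw [h3, norm_smul]
  gcongr
  exact (norm_mul_le _ _).trans (mul_le_mul (resolvent_opNorm_le hH hw)
    (resolvent_opNorm_le hH hz) (norm_nonneg _) (by positivity))

theorem hasDerivAt_resolvent (hH : IsSelfAdjoint H) {z : ℂ} (hz : z.im ≠ 0) :
    HasDerivAt (resolvent H) (resolvent H z * resolvent H z) z := by
  rw [hasDerivAt_iff_tendsto_slope]
  have h1 : Tendsto (fun w => resolvent H w * resolvent H z) (𝓝[≠] z)
      (𝓝 (resolvent H z * resolvent H z)) :=
    ((continuousAt_resolvent hH hz).tendsto.mul_const _).mono_left nhdsWithin_le_nhds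
  refine h1.congr' ?_
  filter_upwards [nhdsWithin_le_nhds (Complex.continuous_im.continuousAt.eventually_ne hz),
    self_mem_nhdsWithin] with w hw hwz
  have h3 : resolvent H w - resolvent H z = (w - z) • (resolvent H w * resolvent H z) := by
    ext f
    exact resolvent_sub hH hw hz f
  rw [slope_def_module, h3, smul_smul, inv_mul_cancel₀ (sub_ne_zero.2 hwz), one_smul]

theorem inner_resolvent_im (hH : IsSelfAdjoint H) {z : ℂ} (hz : z.im ≠ 0) (f : 𝓗) :
    (inner ℂ f (resolvent H z f)).im = z.im * ‖resolvent H z f‖ ^ 2 := by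
  set y : H.domain := ⟨_, resolvent_mem hH hz f⟩ with hy
  have h1 : f = H y - z • (y : 𝓗) := by
    rw [hy, apply_resolvent hH hz]
    simp
  have h2 : inner ℂ f (resolvent H z f) = inner ℂ (H y - z • (y : 𝓗)) (y : 𝓗) := by rw [← h1]
  rw [h2, inner_sub_left, inner_smul_left, selfAdjoint_inner_left hH, Complex.sub_im,
    selfAdjoint_inner_self_im hH, inner_self_eq_norm_sq_to_K]
  have h3 : (((‖(y : 𝓗)‖ : ℝ) : ℂ) ^ 2) = ((‖(y : 𝓗)‖ ^ 2 : ℝ) : ℂ) := by push_cast; rfl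
  change _ = z.im * ‖(y : 𝓗)‖ ^ 2
  simp [h3, -Complex.ofReal_pow]

/-- The bounded continuous function `x ↦ (x - z)⁻¹` on the real line. -/
noncomputable def resolventFun (z : ℂ) (hz : z.im ≠ 0) : BoundedContinuousFunction ℝ ℂ :=
  BoundedContinuousFunction.ofNormedAddCommGroup (fun x : ℝ => ((x : ℂ) - z)⁻¹)
    (Continuous.inv₀ (by fun_prop) fun x h => hz (by
      have := congrArg Complex.im h
      simpa using this))
    |z.im|⁻¹ fun x => by
      rw [norm_inv]
      refine inv_anti₀ (abs_pos.2 hz) ?_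
      have := Complex.abs_im_le_norm ((x : ℂ) - z)
      simpa using this

theorem resolventFun_apply (z : ℂ) (hz : z.im ≠ 0) (x : ℝ) :
    resolventFun z hz x = ((x : ℂ) - z)⁻¹ := rfl

theorem ofReal_sub_ne_zero {z : ℂ} (hz : z.im ≠ 0) (x : ℝ) : (x : ℂ) - z ≠ 0 := fun h => hz (by
  have := congrArg Complex.im h
  simpa using this)

namespace IsSpectralMeasure

theorem integral_normSq (hH : IsSelfAdjoint H) {f : 𝓗} {μ : Measure ℝ}
    (hμ : IsSpectralMeasure H f μ) {z : ℂ} (hz : z.im ≠ 0) :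
    Integrable (fun x : ℝ => ((x - z.re) ^ 2 + z.im ^ 2)⁻¹) μ ∧
      ∫ x : ℝ, ((x - z.re) ^ 2 + z.im ^ 2)⁻¹ ∂μ = ‖resolvent H z f‖ ^ 2 := by
  have := hμ.finite
  have h0 : ∀ x : ℝ, (((x : ℂ) - z)⁻¹).im = z.im * ((x - z.re) ^ 2 + z.im ^ 2)⁻¹ := fun x => by
    rw [Complex.inv_im, Complex.normSq_apply, div_eq_mul_inv]
    simp
    ring_nf
    simp
  have h1 : Integrable (fun x : ℝ => ((x : ℂ) - z)⁻¹) μ := (resolventFun z hz).integrable μ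
  have h2 := h1.im
  have h3 := inner_resolvent_im hH hz f
  rw [hμ.inner_resolvent z hz] at h3
  have h4 : ∫ x : ℝ, (((x : ℂ) - z)⁻¹).im ∂μ = (∫ x : ℝ, ((x : ℂ) - z)⁻¹ ∂μ).im :=
    integral_im h1
  rw [← h4] at h3
  change Integrable (fun x : ℝ => (((x : ℂ) - z)⁻¹).im) μ at h2
  simp only [h0] at h2 h3
  rw [integral_const_mul] at h3
  exact ⟨(integrable_const_mul_iff (isUnit_iff_ne_zero.2 hz) _).1 h2, mul_left_cancel₀ hz h3⟩

theorem inner_resolvent_resolvent (hH : IsSelfAdjoint H) {f : 𝓗} {μ : Measure ℝ}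
    (hμ : IsSpectralMeasure H f μ) {g : 𝓗} {a : BoundedContinuousFunction ℝ ℂ} {z w : ℂ}
    (hz : z.im ≠ 0) (hw : w.im ≠ 0) (hzw : z ≠ w)
    (h1 : inner ℂ f (resolvent H z g) = ∫ x, (resolventFun z hz * a) x ∂μ)
    (h2 : inner ℂ f (resolvent H w g) = ∫ x, (resolventFun w hw * a) x ∂μ) :
    inner ℂ f (resolvent H z (resolvent H w g)) =
      ∫ x, (resolventFun z hz * (resolventFun w hw * a)) x ∂μ := by
  have := hμ.finite
  have h3 := congrArg (inner ℂ f) (resolvent_sub hH hz hw g)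
  rw [inner_sub_right, inner_smul_right, h1, h2, ← integral_sub
    (BoundedContinuousFunction.integrable μ _) (BoundedContinuousFunction.integrable μ _)] at h3
  refine mul_left_cancel₀ (sub_ne_zero.2 hzw) (h3.symm.trans ?_)
  rw [← integral_const_mul]
  refine integral_congr_ae (Eventually.of_forall fun x => ?_)
  have h4 := ofReal_sub_ne_zero hz x
  have h5 := ofReal_sub_ne_zero hw x
  simp only [BoundedContinuousFunction.coe_mul, Pi.mul_apply, resolventFun_apply]
  field_simp
  ring

end IsSpectralMeasure

/-- The form of `H` is nonnegative on vectors `(H - conj z)⁻¹ (H - z)⁻¹ f` with `f` in the range of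
the spectral projection on `[0, ∞)`. Perturbing `z` on one side of the scalar product avoids double
poles. -/
theorem inner_apply_nonneg_of_mem (hH : IsSelfAdjoint H) {f : 𝓗}
    (hf : MemSpectralSubspace H (Ici 0) f) {z : ℂ} (hz : 0 < z.im) {y : H.domain}
    (hy : (y : 𝓗) = resolvent H z (resolvent H (starRingEnd ℂ z) f)) :
    0 ≤ (inner ℂ (y : 𝓗) (H y)).re := by
  obtain ⟨μ, hμ, hμ0⟩ := hf
  have hfin := hμ.finite
  have hz1 : (starRingEnd ℂ z).im ≠ 0 := by simpa using hz.ne'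
  have hHy : H y = resolvent H (starRingEnd ℂ z) f + z • (y : 𝓗) := by
    rw [hy, ← apply_resolvent hH hz.ne']
    congr 1
    exact Subtype.ext hy
  let w : ℝ → ℂ := fun δ => z + δ * Complex.I
  have hwim : ∀ δ : ℝ, 0 ≤ δ → 0 < (w δ).im := fun δ hδ => by simp [w]; linarith
  have key : ∀ δ : ℝ, 0 < δ →
      0 ≤ (inner ℂ ((resolvent H (w δ) * resolvent H (starRingEnd ℂ (w δ))) f) (H y)).re := by
    intro δ hδ
    have hw : (w δ).im ≠ 0 := (hwim δ hδ.le).ne'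
    have hw1 : (starRingEnd ℂ (w δ)).im ≠ 0 := by simpa using hw
    have hne : ∀ {u v : ℂ}, u.im ≠ v.im → u ≠ v := fun h h' => h (by rw [h'])
    have n1 : z ≠ starRingEnd ℂ z := hne (by simp; linarith)
    have n2 : w δ ≠ starRingEnd ℂ z := hne (by simp [w]; linarith)
    have n3 : starRingEnd ℂ (w δ) ≠ starRingEnd ℂ z := hne (by simp [w]; linarith)
    have n4 : w δ ≠ z := hne (by simp [w]; linarith)
    have n5 : starRingEnd ℂ (w δ) ≠ z := hne (by simp [w]; linarith)
    have n6 : w δ ≠ starRingEnd ℂ (w δ) := hne (by simp [w]; linarith)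
    have one : ∀ {u : ℂ} (hu : u.im ≠ 0), inner ℂ f (resolvent H u f) =
        ∫ x, (resolventFun u hu * 1) x ∂μ := fun hu => by
      rw [hμ.inner_resolvent _ hu]
      simp [resolventFun_apply]
    have two : ∀ {u v : ℂ} (hu : u.im ≠ 0) (hv : v.im ≠ 0), u ≠ v → _ :=
      fun hu hv huv => hμ.inner_resolvent_resolvent hH hu hv huv (one hu) (one hv)
    have three : ∀ {t u v : ℂ} (ht : t.im ≠ 0) (hu : u.im ≠ 0) (hv : v.im ≠ 0), t ≠ u → t ≠ v →
        u ≠ v → _ := fun ht hu hv htu htv huv =>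
      hμ.inner_resolvent_resolvent hH ht hu htu (two ht hv htv) (two hu hv huv)
    have e3 := three hw hw1 hz1 n6 n2 n3
    have e4 := hμ.inner_resolvent_resolvent hH hw hw1 n6 (three hw hz.ne' hz1 n4 n2 n1)
      (three hw1 hz.ne' hz1 n5 n3 n1)
    rw [mul_apply_eq_comp, resolvent_inner hH hw, resolvent_inner hH hw1, Complex.conj_conj,
      hHy, hy, _root_.map_add, _root_.map_add, _root_.map_smul, _root_.map_smul, inner_add_right,
      inner_smul_right, e3, e4, ← integral_const_mul, ← integral_add
        (BoundedContinuousFunction.integrable μ _)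
        ((BoundedContinuousFunction.integrable μ _).const_mul z)]
    have hpt : ∀ x : ℝ, (resolventFun _ hw * (resolventFun _ hw1 * (resolventFun _ hz1 * 1))) x +
        z * (resolventFun _ hw * (resolventFun _ hw1 * (resolventFun _ hz.ne' *
          (resolventFun _ hz1 * 1)))) x =
        ((x * (Complex.normSq (x - w δ))⁻¹ * (Complex.normSq (x - z))⁻¹ : ℝ) : ℂ) := by
      intro x
      have h1 := ofReal_sub_ne_zero hw x
      have h2 := ofReal_sub_ne_zero hw1 x
      have h3 := ofReal_sub_ne_zero hz.ne' x
      have h4 := ofReal_sub_ne_zero hz1 x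
      simp only [BoundedContinuousFunction.coe_mul, Pi.mul_apply, resolventFun_apply,
        BoundedContinuousFunction.coe_one, Pi.one_apply]
      push_cast
      rw [← Complex.mul_conj, ← Complex.mul_conj, _root_.map_sub, _root_.map_sub,
        Complex.conj_ofReal]
      field_simp
      ring
    simp_rw [hpt]
    rw [integral_complex_ofReal, Complex.ofReal_re]
    refine integral_nonneg_of_ae ?_
    have h0 : ∀ᵐ x ∂μ, x ∈ Ici (0 : ℝ) := mem_ae_iff.2 hμ0
    filter_upwards [h0] with x hx
    exact mul_nonneg (mul_nonneg hx (inv_nonneg.2 (Complex.normSq_nonneg _)))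
      (inv_nonneg.2 (Complex.normSq_nonneg _))
  have hw0 : w 0 = z := by simp [w]
  have hwc : Continuous w := by fun_prop
  have hlim : Tendsto (fun δ => (resolvent H (w δ) * resolvent H (starRingEnd ℂ (w δ))) f)
      (𝓝 0) (𝓝 (y : 𝓗)) := by
    have h1 : Tendsto (fun δ => resolvent H (w δ)) (𝓝 0) (𝓝 (resolvent H z)) :=
      (continuousAt_resolvent hH hz.ne').tendsto.comp (by simpa [hw0] using hwc.tendsto 0)
    have h2 : Tendsto (fun δ => resolvent H (starRingEnd ℂ (w δ))) (𝓝 0)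
        (𝓝 (resolvent H (starRingEnd ℂ z))) :=
      (continuousAt_resolvent hH hz1).tendsto.comp (by
        have h3 := (Complex.continuous_conj.comp hwc).tendsto 0
        simp only [Function.comp_apply, hw0] at h3
        exact h3)
    rw [hy]
    exact ((ContinuousLinearMap.apply ℂ 𝓗 f).continuous.tendsto _).comp (h1.mul h2)
  have hlim' := ((Complex.continuous_re.tendsto _).comp
    (hlim.inner (𝕜 := ℂ) (tendsto_const_nhds (x := H y)))).mono_left
      (nhdsWithin_le_nhds (s := Ioi (0 : ℝ)))
  refine ge_of_tendsto hlim' ?_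
  filter_upwards [self_mem_nhdsWithin] with δ hδ
  exact key δ hδ

/-- If `ε ‖(H - l - iε)⁻¹ f‖²` is bounded by `C` for `l ≥ 0` and `ε > 0`, then the spectral measure
of `f` is bounded on `[0, ∞)` by `C` times the Lebesgue measure. -/
theorem IsSpectralMeasure.measure_le (hH : IsSelfAdjoint H) {f : 𝓗} {μ : Measure ℝ}
    (hμ : IsSpectralMeasure H f μ) {C : ℝ} (hC : 0 ≤ C)
    (h : ∀ l ε : ℝ, 0 ≤ l → 0 < ε → ε * ‖resolvent H (l + ε * Complex.I) f‖ ^ 2 ≤ C)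
    {s : Set ℝ} (hs : s ⊆ Ici 0) : μ s ≤ C.toNNReal • volume s := by
  have := hμ.finite
  have hball : ∀ l ∈ s, ∀ r : ℝ, 0 < r →
      μ (Metric.closedBall l r) ≤ (C.toNNReal • volume) (Metric.closedBall l r) := by
    intro l hl r hr
    have him : ((l : ℂ) + r * Complex.I).im ≠ 0 := by simpa using hr.ne'
    obtain ⟨h1, h2⟩ := hμ.integral_normSq hH him
    simp only [Complex.add_re, Complex.ofReal_re, Complex.re_ofReal_mul, Complex.I_re, mul_zero,
      add_zero, Complex.add_im, Complex.ofReal_im, Complex.im_ofReal_mul, Complex.I_im, mul_one,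
      zero_add] at h1 h2
    have h3 : (2 * r ^ 2)⁻¹ * μ.real (Metric.closedBall l r) ≤
        ‖resolvent H (l + r * Complex.I) f‖ ^ 2 := by
      rw [← h2, mul_comm, ← smul_eq_mul, ← setIntegral_const]
      refine (setIntegral_mono_on (integrable_const _).integrableOn h1.integrableOn
        measurableSet_closedBall fun x hx => ?_).trans
          (setIntegral_le_integral h1 (Eventually.of_forall fun x => ?_))
      · rw [Metric.mem_closedBall, Real.dist_eq] at hx
        refine inv_anti₀ (by positivity) ?_
        have := sq_le_sq' (by linarith [neg_abs_le (x - l)]) ((le_abs_self _).trans hx)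
        linarith
      · exact inv_nonneg.2 (by positivity)
    have h4 := h l r (hs hl) hr
    have h5 : μ.real (Metric.closedBall l r) ≤ C * (2 * r) := by
      rw [inv_mul_le_iff₀ (by positivity)] at h3
      nlinarith
    rw [Measure.smul_apply, Real.volume_closedBall, ENNReal.smul_def, smul_eq_mul]
    change _ ≤ ENNReal.ofReal C * _
    rw [← ENNReal.ofReal_mul hC]
    exact (ENNReal.le_ofReal_iff_toReal_le (measure_ne_top _ _) (by positivity)).2 h5
  refine (Besicovitch.vitaliFamily μ).measure_le_of_frequently_le (C.toNNReal • volume)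
    Measure.AbsolutelyContinuous.rfl s fun l hl => ?_
  refine (Besicovitch.tendsto_filterAt μ l).frequently (Eventually.frequently ?_)
  filter_upwards [self_mem_nhdsWithin] with r hr
  exact hball l hl r hr

/-- Absolute continuity on `[0, ∞)` follows from resolvent bounds for a separating family of
functionals on the domain. -/
theorem hasACSpectrumOn_of_functionals (hH : IsSelfAdjoint H) (Λ : Set (H.domain →ₗ[ℂ] ℂ))
    (hbound : ∀ ℓ ∈ Λ, ∃ C : ℝ, 0 ≤ C ∧ ∀ (z : ℂ) (hz : z.im ≠ 0), 0 ≤ z.re → ∀ g,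
      √|z.im| * ‖ℓ ⟨resolvent H z g, resolvent_mem hH hz g⟩‖ ≤ C * ‖g‖)
    (hsep : ∀ x : H.domain, (∀ ℓ ∈ Λ, ℓ x = 0) → x = 0) : HasACSpectrumOn H (Ici 0) := by
  have hI : Complex.I.im ≠ 0 := by simp
  obtain ⟨μ, hμ, hμ1, hμ2⟩ := exists_spectralMeasure hH
  -- vectors with uniform resolvent bounds
  let M : Submodule ℂ 𝓗 :=
    { carrier := {f | ∃ C : ℝ, 0 ≤ C ∧ ∀ l ε : ℝ, 0 ≤ l → 0 < ε →
        √ε * ‖resolvent H (l + ε * Complex.I) f‖ ≤ C}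
      zero_mem' := ⟨0, le_rfl, by simp⟩
      add_mem' := by
        rintro f g ⟨C, hC, h⟩ ⟨C', hC', h'⟩
        refine ⟨C + C', by positivity, fun l ε hl hε => ?_⟩
        rw [_root_.map_add]
        calc _ ≤ √ε * (‖resolvent H (l + ε * Complex.I) f‖ +
              ‖resolvent H (l + ε * Complex.I) g‖) := by gcongr; exact norm_add_le _ _
          _ ≤ _ := by rw [mul_add]; exact add_le_add (h l ε hl hε) (h' l ε hl hε)
      smul_mem' := by
        rintro c f ⟨C, hC, h⟩
        refine ⟨‖c‖ * C, by positivity, fun l ε hl hε => ?_⟩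
        rw [_root_.map_smul, norm_smul, mul_left_comm]
        gcongr
        exact h l ε hl hε }
  have hMac : ∀ f ∈ M, ∀ N ⊆ Ici (0 : ℝ), volume N = 0 → μ f N = 0 := by
    rintro f ⟨C, hC, h⟩ N hN hN0
    have h1 := (hμ f).measure_le hH (C := C ^ 2) (by positivity) (fun l ε hl hε => by
      have h2 := pow_le_pow_left₀ (by positivity) (h l ε hl hε) 2
      rwa [mul_pow, Real.sq_sqrt hε.le] at h2) hN
    rw [hN0] at h1
    simpa using h1
  have hMdense : M.topologicalClosure = ⊤ := by
    rw [Submodule.topologicalClosure_eq_top_iff, Submodule.eq_bot_iff]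
    intro g hg
    suffices h : (⟨resolvent H Complex.I g, resolvent_mem hH hI g⟩ : H.domain) = 0 by
      refine resolvent_injective hH hI ?_
      rw [_root_.map_zero]
      exact congrArg Subtype.val h
    refine hsep _ fun ℓ hℓ => ?_
    obtain ⟨C, hC, hb⟩ := hbound ℓ hℓ
    -- the vector representing `g ↦ ℓ ((H - i)⁻¹ g)`
    let R : 𝓗 →ₗ[ℂ] H.domain := (resolvent H Complex.I).toLinearMap.codRestrict H.domain
      (resolvent_mem hH hI)
    let L : StrongDual ℂ 𝓗 := (ℓ ∘ₗ R).mkContinuous C fun g => by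
      have h1 := hb Complex.I hI (by simp) g
      rwa [Complex.I_im, abs_one, Real.sqrt_one, one_mul] at h1
    have hL : ∀ g, L g = ℓ ⟨resolvent H Complex.I g, resolvent_mem hH hI g⟩ := fun g => rfl
    set e := (InnerProductSpace.toDual ℂ 𝓗).symm L with he
    have heL : ∀ g, inner ℂ e g = L g := fun g => InnerProductSpace.toDual_symm_apply
    rw [← hL, ← heL]
    refine Submodule.inner_right_of_mem_orthogonal (K := M) ?_ hg
    refine ⟨C, hC, fun l ε hl hε => ?_⟩
    set z : ℂ := l + ε * Complex.I with hz
    have hzim : z.im ≠ 0 := by simpa [hz] using hε.ne'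
    have hzim' : |z.im| = ε := by simpa [hz] using hε.le
    set x := resolvent H (starRingEnd ℂ z) e with hx
    rw [← resolvent_norm_conj hH hzim, ← hx]
    have h1 : inner ℂ x x = ℓ ⟨resolvent H z (resolvent H Complex.I x),
        resolvent_mem hH hzim _⟩ := by
      nth_rewrite 1 [hx]
      rw [resolvent_inner hH (by simpa using hzim), Complex.conj_conj, heL, hL]
      congr 2
      exact resolvent_comm hH hI hzim x
    have h2 := hb z hzim (by simpa [hz] using hl) (resolvent H Complex.I x)
    rw [← h1, hzim'] at h2
    have h3 := resolvent_norm_le hH hI x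
    rw [Complex.I_im, abs_one, one_mul] at h3
    have h4 : ‖inner ℂ x x‖ = ‖x‖ ^ 2 := by
      rw [inner_self_eq_norm_sq_to_K]
      simp
    rw [h4] at h2
    rcases eq_or_ne x 0 with h0 | h0
    · rw [h0]
      simpa using hC
    · have h5 : 0 < ‖x‖ := norm_pos_iff.2 h0
      refine le_of_mul_le_mul_right ?_ h5
      calc √ε * ‖x‖ * ‖x‖ = √ε * ‖x‖ ^ 2 := by ring
        _ ≤ C * ‖resolvent H Complex.I x‖ := h2
        _ ≤ C * ‖x‖ := by gcongr
  refine fun f => ⟨μ f, hμ f, ?_⟩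
  refine Measure.AbsolutelyContinuous.mk fun N hN hN0 => ?_
  rw [Measure.restrict_apply hN]
  set N' := N ∩ Ici 0 with hN'
  have hN'0 : volume N' = 0 := measure_mono_null inter_subset_left hN0
  have h1 : ∀ η : ℝ, 0 < η → μ f N' ≤ 2 * ENNReal.ofReal (η ^ 2) := by
    intro η hη
    have h2 : f ∈ closure (M : Set 𝓗) := by
      rw [← Submodule.topologicalClosure_coe, hMdense]
      trivial
    obtain ⟨e, he, hfe⟩ := Metric.mem_closure_iff.1 h2 η hη
    have h3 := hμ2 e (f - e) N'
    rw [add_sub_cancel] at h3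
    simp only [Measure.add_apply, Measure.smul_apply, smul_eq_mul,
      hMac e he N' inter_subset_right hN'0, mul_zero, zero_add] at h3
    refine h3.trans ?_
    gcongr
    refine (measure_mono (subset_univ _)).trans ((hμ1 _).trans ?_)
    gcongr
    rw [← dist_eq_norm]
    exact hfe.le
  have h2 : Tendsto (fun η : ℝ => 2 * ENNReal.ofReal (η ^ 2)) (𝓝[>] 0) (𝓝 0) := by
    have h3 : Continuous fun η : ℝ => 2 * ENNReal.ofReal (η ^ 2) :=
      (ENNReal.continuous_const_mul (by simp)).comp
        (ENNReal.continuous_ofReal.comp (continuous_pow 2))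
    have h4 := h3.tendsto 0
    simp only [ne_eq, OfNat.ofNat_ne_zero, not_false_eq_true, zero_pow, ENNReal.ofReal_zero,
      mul_zero] at h4
    exact h4.mono_left nhdsWithin_le_nhds
  refine le_antisymm (ge_of_tendsto h2 ?_) zero_le
  filter_upwards [self_mem_nhdsWithin] with η hη
  exact h1 η hη

end SpectralMeasure

/-! ### Kato smoothness -/

section Smoothness

variable {𝓗 : Type*} [NormedAddCommGroup 𝓗] [InnerProductSpace ℂ 𝓗] [CompleteSpace 𝓗]
  {H : 𝓗 →ₗ.[ℂ] 𝓗}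

theorem im_add_mul_I (l ε : ℝ) : ((l : ℂ) + ε * Complex.I).im = ε := by simp

theorem re_add_mul_I (l ε : ℝ) : ((l : ℂ) + ε * Complex.I).re = l := by simp

theorem sub_mul_I_eq_conj (l ε : ℝ) :
    (l : ℂ) - ε * Complex.I = starRingEnd ℂ (l + ε * Complex.I) := by simp [sub_eq_add_neg]

theorem sub_mul_I_eq_add (l ε : ℝ) :
    (l : ℂ) - ε * Complex.I = l + (-ε : ℝ) * Complex.I := by simp [sub_eq_add_neg]

theorem continuous_resolvent_line (hH : IsSelfAdjoint H) {ε : ℝ} (hε : ε ≠ 0) (f : 𝓗) :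
    Continuous fun l : ℝ => resolvent H (l + ε * Complex.I) f := by
  rw [continuous_iff_continuousAt]
  intro l
  have h1 : ((l : ℂ) + ε * Complex.I).im ≠ 0 := by rwa [im_add_mul_I]
  have h2 : ContinuousAt (fun l : ℝ => resolvent H (l + ε * Complex.I)) l :=
    ContinuousAt.comp (f := fun l : ℝ => (l : ℂ) + ε * Complex.I)
      (continuousAt_resolvent hH h1) (by fun_prop)
  exact ((ContinuousLinearMap.apply ℂ 𝓗 f).continuous.tendsto _).comp h2

theorem lintegral_inv_sq_add_sq (x : ℝ) {ε : ℝ} (hε : 0 < ε) :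
    ∫⁻ l : ℝ, ENNReal.ofReal (((x - l) ^ 2 + ε ^ 2)⁻¹) = ENNReal.ofReal (Real.pi / ε) := by
  have h1 := ProbabilityTheory.lintegral_cauchyPDF_eq_one x (γ := ε.toNNReal) (by simpa using hε)
  have h2 : ∀ l : ℝ, ENNReal.ofReal (((x - l) ^ 2 + ε ^ 2)⁻¹) =
      ENNReal.ofReal (Real.pi / ε) * ProbabilityTheory.cauchyPDF x ε.toNNReal l := fun l => by
    have h3 := Real.pi_pos
    rw [ProbabilityTheory.cauchyPDF_def, ProbabilityTheory.cauchyPDFReal_def,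
      ← ENNReal.ofReal_mul (by positivity), Real.coe_toNNReal _ hε.le, ← neg_sub l x, neg_sq]
    congr 1
    field_simp
  simp_rw [h2]
  rw [lintegral_const_mul _ (by fun_prop), h1, mul_one]

/-- The Poisson integral of the spectral measure. -/
theorem integral_norm_resolvent_sq_le (hH : IsSelfAdjoint H) {ε : ℝ} (hε : 0 < ε) (f : 𝓗) :
    Integrable (fun l : ℝ => ‖resolvent H (l + ε * Complex.I) f‖ ^ 2) ∧
      ∫ l : ℝ, ‖resolvent H (l + ε * Complex.I) f‖ ^ 2 ≤ Real.pi / ε * ‖f‖ ^ 2 := by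
  obtain ⟨μ, hμ, hμ1, -⟩ := exists_spectralMeasure hH
  have hfin := (hμ f).finite
  have hpi := Real.pi_pos
  have hm : Measurable (Function.uncurry fun l x : ℝ =>
      ENNReal.ofReal (((x - l) ^ 2 + ε ^ 2)⁻¹)) := by fun_prop
  have h1 : ∫⁻ l : ℝ, ENNReal.ofReal (‖resolvent H (l + ε * Complex.I) f‖ ^ 2) ≤
      ENNReal.ofReal (Real.pi / ε * ‖f‖ ^ 2) := by
    calc ∫⁻ l : ℝ, ENNReal.ofReal (‖resolvent H (l + ε * Complex.I) f‖ ^ 2)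
        = ∫⁻ l : ℝ, ∫⁻ x, ENNReal.ofReal (((x - l) ^ 2 + ε ^ 2)⁻¹) ∂(μ f) := by
          refine lintegral_congr fun l => ?_
          obtain ⟨h2, h3⟩ := (hμ f).integral_normSq hH (z := l + ε * Complex.I)
            (by rw [im_add_mul_I]; exact hε.ne')
          rw [← h3, ofReal_integral_eq_lintegral_ofReal h2
            (Eventually.of_forall fun x => inv_nonneg.2 (by positivity))]
          simp only [im_add_mul_I, re_add_mul_I]
      _ = ∫⁻ x, ∫⁻ l : ℝ, ENNReal.ofReal (((x - l) ^ 2 + ε ^ 2)⁻¹) ∂volume ∂(μ f) :=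
          lintegral_lintegral_swap hm.aemeasurable
      _ = ENNReal.ofReal (Real.pi / ε) * μ f univ := by
          simp_rw [lintegral_inv_sq_add_sq _ hε]
          rw [lintegral_const]
      _ ≤ _ := by
          rw [ENNReal.ofReal_mul (by positivity)]
          gcongr
          exact hμ1 f
  have hc : Continuous fun l : ℝ => ‖resolvent H (l + ε * Complex.I) f‖ ^ 2 :=
    (continuous_resolvent_line hH hε.ne' f).norm.pow 2
  refine ⟨⟨hc.aestronglyMeasurable, ?_⟩, ?_⟩
  · rw [hasFiniteIntegral_iff_ofReal (Eventually.of_forall fun l => by positivity)]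
    exact h1.trans_lt ENNReal.ofReal_lt_top
  · rw [integral_eq_lintegral_of_nonneg_ae (Eventually.of_forall fun l => by positivity)
      hc.aestronglyMeasurable]
    exact ENNReal.toReal_le_of_le_ofReal (by positivity) h1

theorem norm_resolvent_le_of_le (hH : IsSelfAdjoint H) {ε η : ℝ} (hε : 0 < ε) (hη : ε ≤ η)
    (l : ℝ) (f : 𝓗) : ‖resolvent H (l + η * Complex.I) f‖ ^ 2 ≤
      ‖resolvent H (l + ε * Complex.I) f‖ ^ 2 := by
  obtain ⟨μ, hμ, -, -⟩ := exists_spectralMeasure hH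
  obtain ⟨h1, h2⟩ := (hμ f).integral_normSq hH (z := l + ε * Complex.I)
    (by rw [im_add_mul_I]; exact hε.ne')
  obtain ⟨h3, h4⟩ := (hμ f).integral_normSq hH (z := l + η * Complex.I)
    (by rw [im_add_mul_I]; exact (hε.trans_le hη).ne')
  rw [← h2, ← h4]
  refine integral_mono h3 h1 fun x => ?_
  simp only [im_add_mul_I, re_add_mul_I]
  gcongr

theorem tendsto_norm_resolvent_zero (hH : IsSelfAdjoint H) {ε : ℝ} (hε : 0 < ε) (f : 𝓗)
    {u : ℝ → ℝ} (hu : Tendsto (fun n => |u n|) atTop atTop) :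
    Tendsto (fun n => ‖resolvent H (u n + ε * Complex.I) f‖ ^ 2) atTop (𝓝 0) := by
  obtain ⟨μ, hμ, -, -⟩ := exists_spectralMeasure hH
  have hfin := (hμ f).finite
  have h1 : ∀ n, ‖resolvent H (u n + ε * Complex.I) f‖ ^ 2 =
      ∫ x : ℝ, ((x - u n) ^ 2 + ε ^ 2)⁻¹ ∂(μ f) := fun n => by
    rw [← ((hμ f).integral_normSq hH (z := u n + ε * Complex.I)
      (by rw [im_add_mul_I]; exact hε.ne')).2]
    simp only [im_add_mul_I, re_add_mul_I]
  simp_rw [h1]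
  rw [← integral_zero ℝ ℝ (μ := μ f)]
  refine tendsto_integral_filter_of_dominated_convergence (fun _ => (ε ^ 2)⁻¹)
    (Eventually.of_forall fun n => Measurable.aestronglyMeasurable (by fun_prop))
    (Eventually.of_forall fun n => Eventually.of_forall fun x => ?_) (integrable_const _)
    (Eventually.of_forall fun x => ?_)
  · rw [Real.norm_of_nonneg (by positivity)]
    refine inv_anti₀ (by positivity) ?_
    nlinarith [sq_nonneg (x - u n)]
  · refine tendsto_inv_atTop_zero.comp ?_
    refine tendsto_atTop_add_const_right _ _ ?_
    have h2 : Tendsto (fun n => |u n| - |x|) atTop atTop :=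
      tendsto_atTop_add_const_right _ _ hu
    have h3 : Tendsto (fun n => |x - u n|) atTop atTop := by
      refine tendsto_atTop_mono (fun n => ?_) h2
      rw [abs_sub_comm]
      exact abs_sub_abs_le_abs_sub _ _
    have h4 := (tendsto_pow_atTop (two_ne_zero)).comp h3
    refine h4.congr fun n => ?_
    simp

theorem exists_holomorphic_inner_resolvent (hH : IsSelfAdjoint H) (K : 𝓗 →L[ℂ] 𝓗) (f : 𝓗) :
    ∃ F : ℂ → ℂ, ∀ ζ : ℂ, ζ.im ≠ 0 →
      F ζ = inner ℂ (K (resolvent H (starRingEnd ℂ ζ) f)) (K (resolvent H ζ f)) ∧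
      ‖F ζ‖ ≤ ‖K‖ ^ 2 * ‖resolvent H ζ f‖ ^ 2 ∧ DifferentiableAt ℂ F ζ := by
  set A : 𝓗 →L[ℂ] 𝓗 := ContinuousLinearMap.adjoint K * K with hA
  set F : ℂ → ℂ := fun ζ => inner ℂ f ((resolvent H ζ * A * resolvent H ζ) f) with hF
  refine ⟨F, fun ζ hζ => ?_⟩
  have h0 : F ζ = inner ℂ (K (resolvent H (starRingEnd ℂ ζ) f)) (K (resolvent H ζ f)) := by
    simp only [hF, hA, mul_apply_eq_comp]
    rw [← ContinuousLinearMap.adjoint_inner_right, resolvent_inner hH (by simpa using hζ),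
      Complex.conj_conj]
  refine ⟨h0, ?_, ?_⟩
  · rw [h0]
    calc _ ≤ ‖K (resolvent H (starRingEnd ℂ ζ) f)‖ * ‖K (resolvent H ζ f)‖ :=
          norm_inner_le_norm _ _
      _ ≤ (‖K‖ * ‖resolvent H (starRingEnd ℂ ζ) f‖) * (‖K‖ * ‖resolvent H ζ f‖) := by
          gcongr <;> exact K.le_opNorm _
      _ = _ := by
          rw [resolvent_norm_conj hH hζ]
          ring
  · have h1 := (hasDerivAt_resolvent hH hζ).differentiableAt
    have h2 : DifferentiableAt ℂ (fun ζ => resolvent H ζ * A * resolvent H ζ) ζ :=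
      (h1.mul_const A).mul h1
    exact ((innerSL ℂ f).comp (ContinuousLinearMap.apply ℂ 𝓗 f)).differentiableAt.comp ζ h2

/-- A Hardy space orthogonality: the boundary values from the upper and from the lower half-plane
of `K (H - z)⁻¹ f` are orthogonal in `L²`. The integral is moved to infinity in the
upper half-plane. -/
theorem integral_inner_resolvent_eq_zero (hH : IsSelfAdjoint H) (K : 𝓗 →L[ℂ] 𝓗) {ε : ℝ}
    (hε : 0 < ε) (f : 𝓗) :
    ∫ l : ℝ, inner ℂ (K (resolvent H (l - ε * Complex.I) f))
      (K (resolvent H (l + ε * Complex.I) f)) = 0 := by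
  obtain ⟨F, hF⟩ := exists_holomorphic_inner_resolvent hH K f
  have hFim := fun ζ hζ => (hF ζ hζ).1
  have hFnorm := fun ζ hζ => (hF ζ hζ).2.1
  have hFd := fun ζ hζ => (hF ζ hζ).2.2
  clear hF
  have hint : ∀ η : ℝ, 0 < η → Integrable (fun l : ℝ => F (l + η * Complex.I)) ∧
      ‖∫ l : ℝ, F (l + η * Complex.I)‖ ≤ ‖K‖ ^ 2 * (Real.pi / η * ‖f‖ ^ 2) := by
    intro η hη
    obtain ⟨h1, h2⟩ := integral_norm_resolvent_sq_le hH hη f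
    have hb : ∀ l : ℝ, ‖F (l + η * Complex.I)‖ ≤
        ‖K‖ ^ 2 * ‖resolvent H (l + η * Complex.I) f‖ ^ 2 := fun l =>
      hFnorm _ (by rw [im_add_mul_I]; exact hη.ne')
    have hc : Continuous fun l : ℝ => F (l + η * Complex.I) := by
      rw [continuous_iff_continuousAt]
      intro l
      exact ContinuousAt.comp (f := fun l : ℝ => (l : ℂ) + η * Complex.I)
        (hFd _ (by rw [im_add_mul_I]; exact hη.ne')).continuousAt (by fun_prop)
    refine ⟨(h1.const_mul _).mono' hc.aestronglyMeasurable (Eventually.of_forall hb), ?_⟩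
    refine (norm_integral_le_of_norm_le (h1.const_mul (‖K‖ ^ 2)) (Eventually.of_forall hb)).trans ?_
    rw [integral_const_mul]
    gcongr
  -- the integral over a horizontal line does not depend on its height
  have hshift : ∀ η : ℝ, ε ≤ η →
      ∫ l : ℝ, F (l + ε * Complex.I) = ∫ l : ℝ, F (l + η * Complex.I) := by
    intro η hη
    have hη0 := hε.trans_le hη
    have h1 : ∀ n : ℝ, (∫ x : ℝ in (-n)..n, F (x + ε * Complex.I)) -
        (∫ x : ℝ in (-n)..n, F (x + η * Complex.I)) +
        Complex.I • (∫ y : ℝ in ε..η, F (n + y * Complex.I)) -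
        Complex.I • (∫ y : ℝ in ε..η, F ((-n : ℝ) + y * Complex.I)) = 0 := by
      intro n
      have h2 := Complex.integral_boundary_rect_eq_zero_of_differentiableOn F
        ((-n : ℝ) + ε * Complex.I) (n + η * Complex.I) (fun ζ hζ => by
          refine (hFd ζ ?_).differentiableWithinAt
          have h3 := hζ.2
          simp only [mem_preimage, im_add_mul_I, uIcc_of_le hη] at h3
          exact (hε.trans_le h3.1).ne')
      simpa only [im_add_mul_I, re_add_mul_I] using h2
    have hside : ∀ u : ℝ → ℝ, Tendsto (fun n => |u n|) atTop atTop →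
        Tendsto (fun n => Complex.I • (∫ y : ℝ in ε..η, F (u n + y * Complex.I))) atTop
          (𝓝 0) := by
      intro u hu
      have h2 := ((tendsto_norm_resolvent_zero hH hε f hu).const_mul (‖K‖ ^ 2)).mul_const |η - ε|
      rw [mul_zero, zero_mul] at h2
      refine squeeze_zero_norm (fun n => ?_) h2
      rw [norm_smul, Complex.norm_I, one_mul]
      refine intervalIntegral.norm_integral_le_of_norm_le_const fun y hy => ?_
      rw [uIoc_of_le hη] at hy
      refine (hFnorm _ (by rw [im_add_mul_I]; exact (hε.trans hy.1).ne')).trans ?_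
      exact mul_le_mul_of_nonneg_left (norm_resolvent_le_of_le hH hε hy.1.le _ _) (by positivity)
    have h2 : ∀ ξ : ℝ, 0 < ξ → Tendsto (fun n : ℝ => ∫ x : ℝ in (-n)..n, F (x + ξ * Complex.I))
        atTop (𝓝 (∫ l : ℝ, F (l + ξ * Complex.I))) := fun ξ hξ =>
      intervalIntegral_tendsto_integral (hint ξ hξ).1 tendsto_neg_atTop_atBot tendsto_id
    have h3 := (((h2 ε hε).sub (h2 η hη0)).add (hside (fun n => n) tendsto_abs_atTop_atTop)).sub
      (hside (fun n => -n) (by simpa only [abs_neg] using tendsto_abs_atTop_atTop))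
    have h4 := tendsto_nhds_unique h3 (tendsto_const_nhds.congr fun n => (h1 n).symm)
    rw [add_zero, sub_zero] at h4
    exact sub_eq_zero.1 h4
  have h1 : Tendsto (fun η : ℝ => ‖K‖ ^ 2 * (Real.pi / η * ‖f‖ ^ 2)) atTop (𝓝 0) := by
    have h2 := ((tendsto_const_nhds (x := Real.pi)).div_atTop
      (tendsto_id (α := ℝ) (x := atTop))).mul_const (‖f‖ ^ 2) |>.const_mul (‖K‖ ^ 2)
    simpa using h2
  have h2 : ‖∫ l : ℝ, F (l + ε * Complex.I)‖ ≤ 0 := by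
    refine ge_of_tendsto h1 ?_
    filter_upwards [eventually_ge_atTop ε] with η hη
    rw [hshift η hη]
    exact (hint η (hε.trans_le hη)).2
  rw [← norm_le_zero_iff]
  refine le_trans (le_of_eq ?_) h2
  congr 1
  refine integral_congr_ae (Eventually.of_forall fun l => ?_)
  change _ = F (l + ε * Complex.I)
  rw [hFim _ (by rw [im_add_mul_I]; exact hε.ne')]
  rw [← sub_mul_I_eq_conj]

theorem integral_norm_sq_add_eq (hH : IsSelfAdjoint H) (K : 𝓗 →L[ℂ] 𝓗) {ε : ℝ}
    (hε : 0 < ε) (f : 𝓗) :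
    Integrable (fun l : ℝ => ‖K (resolvent H (l + ε * Complex.I) f)‖ ^ 2 +
      ‖K (resolvent H (l - ε * Complex.I) f)‖ ^ 2) ∧
    ∫ l : ℝ, (‖K (resolvent H (l + ε * Complex.I) f)‖ ^ 2 +
      ‖K (resolvent H (l - ε * Complex.I) f)‖ ^ 2) =
    ∫ l : ℝ, ‖K (resolvent H (l + ε * Complex.I) f - resolvent H (l - ε * Complex.I) f)‖ ^ 2 := by
  obtain ⟨h1, -⟩ := integral_norm_resolvent_sq_le hH hε f
  set u : ℝ → 𝓗 := fun l => K (resolvent H (l + ε * Complex.I) f) with hu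
  set v : ℝ → 𝓗 := fun l => K (resolvent H (l - ε * Complex.I) f) with hv
  have huc : Continuous u := K.continuous.comp (continuous_resolvent_line hH hε.ne' f)
  have hvc : Continuous v := by
    simp only [hv, sub_mul_I_eq_add]
    exact K.continuous.comp (continuous_resolvent_line hH (neg_ne_zero.2 hε.ne') f)
  have hub : ∀ l, ‖u l‖ ^ 2 ≤ ‖K‖ ^ 2 * ‖resolvent H (l + ε * Complex.I) f‖ ^ 2 := fun l => by
    rw [← mul_pow]
    gcongr
    exact K.le_opNorm _
  have hvb : ∀ l, ‖v l‖ ^ 2 ≤ ‖K‖ ^ 2 * ‖resolvent H (l + ε * Complex.I) f‖ ^ 2 := fun l => by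
    rw [← mul_pow]
    simp only [hv]
    rw [← resolvent_norm_conj hH (z := l + ε * Complex.I)
      (by rw [im_add_mul_I]; exact hε.ne'), sub_mul_I_eq_conj]
    gcongr
    exact K.le_opNorm _
  have hui : Integrable fun l => ‖u l‖ ^ 2 := (h1.const_mul _).mono'
    (huc.norm.pow 2).aestronglyMeasurable (Eventually.of_forall fun l => by simpa using hub l)
  have hvi : Integrable fun l => ‖v l‖ ^ 2 := (h1.const_mul _).mono'
    (hvc.norm.pow 2).aestronglyMeasurable (Eventually.of_forall fun l => by simpa using hvb l)
  have hi : Integrable fun l => inner ℂ (v l) (u l) := by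
    refine (hui.add hvi).mono' (hvc.inner huc).aestronglyMeasurable
      (Eventually.of_forall fun l => ?_)
    refine (norm_inner_le_norm _ _).trans ?_
    change _ ≤ ‖u l‖ ^ 2 + ‖v l‖ ^ 2
    nlinarith [sq_nonneg (‖u l‖ - ‖v l‖), norm_nonneg (u l), norm_nonneg (v l)]
  refine ⟨hui.add hvi, ?_⟩
  have h2 : ∀ l : ℝ, ‖K (resolvent H (l + ε * Complex.I) f -
      resolvent H (l - ε * Complex.I) f)‖ ^ 2 =
      (‖u l‖ ^ 2 + ‖v l‖ ^ 2) - 2 * (inner ℂ (v l) (u l)).re := fun l => by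
    rw [_root_.map_sub, norm_sub_sq (𝕜 := ℂ), ← inner_conj_symm]
    change _ - 2 * (starRingEnd ℂ (inner ℂ (v l) (u l))).re + _ = _
    rw [Complex.conj_re]
    ring
  have h3 : ∫ l, (inner ℂ (v l) (u l)).re = (∫ l, inner ℂ (v l) (u l)).re := integral_re hi
  simp_rw [h2]
  have h4 : Integrable fun l => ‖u l‖ ^ 2 + ‖v l‖ ^ 2 := hui.add hvi
  have h5 : Integrable fun l => 2 * (inner ℂ (v l) (u l)).re := hi.re.const_mul 2
  rw [integral_sub h4 h5, integral_const_mul, h3, integral_inner_resolvent_eq_zero hH K hε f]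
  simp [hu, hv]

/-- For `f` in the range of the spectral projection on `[0, ∞)`, the jump of the resolvent
across the real axis at any `l` is `(H - w)⁻¹ v` with `Re w ≥ 0`, and `v` is controlled by
`(H - l - iε)⁻¹ f`. For `l < 0` take `w = iε`; positivity of `H` on the spectral subspace
bounds `v`. -/
theorem exists_resolvent_jump (hH : IsSelfAdjoint H) {f : 𝓗}
    (hf : MemSpectralSubspace H (Ici 0) f) (l : ℝ) {ε : ℝ} (hε : 0 < ε) :
    ∃ (w : ℂ) (v : 𝓗), 0 ≤ w.re ∧ w.im = ε ∧
      ‖v‖ ≤ 2 * ε * ‖resolvent H (l + ε * Complex.I) f‖ ∧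
      resolvent H (l + ε * Complex.I) f - resolvent H (l - ε * Complex.I) f =
        resolvent H w v := by
  set z : ℂ := l + ε * Complex.I with hz
  have hzim : z.im = ε := im_add_mul_I l ε
  have hz0 : z.im ≠ 0 := by rw [hzim]; exact hε.ne'
  have hz1 : (starRingEnd ℂ z).im ≠ 0 := by simpa using hz0
  rw [sub_mul_I_eq_conj, ← hz]
  have hzz : z - starRingEnd ℂ z = 2 * ε * Complex.I := by
    simp [hz]
    ring
  have h1 := resolvent_sub hH hz0 hz1 f
  rw [hzz] at h1
  have h2ε : ‖(2 * ε * Complex.I : ℂ)‖ = 2 * ε := by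
    simp [abs_of_pos hε]
  rcases le_or_gt 0 l with hl | hl
  · refine ⟨z, (2 * ε * Complex.I) • resolvent H (starRingEnd ℂ z) f, by simpa [hz] using hl, hzim,
      ?_, ?_⟩
    · rw [norm_smul, resolvent_norm_conj hH hz0, h2ε]
    · rw [_root_.map_smul, h1]
  · set y : H.domain := ⟨_, resolvent_mem hH hz0 (resolvent H (starRingEnd ℂ z) f)⟩ with hy
    set w : ℂ := ε * Complex.I with hw
    have hw0 : w.im ≠ 0 := by simpa [hw] using hε.ne'
    refine ⟨w, (2 * ε * Complex.I) • (H y - w • (y : 𝓗)), by simp [hw], by simp [hw], ?_, ?_⟩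
    · have hpos := inner_apply_nonneg_of_mem hH hf (z := z) (by rw [hzim]; exact hε) (y := y) rfl
      have h3 : resolvent H (starRingEnd ℂ z) f = H y - z • (y : 𝓗) := by
        rw [hy, apply_resolvent hH hz0]
        simp
      rw [norm_smul, h2ε, ← resolvent_norm_conj hH hz0, h3]
      refine mul_le_mul_of_nonneg_left ?_ (by positivity)
      refine (pow_le_pow_iff_left₀ (norm_nonneg _) (norm_nonneg _) two_ne_zero).1 ?_
      have him := selfAdjoint_inner_self_im hH y
      have hre : (inner ℂ (H y) (y : 𝓗)).re = (inner ℂ (y : 𝓗) (H y)).re := by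
        rw [selfAdjoint_inner_left hH]
      have h4 : ∀ ζ : ℂ, ‖H y - ζ • (y : 𝓗)‖ ^ 2 = ‖H y‖ ^ 2 -
          2 * (ζ.re * (inner ℂ (y : 𝓗) (H y)).re) + ‖ζ‖ ^ 2 * ‖(y : 𝓗)‖ ^ 2 := by
        intro ζ
        rw [norm_sub_sq (𝕜 := ℂ), inner_smul_right, norm_smul, mul_pow]
        change _ - 2 * (ζ * inner ℂ (H y) (y : 𝓗)).re + _ = _
        rw [selfAdjoint_inner_left hH, Complex.mul_re, him]
        ring
      rw [h4, h4]
      have h5 : w.re = 0 := by simp [hw]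
      have h6 : z.re = l := re_add_mul_I l ε
      have h7 : ‖w‖ ^ 2 ≤ ‖z‖ ^ 2 := by
        rw [← Complex.normSq_eq_norm_sq, ← Complex.normSq_eq_norm_sq, Complex.normSq_apply,
          Complex.normSq_apply, h5, h6, hzim]
        have h8 : w.im = ε := by simp [hw]
        rw [h8]
        nlinarith
      have h8 := mul_le_mul_of_nonneg_right h7 (sq_nonneg ‖(y : 𝓗)‖)
      rw [h5, h6]
      nlinarith [mul_nonneg (neg_nonneg.2 hl.le) hpos]
    · rw [_root_.map_smul, resolvent_apply_sub hH hw0, h1]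

theorem norm_regularization_le (hH : IsSelfAdjoint H) {r : ℝ} (hr : 0 < r) (g : 𝓗) :
    ‖(-(r * Complex.I) : ℂ) • resolvent H (r * Complex.I) g‖ ≤ ‖g‖ := by
  have h1 := resolvent_norm_le hH (z := r * Complex.I) (by simpa using hr.ne') g
  rw [Complex.im_ofReal_mul, Complex.I_im, mul_one, abs_of_pos hr] at h1
  rwa [norm_smul, norm_neg, norm_mul, Complex.norm_I, mul_one, Complex.norm_real,
    Real.norm_of_nonneg hr.le]

/-- The regularization `-in (H - in)⁻¹` of the identity, written with `n + 1` in place of `n`. -/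
theorem tendsto_regularization (hH : IsSelfAdjoint H) (f : 𝓗) :
    Tendsto (fun n : ℕ => (-((n + 1 : ℝ) * Complex.I) : ℂ) •
      resolvent H ((n + 1 : ℝ) * Complex.I) f) atTop (𝓝 f) := by
  have him : ∀ n : ℕ, (((n + 1 : ℝ) : ℂ) * Complex.I).im = n + 1 := fun n => by simp
  have hn0 : ∀ n : ℕ, (0 : ℝ) < n + 1 := fun n => by positivity
  have him0 : ∀ n : ℕ, (((n + 1 : ℝ) : ℂ) * Complex.I).im ≠ 0 := fun n => by
    rw [him]; exact (hn0 n).ne'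
  have hI : Complex.I.im ≠ 0 := by simp
  set J : ℕ → 𝓗 →L[ℂ] 𝓗 := fun n => (-((n + 1 : ℝ) * Complex.I) : ℂ) •
      resolvent H ((n + 1 : ℝ) * Complex.I) with hJ
  have hR : ∀ (n : ℕ) g, ‖resolvent H ((n + 1 : ℝ) * Complex.I) g‖ ≤ ‖g‖ / (n + 1) := by
    intro n g
    have h1 := resolvent_norm_le hH (him0 n) g
    rw [him, abs_of_pos (hn0 n)] at h1
    rwa [le_div_iff₀' (hn0 n)]
  have hJ1 : ∀ n g, ‖J n g‖ ≤ ‖g‖ := fun n g => norm_regularization_le hH (hn0 n) g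
  have hJdom : ∀ n (x : H.domain), J n x - x = -resolvent H ((n + 1 : ℝ) * Complex.I) (H x) := by
    intro n x
    have h1 := resolvent_apply_sub hH (him0 n) x
    rw [_root_.map_sub, _root_.map_smul] at h1
    simp only [hJ, _root_.smul_apply]
    nth_rewrite 2 [← h1]
    module
  change Tendsto (fun n => J n f) atTop (𝓝 f)
  rw [Metric.tendsto_atTop]
  intro δ hδ
  have hdense : f ∈ closure (H.domain : Set 𝓗) := hH.dense_domain f
  obtain ⟨x, hx, hfx⟩ := Metric.mem_closure_iff.1 hdense (δ / 3) (by positivity)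
  obtain ⟨N, hN⟩ := exists_nat_gt (‖H ⟨x, hx⟩‖ / (δ / 3))
  refine ⟨N, fun n hn => ?_⟩
  rw [dist_eq_norm] at hfx ⊢
  have h1 : J n f - f = J n (f - x) + (J n x - x) - (f - x) := by
    rw [_root_.map_sub]
    abel
  have h2 : ‖J n x - x‖ < δ / 3 := by
    have h3 := hJdom n ⟨x, hx⟩
    simp only at h3
    rw [h3, norm_neg]
    refine (hR n _).trans_lt ?_
    rw [div_lt_iff₀ (by positivity)] at hN
    rw [div_lt_iff₀ (hn0 n)]
    have h4 : (N : ℝ) ≤ n := by exact_mod_cast hn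
    nlinarith
  rw [h1]
  calc _ ≤ ‖J n (f - x)‖ + ‖J n x - x‖ + ‖f - x‖ :=
        (norm_sub_le _ _).trans (add_le_add_left (norm_add_le _ _) _)
    _ ≤ ‖f - x‖ + ‖J n x - x‖ + ‖f - x‖ := by gcongr; exact hJ1 n _
    _ < δ := by linarith

/-- Kato's criterion on the half-line: a bound of `T (H - z)⁻¹` by a multiple of `|Im z|^{-1/2}`
for `Re z ≥ 0` makes `T` smooth on `[0, ∞)`. -/
theorem exists_smoothness_bound (hH : IsSelfAdjoint H) (T : H.domain →ₗ[ℂ] 𝓗)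
    (hbound : ∃ C : ℝ, 0 ≤ C ∧ ∀ (z : ℂ) (hz : z.im ≠ 0), 0 ≤ z.re → ∀ g,
      √|z.im| * ‖T ⟨resolvent H z g, resolvent_mem hH hz g⟩‖ ≤ C * ‖g‖) :
    ∃ C : ℝ≥0, ∀ f, MemSpectralSubspace H (Ici 0) f → ∀ ε : ℝ, 0 < ε →
      ∀ u v : ℝ → H.domain, (∀ l, (u l : 𝓗) = resolvent H (l + ε * Complex.I) f) →
        (∀ l, (v l : 𝓗) = resolvent H (l - ε * Complex.I) f) →
        ∫⁻ l : ℝ, (‖T (u l)‖ₑ ^ 2 + ‖T (v l)‖ₑ ^ 2) ≤ C * ‖f‖ₑ ^ 2 := by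
  obtain ⟨C, hC, hb⟩ := hbound
  have hI : Complex.I.im ≠ 0 := by simp
  -- the bounded operators `T (H - z)⁻¹`
  let Rz : ∀ z : ℂ, z.im ≠ 0 → 𝓗 →ₗ[ℂ] H.domain := fun z hz =>
    (resolvent H z).toLinearMap.codRestrict H.domain (resolvent_mem hH hz)
  have hRz : ∀ z hz g, ((Rz z hz g : H.domain) : 𝓗) = resolvent H z g := fun z hz g => rfl
  let B : 𝓗 →L[ℂ] 𝓗 := (T ∘ₗ Rz Complex.I hI).mkContinuous C fun g => by
    have h1 := hb Complex.I hI (by simp) g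
    rwa [Complex.I_im, abs_one, Real.sqrt_one, one_mul] at h1
  have hB : ∀ g, B g = T (Rz Complex.I hI g) := fun g => rfl
  have hTR : ∀ z hz g, T (Rz z hz g) = B (g + (z - Complex.I) • resolvent H z g) := by
    intro z hz g
    rw [hB]
    congr 1
    refine Subtype.ext ?_
    rw [hRz z hz, hRz _ hI, _root_.map_add, _root_.map_smul, resolvent_comm hH hI hz,
      ← resolvent_sub hH hz hI]
    abel
  have hn0 : ∀ n : ℕ, (0 : ℝ) < n + 1 := fun n => by positivity
  have him0 : ∀ n : ℕ, (((n + 1 : ℝ) : ℂ) * Complex.I).im ≠ 0 := fun n => by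
    have : (((n + 1 : ℝ) : ℂ) * Complex.I).im = n + 1 := by simp
    rw [this]; exact (hn0 n).ne'
  let J : ℕ → 𝓗 →L[ℂ] 𝓗 := fun n => (-((n + 1 : ℝ) * Complex.I) : ℂ) •
      resolvent H ((n + 1 : ℝ) * Complex.I)
  have hJ1 : ∀ n g, ‖J n g‖ ≤ ‖g‖ :=
    fun n g => norm_regularization_le hH (hn0 n) g
  have hJlim : ∀ g, Tendsto (fun n => J n g) atTop (𝓝 g) := tendsto_regularization hH
  have hJcomm : ∀ n z, z.im ≠ 0 → ∀ g, J n (resolvent H z g) = resolvent H z (J n g) := by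
    intro n z hz g
    simp only [J, _root_.smul_apply, _root_.map_smul]
    rw [resolvent_comm hH (him0 n) hz]
  -- the bounded approximations of `T`
  let K : ℕ → 𝓗 →L[ℂ] 𝓗 := fun n => (-((n + 1 : ℝ) * Complex.I) : ℂ) •
      B.comp (1 + (((n + 1 : ℝ) : ℂ) * Complex.I - Complex.I) •
        resolvent H ((n + 1 : ℝ) * Complex.I))
  have hK : ∀ n g (x : H.domain), (x : 𝓗) = J n g → K n g = T x := by
    intro n g x hx
    have h1 : x = (-((n + 1 : ℝ) * Complex.I) : ℂ) • Rz _ (him0 n) g := Subtype.ext hx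
    rw [h1, _root_.map_smul, hTR _ (him0 n)]
    rfl
  have hKR : ∀ n z (hz : z.im ≠ 0) g, K n (resolvent H z g) = T (Rz z hz (J n g)) :=
    fun n z hz g => hK n _ _ (by rw [hRz z hz, hJcomm n z hz])
  have hKlim : ∀ z (hz : z.im ≠ 0) g,
      Tendsto (fun n => K n (resolvent H z g)) atTop (𝓝 (T (Rz z hz g))) := by
    intro z hz g
    simp_rw [hKR _ z hz, hTR z hz]
    exact (B.continuous.tendsto _).comp ((hJlim g).add
      ((((resolvent H z).continuous.tendsto _).comp (hJlim g)).const_smul _))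
  refine ⟨(4 * Real.pi * C ^ 2).toNNReal, fun f hf ε hε u v hu hv => ?_⟩
  have hzim : ∀ l : ℝ, ((l : ℂ) + ε * Complex.I).im ≠ 0 := fun l => by
    rw [im_add_mul_I]; exact hε.ne'
  have hzim' : ∀ l : ℝ, ((l : ℂ) - ε * Complex.I).im ≠ 0 := fun l => by
    rw [sub_mul_I_eq_add, im_add_mul_I]; exact neg_ne_zero.2 hε.ne'
  have hjump : ∀ n (l : ℝ), ‖K n (resolvent H (l + ε * Complex.I) f -
      resolvent H (l - ε * Complex.I) f)‖ ^ 2 ≤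
      4 * C ^ 2 * ε * ‖resolvent H (l + ε * Complex.I) f‖ ^ 2 := by
    intro n l
    obtain ⟨w, g, hw, hwim, hg, h1⟩ := exists_resolvent_jump hH hf l hε
    have hw0 : w.im ≠ 0 := by rw [hwim]; exact hε.ne'
    rw [h1, hKR n w hw0]
    have h2 := hb w hw0 hw (J n g)
    rw [hwim, abs_of_pos hε] at h2
    have h3 : √ε * ‖T (Rz w hw0 (J n g))‖ ≤ C * (2 * ε * ‖resolvent H (l + ε * Complex.I) f‖) :=
      h2.trans (by gcongr; exact (hJ1 n g).trans hg)
    have h4 := pow_le_pow_left₀ (by positivity) h3 2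
    rw [mul_pow, Real.sq_sqrt hε.le] at h4
    refine le_of_mul_le_mul_left (h4.trans (le_of_eq ?_)) hε
    ring
  have hn : ∀ n, ∫⁻ l : ℝ, (‖K n (resolvent H (l + ε * Complex.I) f)‖ₑ ^ 2 +
      ‖K n (resolvent H (l - ε * Complex.I) f)‖ₑ ^ 2) ≤
      (4 * Real.pi * C ^ 2).toNNReal * ‖f‖ₑ ^ 2 := by
    intro n
    obtain ⟨h1, h2⟩ := integral_norm_sq_add_eq hH (K n) hε f
    obtain ⟨h3, h4⟩ := integral_norm_resolvent_sq_le hH hε f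
    have h5 : ∀ l : ℝ, ‖K n (resolvent H (l + ε * Complex.I) f)‖ₑ ^ 2 +
        ‖K n (resolvent H (l - ε * Complex.I) f)‖ₑ ^ 2 =
        ENNReal.ofReal (‖K n (resolvent H (l + ε * Complex.I) f)‖ ^ 2 +
          ‖K n (resolvent H (l - ε * Complex.I) f)‖ ^ 2) := fun l => by
      rw [ENNReal.ofReal_add (by positivity) (by positivity), ENNReal.ofReal_pow (norm_nonneg _),
        ENNReal.ofReal_pow (norm_nonneg _), ofReal_norm, ofReal_norm]
    simp_rw [h5]
    rw [← ofReal_integral_eq_lintegral_ofReal h1 (Eventually.of_forall fun l => by positivity), h2]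
    have h6 : ∫ l : ℝ, ‖K n (resolvent H (l + ε * Complex.I) f -
        resolvent H (l - ε * Complex.I) f)‖ ^ 2 ≤ 4 * Real.pi * C ^ 2 * ‖f‖ ^ 2 := by
      refine (integral_mono_of_nonneg (Eventually.of_forall fun l => by positivity)
        (h3.const_mul (4 * C ^ 2 * ε)) (Eventually.of_forall (hjump n))).trans ?_
      rw [integral_const_mul]
      refine (mul_le_mul_of_nonneg_left h4 (by positivity)).trans (le_of_eq ?_)
      field_simp
    refine (ENNReal.ofReal_le_ofReal h6).trans (le_of_eq ?_)
    have hpi := Real.pi_pos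
    rw [ENNReal.ofReal_mul (by positivity), ENNReal.ofReal_pow (norm_nonneg _), ofReal_norm]
    rfl
  have hlim : ∀ l : ℝ, Tendsto (fun n => ‖K n (resolvent H (l + ε * Complex.I) f)‖ₑ ^ 2 +
      ‖K n (resolvent H (l - ε * Complex.I) f)‖ₑ ^ 2) atTop
      (𝓝 (‖T (u l)‖ₑ ^ 2 + ‖T (v l)‖ₑ ^ 2)) := by
    intro l
    have h1 : u l = Rz _ (hzim l) f := Subtype.ext (hu l)
    have h2 : v l = Rz _ (hzim' l) f := Subtype.ext (hv l)
    rw [h1, h2]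
    exact (ENNReal.Tendsto.pow (hKlim _ (hzim l) f).enorm).add
      (ENNReal.Tendsto.pow (hKlim _ (hzim' l) f).enorm)
  calc ∫⁻ l : ℝ, (‖T (u l)‖ₑ ^ 2 + ‖T (v l)‖ₑ ^ 2)
      = ∫⁻ l : ℝ, liminf (fun n => ‖K n (resolvent H (l + ε * Complex.I) f)‖ₑ ^ 2 +
          ‖K n (resolvent H (l - ε * Complex.I) f)‖ₑ ^ 2) atTop :=
        lintegral_congr fun l => (hlim l).liminf_eq.symm
    _ ≤ liminf (fun n => ∫⁻ l : ℝ, (‖K n (resolvent H (l + ε * Complex.I) f)‖ₑ ^ 2 +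
          ‖K n (resolvent H (l - ε * Complex.I) f)‖ₑ ^ 2)) atTop := by
        refine lintegral_liminf_le' fun n => ?_
        have h1 := ((K n).continuous.comp (continuous_resolvent_line hH hε.ne' f)).enorm
        have h2 := ((K n).continuous.comp
          (continuous_resolvent_line hH (neg_ne_zero.2 hε.ne') f)).enorm
        simp_rw [sub_mul_I_eq_add]
        exact ((h1.measurable.pow_const 2).add (h2.measurable.pow_const 2)).aemeasurable
    _ ≤ _ := by
        refine liminf_le_of_le ⟨0, by simp⟩ fun b hb' => ?_
        obtain ⟨n, hn'⟩ := hb'.exists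
        exact hn'.trans (hn n)

end Smoothness

/-! ### Resolvent bounds imply smoothness and absolute continuity -/

section Conclusion

variable {𝓗 : Type*} [NormedAddCommGroup 𝓗] [InnerProductSpace ℂ 𝓗] [CompleteSpace 𝓗]
  {H : 𝓗 →ₗ.[ℂ] 𝓗}

theorem isSmoothOn_of_bound (hH : IsSelfAdjoint H) {L : 𝓗 →ₗ.[ℂ] 𝓗} {T : H.domain →ₗ[ℂ] 𝓗}
    (hL : ∀ x : H.domain, ∃ hx : (x : 𝓗) ∈ L.domain, L ⟨x, hx⟩ = T x)
    (hbound : ∃ C : ℝ, 0 ≤ C ∧ ∀ (z : ℂ) (hz : z.im ≠ 0), 0 ≤ z.re → ∀ g,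
      √|z.im| * ‖T ⟨resolvent H z g, resolvent_mem hH hz g⟩‖ ≤ C * ‖g‖) :
    IsSmoothOn H L (Ici 0) := by
  obtain ⟨C, hC⟩ := exists_smoothness_bound hH T hbound
  have heval : ∀ x : H.domain, evalOrZero L x = T x := fun x => by
    obtain ⟨hx, h⟩ := hL x
    rw [evalOrZero, dif_pos hx, h]
  refine ⟨C, fun f hf ε hε => ?_⟩
  have h1 : ∀ l : ℝ, ((l : ℂ) + ε * Complex.I).im ≠ 0 := fun l => by
    rw [im_add_mul_I]; exact hε.ne'
  have h2 : ∀ l : ℝ, ((l : ℂ) - ε * Complex.I).im ≠ 0 := fun l => by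
    rw [sub_mul_I_eq_add, im_add_mul_I]; exact neg_ne_zero.2 hε.ne'
  refine ⟨Eventually.of_forall fun l => ⟨(hL ⟨_, resolvent_mem hH (h1 l) f⟩).1,
    (hL ⟨_, resolvent_mem hH (h2 l) f⟩).1⟩, ?_⟩
  refine le_trans (le_of_eq (lintegral_congr fun l => ?_))
    (hC f hf ε hε (fun l => ⟨_, resolvent_mem hH (h1 l) f⟩)
      (fun l => ⟨_, resolvent_mem hH (h2 l) f⟩) (fun l => rfl) (fun l => rfl))
  rw [← heval, ← heval]

theorem hasACSpectrumOn_of_dualGenerator (hH : IsSelfAdjoint H) {E : Type*}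
    [NormedAddCommGroup E] [InnerProductSpace ℂ E] [CompleteSpace E] {U : ℝ → E →L[ℂ] E}
    (hU : IsC0Group U) (J : H.domain →ₗ[ℂ] E) (hJ : ∀ x, J x = 0 → x = 0)
    (hbound : ∀ e : GraphSpace (generator (dualGroup U)), ∃ C : ℝ, 0 ≤ C ∧
      ∀ (z : ℂ) (hz : z.im ≠ 0), 0 ≤ z.re → ∀ g,
      √|z.im| * ‖dualGeneratorIncl U e (J ⟨resolvent H z g, resolvent_mem hH hz g⟩)‖ ≤
        C * ‖g‖) : HasACSpectrumOn H (Ici 0) := by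
  -- the conjugates of the antilinear functionals `e ∈ D(A, 𝓢*)`
  let ℓ : GraphSpace (generator (dualGroup U)) → E →ₗ[ℂ] ℂ := fun e =>
    { toFun := fun x => starRingEnd ℂ (dualGeneratorIncl U e x)
      map_add' := fun x y => by simp
      map_smul' := fun c x => by simp }
  have hℓ : ∀ e x, ℓ e x = starRingEnd ℂ (dualGeneratorIncl U e x) := fun e x => rfl
  refine hasACSpectrumOn_of_functionals hH (range fun e => ℓ e ∘ₗ J) ?_ fun x hx => ?_
  · rintro _ ⟨e, rfl⟩
    obtain ⟨C, hC, h⟩ := hbound e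
    refine ⟨C, hC, fun z hz hz' g => ?_⟩
    rw [LinearMap.comp_apply, hℓ, RCLike.norm_conj]
    exact h z hz hz' g
  · refine hJ x (eq_zero_of_forall_generator hU fun e => ?_)
    have h1 := hx _ (mem_range_self e)
    rw [LinearMap.comp_apply, hℓ] at h1
    exact (map_eq_zero _).1 h1

theorem toEnergy_eq_zero {V : Type*} [NormedAddCommGroup V] [NormedSpace ℂ V]
    {S : V →L[ℂ] AntiDual V} (hS : IsStrictlyPos S) {f : V} (h : toEnergy hS f = 0) : f = 0 := by
  by_contra hf
  have h1 := (hS f hf).2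
  rw [← inner_toEnergy hS, h, inner_zero_left] at h1
  exact lt_irrefl _ h1

theorem exists_bound_of_submodule {V F : Type*} [NormedAddCommGroup V] [NormedSpace ℂ V]
    [NormedAddCommGroup F] [NormedSpace ℂ F] (M : Submodule ℂ V) (T : M →L[ℂ] F) :
    ∃ c : ℝ, 0 ≤ c ∧ ∀ x : M, ‖T x‖ ≤ c * ‖(x : V)‖ :=
  ⟨‖T‖, norm_nonneg T, fun x => T.le_opNorm x⟩

theorem exists_norm_toDualClosure_le {X F : Type*} [NormedAddCommGroup X] [NormedSpace ℂ X]
    [NormedAddCommGroup F] [NormedSpace ℂ F] {U : ℝ → X →L[ℂ] X} (T : dualClosure U →L[ℂ] F) :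
    ∃ c : ℝ, 0 ≤ c ∧ ∀ x, ‖T (toDualClosure U x)‖ ≤
      c * ‖toInterpDual (dualGeneratorIncl U) x‖ := by
  obtain ⟨c, hc, h⟩ := exists_bound_of_submodule (dualClosure U) T
  exact ⟨c, hc, fun x => h (toDualClosure U x)⟩

end Conclusion

end WeakConj

theorem corollary2p2 {𝓗 : Type*} [NormedAddCommGroup 𝓗] [InnerProductSpace ℂ 𝓗] [CompleteSpace 𝓗]
    -- the self-adjoint operator `H`, and the unitary group `W_t = e^{itA}` leaving `D(H)` invariant
    (H : 𝓗 →ₗ.[ℂ] 𝓗) (hH : IsSelfAdjoint H)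
    (W : ℝ → 𝓗 →L[ℂ] 𝓗) (hW : WeakConj.IsC0Group W) (hWu : ∀ t, W t ∈ unitary (𝓗 →L[ℂ] 𝓗))
    (hWH : ∀ t, ∀ f : H.domain, W t f ∈ H.domain)
    -- `H` is of class `C¹(A; 𝓖², 𝓗)`
    (hHC1 : ∀ f : H.domain, Differentiable ℝ (WeakConj.conjOrbit H W hWH f))
    -- `S = -c₁ H + [iH, A] > 0` and `[iH, A] ≥ -c₂`
    (c₁ c₂ : ℝ) (hc₁ : 0 < c₁) (hc₂ : 0 < c₂)
    (hS : WeakConj.IsStrictlyPos (WeakConj.weakForm H W hWH c₁))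
    (hbelow : ∀ f : H.domain,
      -c₂ * ‖(f : 𝓗)‖ ^ 2 ≤ (inner ℂ (f : 𝓗) (WeakConj.commutator H W hWH f)).re)
    -- `W` extends to a `C₀`-group in the completion `𝓢`
    (U : ℝ → WeakConj.Energy _ hS →L[ℂ] WeakConj.Energy _ hS) (hU : WeakConj.IsC0Group U)
    (hUW : ∀ (t : ℝ) (f f' : WeakConj.FormDomain H),
      WeakConj.GraphSpace.incl _ f' = W t (WeakConj.GraphSpace.incl _ f) →
        U t (WeakConj.toEnergy hS f) = WeakConj.toEnergy hS f')
    -- `[iH, A]` extends to an element of `C¹(A; 𝓢, 𝓢*)`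
    (hBC1 : ∃ B : WeakConj.Energy _ hS →L[ℂ] WeakConj.AntiDual (WeakConj.Energy _ hS),
      (∀ f g : WeakConj.FormDomain H, B (WeakConj.toEnergy hS f) (WeakConj.toEnergy hS g) =
        WeakConj.formExtension H (WeakConj.commutator H W hWH) f g) ∧
      ∀ x, Differentiable ℝ fun t => WeakConj.dualGroup U (-t) (B (U t x))) :
    (∀ T : WeakConj.dualClosure U →L[ℂ] 𝓗,
      WeakConj.IsSmoothOn H (WeakConj.asOperator T) (Set.Ici 0)) ∧
    WeakConj.HasACSpectrumOn H (Set.Ici 0) := by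
  obtain ⟨⟨C, hC, hinterp⟩, hgen⟩ :=
    WeakConj.exists_bound_resolvent hH hW hWu hHC1 hc₁ hS hU hUW hBC1
  constructor
  · intro T
    obtain ⟨c, hc, hT⟩ := WeakConj.exists_norm_toDualClosure_le T
    refine WeakConj.isSmoothOn_of_bound hH (T := T.toLinearMap ∘ₗ WeakConj.toDualClosure U ∘ₗ
      WeakConj.toEnergy hS ∘ₗ WeakConj.domainIncl hH)
      (fun x => ⟨WeakConj.domain_le_formDomain hH x.2, rfl⟩)
      ⟨c * C, by positivity, fun z hz hz' g => ?_⟩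
    set y := WeakConj.toEnergy hS
      (WeakConj.domainIncl hH ⟨WeakConj.resolvent H z g, WeakConj.resolvent_mem hH hz g⟩)
    calc √|z.im| * ‖T (WeakConj.toDualClosure U y)‖
        ≤ √|z.im| * (c * ‖WeakConj.toInterpDual (WeakConj.dualGeneratorIncl U) y‖) := by
          gcongr
          exact hT y
      _ = c * (√|z.im| * ‖WeakConj.toInterpDual (WeakConj.dualGeneratorIncl U) y‖) := by ring
      _ ≤ c * (C * ‖g‖) := by
          exact mul_le_mul_of_nonneg_left (hinterp z hz hz' g) hc
      _ = c * C * ‖g‖ := by ring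
  · refine WeakConj.hasACSpectrumOn_of_dualGenerator hH hU
      (WeakConj.toEnergy hS ∘ₗ WeakConj.domainIncl hH) (fun x hx => ?_) hgen
    have h1 : WeakConj.domainIncl hH x = 0 := WeakConj.toEnergy_eq_zero hS hx
    exact Subtype.ext (congrArg (WeakConj.GraphSpace.incl _) h1)
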